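/- **Setting.** Let $d\ge 2$, $n\ge 0$, $\nu>0$, $T>0$, $\bar\alpha^1,\dots,\bar\alpha^n\in\mathbb N^d$, $\beta_1,\dots,\beta_n\in\{0,\dots,d\}$, and let $f_0,\dots,f_d:\mathbb R^n\to\mathbb R$ be $\mathcal C^\infty$, where $f_0$ depends only on the variables $z_j$ with $\beta_j\neq 0$. For $w=(w_0,\dots,w_d)$ put $J(w)=(\partial_{\bar\alpha^1}w_{\beta_1},\dots,\partial_{\bar\alpha^n}w_{\beta_n})$ and, for $g:\mathbb R^n\to\mathbb R$, $g^*(w)=g(J(w))$. Let $N(y)=|y|^2\log|y|$ if $d=2$, $N(y)=|y|^2/(2-d)$ if $d\ge3$, $k(y)=\frac{\Gamma(d/2)}{2\pi^{d/2}}\frac{N(y)}{|y|^d}$, with $|y|$ the Euclidean norm, and $\varphi_{\sigma^2}(t,x)=(2\pi\sigma^2t)^{-d/2}e^{-|x|^2/(2\sigma^2t)}$. Let $u=(u_0,\dots,u_d)$ be a smooth solution on $[0,T]\times\mathbb R^d$ of $$\partial_tu_i+\nu\Delta u_i+f_i^*(u)=0,\quad u_i(T,\cdot)=\phi_i\quad(1\le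 i\le d),\qquad \Delta u_0=f_0^*(u),$$ where $u_0$ is the Newtonian potential solution $u_0(t,x)=\int_{\mathbb R^d}k(y)f_0^*(u)(t,x+y)\,dy$. Smooth means: each $u_i$ is differentiable in $t$ on $[0,T]$, and $u_i$ and $\partial_tu_i$ are infinitely differentiable in $x$, with all $x$-derivatives continuous on $[0,T]\times\mathbb R^d$. Put $\phi_0(x)=\int k(y)f_0^*(\phi)(x+y)\,dy$, so that $u(T,\cdot)=(\phi_0,\dots,\phi_d)$. **Codes.** $\mathcal C$ consists of the codes $\mathrm{Id}_i$, $(a\partial_\lambda f_i)^*$, $(a\partial_\mu,i)$ and $(\partial_\mu,-1)$, with $a\in\mathbb R$, $\lambda\in\mathbb N^n$, $\mu\in\mathbb N^d$, $0\le i\le d$; here $(a\partial_\lambda f_i)^*=g^*$ is labelled by the function $g=a\partial_\lambda f_i$. They act by $\mathrm{Id}_i(u)=u_i$, $g^*(u)=g(J(u))$, $(a\partial_\mu,i)(u)=a\partial_\mu u_i$, $(\partial_\mu,-1)(u)=\partial_\mu(\partial_t+\nu\Delta)u_0$. The codes $\mathrm{Id}_0$, $(a\partial_\mu,0)$ and $(\partial_\mu,-1)$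 are called Poisson codes. **Mechanism.** For $A\subset\{1,\dots,n\}$, $\mu\in\mathbb N^d$, $g:\mathbb R^n\to\mathbb R$ and a code sequence $Y$, the family $\mathrm{fdb}_A(\mu,g,Y)$ has one member for each family $(k_l)_{0\ne l\le\mu}$ in $\mathbb N^n$ with $\sum_l|k_l|\,l=\mu$ and $k_l^i=0$ for $i\notin A$. This member is the sequence $Y$, followed by $$\Big(\tfrac{\mu!}{\prod_{l,i}k_l^i!\,(l!)^{k_l^i}}\,\partial_\lambda g\Big)^*,\qquad\lambda=\sum_lk_l,$$ and, for all $l,i$, by $k_l^i$ copies of $(\partial_{l+\bar\alpha^i},\beta_i)$. (For $\mu=0$ the only member is $Y$ followed by $g^*$.) Write $\mathrm{fdb}$ when $A$ is the set of all indices and $\mathrm{fdb}_0$ when $A=\{j:\beta_j\ne0\}$. The mechanism $\mathcal M$ maps each code to a finite family of code sequences, counted with multiplicity ($\mathbf 1_r$ is the $r$-th unit multi-index): - $\mathcal M(\mathrm{Id}_i)=\{(f_i^*)\}$; $\mathcal M((a\partial_\mu,i))=\mathrm{fdb}(\mu,af_i,\emptyset)$ for $i\ge1$; $\mathcal M((a\partial_\mu,0))=\mathrm{fdb}_0(\mu,af_0,\emptyset)$.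 - $\mathcal M(g^*)$ consists of $\mathrm{fdb}(\bar\alpha^r,f_{\beta_r},((\partial_{\mathbf 1_r}g)^*))$ for $\beta_r\ne0$; of $\big((-\nu\partial_{\mathbf 1_i+\mathbf 1_j}g)^*,(\partial_{\bar\alpha^i+\mathbf 1_k},\beta_i),(\partial_{\bar\alpha^j+\mathbf 1_k},\beta_j)\big)$ for $1\le i,j\le n$, $1\le k\le d$; and of $\big((-\partial_{\mathbf 1_r}g)^*,(\partial_{\bar\alpha^r},-1)\big)$ for $\beta_r=0$. - $\mathcal M((\partial_\mu,-1))$ consists of $\mathrm{fdb}_0\big(\gamma,\partial_{\mathbf 1_i+\mathbf 1_j}f_0,\big((\nu\binom\mu\ell\binom\ell\gamma\partial_{\mu-\ell+\bar\alpha^i+\mathbf 1_k},\beta_i),(\partial_{\ell-\gamma+\bar\alpha^j+\mathbf 1_k},\beta_j)\big)\big)$ for $\beta_i,\beta_j\neq0$, $1\le k\le d$, $0\le\gamma\le\ell\le\mu$; and of $\mathrm{fdb}(\mu-\ell+\bar\alpha^i,f_{\beta_i},Y)$ for $\beta_i\ne0$, $0\le\ell\le\mu$ and $Y\in\mathrm{fdb}_0(\ell,-\binom\mu\ell\partial_{\mathbf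 1_i}f_0,\emptyset)$. **Integrability conditions on $u$.** For every $c\in\mathcal C$ and $\varepsilon>0$ the function $e^{-\varepsilon|x|^2}c(u)(t,x)$ is bounded on $[0,T]\times\mathbb R^d$. For every Poisson code $c$ and $Z\in\mathcal M(c)$ there is $G:\mathbb R^d\to\mathbb R$ with $|\prod_{z\in Z}z(u)(t,y)|\le G(y)$ for all $t\in[0,T]$, $y\in\mathbb R^d$, such that $y\mapsto k(y)G(x+y)$ is integrable for every $x$. **Integral system.** A family $v=(v_c)$ of functions of $(t,x)$ solves (S) if, with all integrals absolutely convergent, for all $t\in[0,T]$, $x\in\mathbb R^d$, $$v_c(t,x)=\sum_{Z\in\mathcal M(c)}\int_0^\infty\!\!\int_{\mathbb R^d}\varphi_1(s,y)\frac{N(y)}{2s}\prod_{z\in Z}v_z(t,x+y)\,dy\,ds$$ for every Poisson code $c$, and for every other $c\in\mathcal C$ $$v_c(t,x)=\int_{\mathbb R^d}\varphi_{2\nu}(T-t,y-x)\,c(u)(T,y)\,dy+\sum_{Z\in\mathcal M(c)}\int_t^T\!\!\int_{\mathbb R^d}\varphi_{2\nu}(s-t,y-x)\prod_{z\in Z}v_z(s,y)\,dy\,ds,$$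 which for $t=T$ means $v_c(T,x)=c(u)(T,x)$. **Random tree.** Let $\rho,\tilde\rho$ be measurable probability densities on $\mathbb R_+$, positive on $(0,\infty)$, and let $\bar F$ be the tail distribution function of $\rho$. The random variable $\mathcal H(t,x,c)$ is the output of the following recursive procedure $\mathrm{TREE}(t,x,c)$, all draws in all calls being independent. Let $r_c$ be the size of $\mathcal M(c)$ and draw $I_c$ uniformly from $\mathcal M(c)$. (When $r_c=0$, the output of a branching step is $0$.) - If $c$ is a Poisson code, draw $\tilde\tau\sim\tilde\rho$ and $W\sim\mathcal N(0,\tilde\tau I_d)$; the output is $\frac{r_cN(W)}{2\tilde\tau\tilde\rho(\tilde\tau)}\prod_{z\in I_c}\mathrm{TREE}(t,x+W,z)$. - Otherwise draw $\tau\sim\rho$. If $t+\tau>T$, draw $W\sim\mathcal N(0,2\nu(T-t)I_d)$; the output is $c(u)(T,x+W)/\bar F(T-t)$. If $t+\tau\le T$, draw $W\sim\mathcal N(0,2\nu\tau I_d)$; the output is $\frac{r_c}{\rho(\tau)}\prod_{z\in I_c}\mathrm{TREE}(t+\tau,x+W,z)$. If the procedure does not terminate, $\mathcal H(t,x,c)=0$.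 **Proposition.** Assume that $\mathbb E[|\mathcal H(t,x,c)|]<\infty$ for all $c\in\mathcal C$ and $(t,x)\in[0,T]\times\mathbb R^d$, and that (S) has at most one solution on $\mathcal C\times[0,T]\times\mathbb R^d$ within some class $\mathcal V$ of families $(v_c)$ that contains both $(c(u))_c$ and $(\mathbb E[\mathcal H(\cdot,\cdot,c)])_c$ (for example, the class of all families). Then $$u_i(t,x)=\mathbb E[\mathcal H(t,x,\mathrm{Id}_i)],\qquad(t,x)\in[0,T]\times\mathbb R^d,\quad i=0,1,\dots,d.$$ -/

import Mathlib

open MeasureTheory ProbabilityTheory Filter Topology Set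

namespace CodedTree

noncomputable section

/-- Euclidean space `ℝᵐ`; multi-indices in `ℕᵐ` are functions `Fin m → ℕ`. -/
abbrev E (m : ℕ) : Type := EuclideanSpace ℝ (Fin m)

/-- The partial derivative `∂g / ∂x_i`. -/
def pd {m : ℕ} (i : Fin m) (g : E m → ℝ) : E m → ℝ :=
  fun x => lineDeriv ℝ g x (EuclideanSpace.single i 1)

/-- The multi-index derivative `∂_μ g = ∂₁^{μ₁} ⋯ ∂_m^{μ_m} g`. -/
def mderiv {m : ℕ} (μ : Fin m → ℕ) (g : E m → ℝ) : E m → ℝ :=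
  (List.finRange m).foldr (fun i h => (pd i)^[μ i] h) g

/-- The indicator multi-index `1_p`. -/
abbrev unitIdx {m : ℕ} (p : Fin m) : Fin m → ℕ := Pi.single p 1

/-- The heat kernel `φ_{σ²}(t, x)` on `ℝᵈ` (Gaussian density of variance `σ² t` per coordinate),
where `s2` stands for `σ²`. -/
def heatKernel {d : ℕ} (s2 t : ℝ) (x : E d) : ℝ :=
  Real.exp (-‖x‖ ^ 2 / (2 * s2 * t)) / (2 * Real.pi * s2 * t) ^ ((d : ℝ) / 2)

/-- The function `N`: `N(y) = |y|² log |y|` if `d = 2`, and `N(y) = |y|² / (2 - d)` if `d ≥ 3`. -/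
def poissonN {d : ℕ} (y : E d) : ℝ :=
  if d = 2 then ‖y‖ ^ 2 * Real.log ‖y‖ else ‖y‖ ^ 2 / (2 - (d : ℝ))

/-- The kernel `Γ(d/2) / (2 π^{d/2}) · N(y) / |y|ᵈ`, the fundamental solution of the Laplacian. -/
def newtonKernel {d : ℕ} (y : E d) : ℝ :=
  Real.Gamma ((d : ℝ) / 2) / (2 * Real.pi ^ ((d : ℝ) / 2)) * (poissonN y / ‖y‖ ^ d)

/-! ### The system of PDEs -/

/-- The data of the coupled system on `[0,T] × ℝᵈ`:
`∂_t u_i + ν Δ u_i + f_i(∂_{α¹} u_{β₁}, …, ∂_{αⁿ} u_{βₙ}) = 0` for `i = 1, …, d`,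
`Δ u_0 = f_0(∂_{αʲ} u_{β_j} : β_j ≠ 0)`, and `u_i(T, ·) = φ_i` for `i = 1, …, d`.
The arguments that involve `u_0` are those with `β_j = 0`, and `f_0` does not depend on them. -/
structure PDESystem (d n : ℕ) where
  /-- viscosity -/
  ν : ℝ
  /-- time horizon -/
  T : ℝ
  /-- order of differentiation of the `j`-th argument -/
  α : Fin n → (Fin d → ℕ)
  /-- component of `u` that appears in the `j`-th argument -/
  β : Fin n → Fin (d + 1)
  /-- nonlinearities `f_0, …, f_d` -/
  f : Fin (d + 1) → E n → ℝ
  /-- terminal data `φ_1, …, φ_d` (shifted to the index set `0, …, d-1`) -/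
  φ : Fin d → E d → ℝ
  ν_pos : 0 < ν
  T_pos : 0 < T
  f_smooth : ∀ i, ContDiff ℝ ((⊤ : ℕ∞) : WithTop ℕ∞) (f i)
  f_zero_indep : ∀ z z' : E n, (∀ j, β j ≠ 0 → z j = z' j) → f 0 z = f 0 z'

variable {d n : ℕ}

namespace PDESystem

variable (S : PDESystem d n)

/-- `(∂_{α¹} w_{β₁}(y), …, ∂_{αⁿ} w_{βₙ}(y))` for a function `w = (w_0, …, w_d)` of space. -/
def jet (w : Fin (d + 1) → E d → ℝ) (y : E d) : E n :=
  WithLp.toLp 2 (fun j => mderiv (S.α j) (w (S.β j)) y)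

/-- `φ_0`, the Newtonian potential of `f_0` applied to the derivatives of `φ_1, …, φ_d`
(the entry put in for the index `0` is irrelevant). -/
def phiZero (x : E d) : ℝ :=
  ∫ y : E d, newtonKernel y * S.f 0 (S.jet (Fin.cons (fun _ => 0) S.φ) (x + y))

/-- `(φ_0, φ_1, …, φ_d)`. -/
def phiAll : Fin (d + 1) → E d → ℝ := Fin.cons S.phiZero S.φ

end PDESystem

/-- `𝒞^{0,∞}([0,T] × ℝᵈ)`: infinitely differentiable in space, with all spatial derivatives
continuous on `[0,T] × ℝᵈ`. -/
def IsC0Infty (T : ℝ) (w : ℝ → E d → ℝ) : Prop :=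
  (∀ t ∈ Icc 0 T, ContDiff ℝ ((⊤ : ℕ∞) : WithTop ℕ∞) (w t)) ∧
  ∀ μ : Fin d → ℕ,
    ContinuousOn (fun p : ℝ × E d => mderiv μ (w p.1) p.2) (Icc 0 T ×ˢ univ)

/-- The time derivative on `[0,T]`, one-sided at the end points. -/
def timeDeriv (T : ℝ) (w : ℝ → E d → ℝ) : ℝ → E d → ℝ :=
  fun t x => derivWithin (fun s => w s x) (Icc 0 T) t

/-- `𝒞^{1,∞}([0,T] × ℝᵈ)`: differentiable in time, with `w` and `∂_t w` in `𝒞^{0,∞}`. -/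
def IsC1Infty (T : ℝ) (w : ℝ → E d → ℝ) : Prop :=
  IsC0Infty T w ∧
  (∀ x, DifferentiableOn ℝ (fun s => w s x) (Icc 0 T)) ∧
  IsC0Infty T (timeDeriv T w)

/-- `(∂_t + ν Δ) w`. -/
def heatOp (ν T : ℝ) (w : ℝ → E d → ℝ) : ℝ → E d → ℝ :=
  fun t x => timeDeriv T w t x + ν * Laplacian.laplacian (w t) x

/-- `u` is a smooth solution of the system. The Poisson equation determines `u_0` only up to
harmonic functions; as usual its solution is the one given by the Newtonian potential. -/
structure PDESystem.IsClassicalSolution (S : PDESystem d n)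
    (u : Fin (d + 1) → ℝ → E d → ℝ) : Prop where
  smooth : ∀ i, IsC1Infty S.T (u i)
  parabolic : ∀ i : Fin d, ∀ t ∈ Icc 0 S.T, ∀ x,
    heatOp S.ν S.T (u i.succ) t x + S.f i.succ (S.jet (fun k => u k t) x) = 0
  poisson : ∀ t ∈ Icc 0 S.T, ∀ x,
    Laplacian.laplacian (u 0 t) x = S.f 0 (S.jet (fun k => u k t) x)
  potential : ∀ t ∈ Icc 0 S.T, ∀ x,
    u 0 t x = ∫ y : E d, newtonKernel y * S.f 0 (S.jet (fun k => u k t) (x + y))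
  terminal : ∀ i : Fin d, u i.succ S.T = S.φ i

/-! ### Codes -/

/-- Codes: `Id_i`, `g^*`, `(a ∂_μ, i)` and `(∂_μ, -1)`. -/
inductive Code (d n : ℕ) : Type
  | ident (i : Fin (d + 1)) : Code d n
  | star (g : E n → ℝ) : Code d n
  | deriv (a : ℝ) (μ : Fin d → ℕ) (i : Fin (d + 1)) : Code d n
  | heat (μ : Fin d → ℕ) : Code d n

/-- The codes `Id_0`, `(a ∂_μ, 0)` and `(∂_μ, -1)`, which are governed by a Poisson equation. -/
def Code.IsPoisson : Code d n → Prop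
  | .ident i => i = 0
  | .star _ => False
  | .deriv _ _ i => i = 0
  | .heat _ => True

namespace PDESystem

variable (S : PDESystem d n)

/-- The set `𝒞` of codes: `g^*` belongs to it only for `g = a ∂_λ f_i`. -/
def codes : Set (Code d n) :=
  {c | match c with
    | .star g => ∃ (a : ℝ) (l : Fin n → ℕ) (i : Fin (d + 1)), g = a • mderiv l (S.f i)
    | _ => True}

/-- The action `c(u)(t, x)` of a code. -/
def eval (c : Code d n) (u : Fin (d + 1) → ℝ → E d → ℝ) (t : ℝ) (x : E d) : ℝ :=
  match c with
  | .ident i => u i t x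
  | .star g => g (S.jet (fun k => u k t) x)
  | .deriv a μ i => a * mderiv μ (u i t) x
  | .heat μ => mderiv μ (heatOp S.ν S.T (u 0) t) x

/-- The terminal value `c(u)(T, y)`, written through the data `u(T, ·) = (φ_0, …, φ_d)`.
It is used only for codes that are not governed by a Poisson equation, so that the value for
`(∂_μ, -1)` is irrelevant. -/
def terminalValue (c : Code d n) (y : E d) : ℝ :=
  match c with
  | .ident i => S.phiAll i y
  | .star g => g (S.jet S.phiAll y)
  | .deriv a μ i => a * mderiv μ (S.phiAll i) y
  | .heat _ => 0

end PDESystem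

/-! ### The branching mechanism -/

/-- The nonzero multi-indices `l ≤ μ`. -/
def blocks (μ : Fin d → ℕ) : Finset (Fin d → ℕ) := (Finset.Icc 0 μ).erase 0

/-- The index set of the multivariate Faà di Bruno formula for `∂_μ (g ∘ v)`: families
`k = (k_l)` of elements of `ℕⁿ`, indexed by the multi-indices `l ≠ 0`, such that
`∑_l |k_l| l = μ`. The finitely many `l` with `k_l ≠ 0`, listed in increasing order, are the
`l¹ ≺ ⋯ ≺ lˢ` of the formula, with `k_{lʳ}` for `k_r`; for `μ = 0` the only element is the
empty family, which stands for the term `g ∘ v` itself. Only the variables of `g` in `A` are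
used. -/
def fdbIndex (A : Finset (Fin n)) (μ : Fin d → ℕ) : Finset (blocks μ → Fin n → ℕ) :=
  (Fintype.piFinset fun _ => Fintype.piFinset fun _ => Finset.range (∑ j, μ j + 1)).filter
    fun k => (∑ l : blocks μ, ∑ i, k l i • (l : Fin d → ℕ)) = μ ∧ ∀ l i, i ∉ A → k l i = 0

/-- The coefficient `∏ μ_j! / ∏_{i,r} k_r^i! (l_1^r! ⋯ l_d^r!)^{k_r^i}`. -/
def fdbCoeff (μ : Fin d → ℕ) (k : blocks μ → Fin n → ℕ) : ℝ :=
  (∏ j, ((μ j).factorial : ℝ)) /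
    ∏ l : blocks μ, ∏ i, (((k l i).factorial : ℝ) *
      (∏ j, (((l : Fin d → ℕ) j).factorial : ℝ)) ^ k l i)

namespace PDESystem

variable (S : PDESystem d n)

/-- The code sequence of one term of the Faà di Bruno formula, preceded by `pre`. -/
def fdbTerm (μ : Fin d → ℕ) (g : E n → ℝ) (pre : List (Code d n))
    (k : blocks μ → Fin n → ℕ) : List (Code d n) :=
  pre ++ [Code.star (fdbCoeff μ k • mderiv (fun i => ∑ l, k l i) g)] ++
    (Finset.univ : Finset (blocks μ × Fin n)).toList.flatMap fun p =>
      List.replicate (k p.1 p.2) (Code.deriv 1 ((p.1 : Fin d → ℕ) + S.α p.2) (S.β p.2))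

/-- `fdb(μ, g, pre)`, enumerated term by term, for `g` a function of the variables in `A`. -/
def fdb (A : Finset (Fin n)) (μ : Fin d → ℕ) (g : E n → ℝ) (pre : List (Code d n)) :
    List (List (Code d n)) :=
  (fdbIndex A μ).toList.map (S.fdbTerm μ g pre)

/-- The variables on which `f_i` depends: all of them if `i ≠ 0`, and those with `β_j ≠ 0`
(the last `n - q` ones) if `i = 0`. -/
def args (i : Fin (d + 1)) : Finset (Fin n) :=
  if i = 0 then Finset.univ.filter (fun j => S.β j ≠ 0) else Finset.univ

/-- The mechanism `𝓜`. The elements of `𝓜(c)` are enumerated with multiplicity, one for each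
term of the corresponding differentiation formula. -/
def mechanism : Code d n → List (List (Code d n))
  | .ident i => [[Code.star (S.f i)]]
  | .deriv a μ i => S.fdb (S.args i) μ (a • S.f i) []
  | .star g =>
      ((List.finRange n).filter (fun r => S.β r ≠ 0)).flatMap (fun r =>
        S.fdb Finset.univ (S.α r) (S.f (S.β r)) [Code.star (mderiv (unitIdx r) g)]) ++
      ((List.finRange n).flatMap fun i => (List.finRange n).flatMap fun j =>
        (List.finRange d).map fun k =>
          [Code.star ((-S.ν) • mderiv (unitIdx i + unitIdx j) g),
            Code.deriv 1 (S.α i + unitIdx k) (S.β i),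
            Code.deriv 1 (S.α j + unitIdx k) (S.β j)]) ++
      ((List.finRange n).filter (fun r => S.β r = 0)).map (fun r =>
        [Code.star (-(mderiv (unitIdx r) g)), Code.heat (S.α r)])
  | .heat μ =>
      (((List.finRange n).filter (fun i => S.β i ≠ 0)).flatMap fun i =>
        ((List.finRange n).filter (fun j => S.β j ≠ 0)).flatMap fun j =>
        (List.finRange d).flatMap fun k =>
        (Finset.Icc 0 μ).toList.flatMap fun l =>
        (Finset.Icc 0 l).toList.flatMap fun γ =>
          S.fdb (S.args 0) γ (mderiv (unitIdx i + unitIdx j) (S.f 0))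
            [Code.deriv (S.ν * ∏ r, (((μ r).choose (l r) : ℝ) * ((l r).choose (γ r) : ℝ)))
                (μ - l + S.α i + unitIdx k) (S.β i),
              Code.deriv 1 (l - γ + S.α j + unitIdx k) (S.β j)]) ++
      (((List.finRange n).filter (fun i => S.β i ≠ 0)).flatMap fun i =>
        (Finset.Icc 0 μ).toList.flatMap fun l =>
        (S.fdb (S.args 0) l
            ((-∏ r, ((μ r).choose (l r) : ℝ)) • mderiv (unitIdx i) (S.f 0)) []).flatMap fun Y =>
          S.fdb Finset.univ (μ - l + S.α i) (S.f (S.β i)) Y)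

/-! ### The integral system -/

/-- `∏_{z ∈ Z} v_z(t, x)`. -/
def codeProd (v : Code d n → ℝ → E d → ℝ) (Z : List (Code d n)) (t : ℝ) (x : E d) : ℝ :=
  (Z.map fun z => v z t x).prod

/-- The family `v = (v_c)` solves the integral system indexed by the codes in `𝒞`, all the
integrals in it being absolutely convergent. At `t = T` the heat kernel is the Dirac mass. -/
structure IsIntegralSolution (v : Code d n → ℝ → E d → ℝ) : Prop where
  poisson_integrable : ∀ c ∈ S.codes, c.IsPoisson → ∀ t ∈ Icc 0 S.T, ∀ x,
    ∀ Z ∈ S.mechanism c,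
      Integrable (fun p : ℝ × E d => heatKernel 1 p.1 p.2 * (poissonN p.2 / (2 * p.1)) *
        codeProd v Z t (x + p.2)) ((volume.restrict (Ioi 0)).prod volume)
  poisson_eq : ∀ c ∈ S.codes, c.IsPoisson → ∀ t ∈ Icc 0 S.T, ∀ x,
    v c t x = ((S.mechanism c).map fun Z =>
      ∫ s in Ioi (0 : ℝ), ∫ y : E d,
        heatKernel 1 s y * (poissonN y / (2 * s)) * codeProd v Z t (x + y)).sum
  terminal_integrable : ∀ c ∈ S.codes, ¬ c.IsPoisson → ∀ t ∈ Ico 0 S.T, ∀ x,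
    Integrable (fun y : E d => heatKernel (2 * S.ν) (S.T - t) (y - x) * S.terminalValue c y)
  source_integrable : ∀ c ∈ S.codes, ¬ c.IsPoisson → ∀ t ∈ Ico 0 S.T, ∀ x,
    ∀ Z ∈ S.mechanism c,
      Integrable (fun p : ℝ × E d => heatKernel (2 * S.ν) (p.1 - t) (p.2 - x) *
        codeProd v Z p.1 p.2) ((volume.restrict (Ioc t S.T)).prod volume)
  parabolic_eq : ∀ c ∈ S.codes, ¬ c.IsPoisson → ∀ t ∈ Ico 0 S.T, ∀ x,
    v c t x =
      (∫ y : E d, heatKernel (2 * S.ν) (S.T - t) (y - x) * S.terminalValue c y) +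
      ((S.mechanism c).map fun Z =>
        ∫ s in Ioc t S.T, ∫ y : E d,
          heatKernel (2 * S.ν) (s - t) (y - x) * codeProd v Z s y).sum
  terminal_eq : ∀ c ∈ S.codes, ¬ c.IsPoisson → ∀ x, v c S.T x = S.terminalValue c x

/-- The family `(c(u))_c`. -/
def evalFamily (u : Fin (d + 1) → ℝ → E d → ℝ) : Code d n → ℝ → E d → ℝ :=
  fun c => S.eval c u

/-- The integrability conditions under which the system is put in integral form: on `[0,T]` all
codes grow in space more slowly than every `exp (ε |x|²)`, and the products of codes in the
source terms of Poisson equations are dominated, uniformly in time, by functions whose Newtonian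
potentials converge absolutely. -/
structure IntegrabilityConditions (u : Fin (d + 1) → ℝ → E d → ℝ) : Prop where
  growth : ∀ c ∈ S.codes, ∀ ε > 0, ∃ K : ℝ, ∀ t ∈ Icc 0 S.T, ∀ x,
    |S.eval c u t x| ≤ K * Real.exp (ε * ‖x‖ ^ 2)
  newton : ∀ c ∈ S.codes, c.IsPoisson → ∀ Z ∈ S.mechanism c,
    ∃ G : E d → ℝ,
      (∀ x, Integrable (fun y : E d => newtonKernel y * G (x + y))) ∧
      ∀ t ∈ Icc 0 S.T, ∀ y, |codeProd (S.evalFamily u) Z t y| ≤ G y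

end PDESystem

/-! ### The random coded tree -/

/-- A probability density on `ℝ₊` with positive values. -/
structure IsPositiveDensity (ρ : ℝ → ℝ) : Prop where
  measurable : Measurable ρ
  pos : ∀ s, 0 < s → 0 < ρ s
  lintegral_eq_one : ∫⁻ s in Ioi (0 : ℝ), ENNReal.ofReal (ρ s) = 1

/-- The distribution on `ℝ₊` with density `ρ`. -/
def densityLaw (ρ : ℝ → ℝ) : Measure ℝ :=
  (volume.restrict (Ioi 0)).withDensity fun s => ENNReal.ofReal (ρ s)

/-- The tail distribution function of `ρ`. -/
def tail (ρ : ℝ → ℝ) (s : ℝ) : ℝ := (densityLaw ρ).real (Ioi s)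

/-- The random numbers used by one call of the algorithm: `τ`, `τ'` (written `τ` with a tilde in
the literature), a standard normal vector `ξ`, from which `W_s = √s ξ`, and a number `U` used for
the uniform choice of an element of the mechanism. -/
structure Draw (d : ℕ) where
  τ : ℝ
  τ' : ℝ
  ξ : E d
  U : ℝ

/-- The draw encoded by a tuple. -/
def Draw.ofTuple (m : ℝ × ℝ × E d × ℝ) : Draw d := ⟨m.1, m.2.1, m.2.2.1, m.2.2.2⟩

/-- The law of the random numbers of one call: independent, with `τ ∼ ρ`, `τ' ∼ ρ'`,
`ξ ∼ 𝒩(0, I_d)` and `U` uniform on `[0,1]`. -/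
def drawLaw (d : ℕ) (ρ ρ' : ℝ → ℝ) : Measure (ℝ × ℝ × E d × ℝ) :=
  (densityLaw ρ).prod ((densityLaw ρ').prod
    ((stdGaussian (E d)).prod (volume.restrict (Icc (0 : ℝ) 1))))

namespace PDESystem

variable (S : PDESystem d n)

open Classical in
/-- The output of the coded tree algorithm `TREE(t, x, c)` if the tree has at most `k`
generations, and `0` otherwise. The calls are labelled by finite words (Ulam-Harris labels): the
`j`-th child of the call `ℓ` is the call `j :: ℓ`, and the call `ℓ` uses the draw `m ℓ`. Codes
governed by a Poisson equation branch at once, without change of time; the others branch after the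
time `τ`, or are evaluated at the horizon `T` if it comes first. -/
def treeProd (ρ ρ' : ℝ → ℝ) (m : List ℕ → ℝ × ℝ × E d × ℝ) :
    ℕ → List ℕ → ℝ → E d → Code d n → ℝ
  | 0, _, _, _, _ => 0
  | k + 1, ℓ, t, x, c =>
    let D := Draw.ofTuple (m ℓ)
    let r : ℕ := (S.mechanism c).length
    let Z : List (Code d n) := (S.mechanism c).getD ⌊r * D.U⌋₊ []
    if c.IsPoisson then
      let W : E d := √D.τ' • D.ξ
      poissonN W * r / (2 * D.τ' * ρ' D.τ') *
        (Z.mapIdx fun j z => treeProd ρ ρ' m k (j :: ℓ) t (x + W) z).prod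
    else if S.T < t + D.τ then
      S.terminalValue c (x + √(2 * S.ν * (S.T - t)) • D.ξ) / tail ρ (S.T - t)
    else
      (r : ℝ) / ρ D.τ *
        (Z.mapIdx fun j z => treeProd ρ ρ' m k (j :: ℓ) (t + D.τ)
          (x + √(2 * S.ν * D.τ) • D.ξ) z).prod

/-- The functional `𝓗(t, x, c)` of the random coded tree. As a sequence in `k`, `treeProd` is
eventually equal to the output of the algorithm if the tree is finite, and it is `0` for every `k`
if the algorithm does not terminate. -/
def treeFunctional (ρ ρ' : ℝ → ℝ) (m : List ℕ → ℝ × ℝ × E d × ℝ)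
    (t : ℝ) (x : E d) (c : Code d n) : ℝ :=
  limUnder atTop fun k => S.treeProd ρ ρ' m k [] t x c

end PDESystem

end

end CodedTree

namespace CodedTree

noncomputable section

variable {d n : ℕ}

/-! ### Multi-indices -/

/-! The families `(c(u))_c` and `(E[H(·,·,c)])_c` both solve the integral system (S). The uniqueness
assumption identifies them, and the codes `Id_i` give the claim. The two halves of the proof share
only the algebra of the mechanism.

For a classical solution, `S.source`, the sum over `𝓜(c)` of the products of codes, has a meaning
for each type of code. If `c` is not a Poisson code, it is `-(∂_t + νΔ) c(u)`: the chain rule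
produces the terms of `𝓜(g^*)`, the parabolic equations replace `(∂_t + νΔ) ∂_α u_i` by `-∂_α
f_i^*(u)` for `i ≠ 0`, and the same expression for `u_0`, which no equation gives, is kept as a code
`(∂_α, -1)`. If `c` is a Poisson code, it is the density whose Newtonian potential is `c(u)`. Both
facts rest on the Faà di Bruno and Leibniz formulas, proved for derivations of a commutative algebra
and applied to smooth functions (`faaDiBruno_algebra`, `leibniz_algebra`, `source_star`,
`source_heat`).

These identities are then put in integral form. For the first kind, the Gaussian average of `c(u)(s,
x + √(2ν(s-t)) ξ)` is differentiated in `s`; Gaussian integration by parts (`stein`) turns the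
gradient term into `νΔ`, and integration from `t` to `T` is the Duhamel formula (`duhamel`). For the
second kind, the potential of `f_0^*(u)` is differentiated in space and time under the integral sign
(`continuous_potential`, `hasDerivWithinAt_potential`, `isRepresented`), and the Newtonian kernel is
written as the time integral of `φ_1(s,y) N(y)/(2s)` (`integral_heatKernel_time`).

For the tree, the functional equals one call of the algorithm applied to the functionals of the
subtrees of the root (`treeFunctional_eq_step`). These are independent copies of the whole tree,
independent of the root draw (`map_graft_curry`), so the expectation is a fixed point of the
averaged call (`treeMean_eq`). In that average the factor `r_c` cancels the probability of each
choice, the densities cancel the weights `1/ρ`, the tail cancels the probability of reaching the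
horizon, and the normal vector becomes the heat kernel. What remains is (S), with the required
absolute convergence supplied by Fubini (`poisson_of_step`, `heat_of_step`). -/

theorem multiIndex_induction {m : ℕ} {P : (Fin m → ℕ) → Prop} (h0 : P 0)
    (hs : ∀ μ j, P μ → P (μ + unitIdx j)) (μ : Fin m → ℕ) : P μ := by
  induction h : ∑ j, μ j generalizing μ with
  | zero =>
    have : μ = 0 := by
      funext j
      have := (Finset.sum_eq_zero_iff.1 h) j (Finset.mem_univ j)
      simpa using this
    exact this ▸ h0
  | succ k ih =>
    have : ∃ j, μ j ≠ 0 := by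
      by_contra! hc
      simp [hc] at h
    obtain ⟨j, hj⟩ := this
    have hμ : (μ - unitIdx j) + unitIdx j = μ := by
      funext i
      by_cases hij : i = j
      · subst hij; simp; omega
      · simp [hij]
    rw [← hμ]
    apply hs
    apply ih
    have h2 : ∑ i, ((μ - unitIdx j) + unitIdx j) i = k + 1 := by rw [hμ, h]
    simp only [Pi.add_apply, Finset.sum_add_distrib] at h2
    have h3 : ∑ i, (unitIdx j : Fin m → ℕ) i = 1 := by simp [Finset.sum_pi_single']
    omega

theorem sub_unit_add_unit {m : ℕ} {μ : Fin m → ℕ} {j : Fin m} (h : 1 ≤ μ j) :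
    μ - unitIdx j + unitIdx j = μ := by
  funext i
  by_cases hij : i = j
  · subst hij; simp; omega
  · simp [hij]

/-- `μ! = ∏ μ_j!`. -/
def mfact {m : ℕ} (μ : Fin m → ℕ) : ℝ := ∏ j, ((μ j).factorial : ℝ)

theorem mfact_ne_zero {m : ℕ} (μ : Fin m → ℕ) : mfact μ ≠ 0 :=
  Finset.prod_ne_zero_iff.2 fun j _ => by exact_mod_cast (μ j).factorial_ne_zero

theorem mfact_add_unit {m : ℕ} (μ : Fin m → ℕ) (j : Fin m) :
    mfact (μ + unitIdx j) = (μ j + 1) * mfact μ := by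
  unfold mfact
  rw [← Finset.mul_prod_erase _ _ (Finset.mem_univ j),
    ← Finset.mul_prod_erase _ (fun i => ((μ i).factorial : ℝ)) (Finset.mem_univ j), ← mul_assoc]
  congr 1
  · simp [Nat.factorial_succ]
  · refine Finset.prod_congr rfl fun i hi => ?_
    simp [Finset.ne_of_mem_erase hi]

@[simp] theorem mfact_unit {m : ℕ} (j : Fin m) : mfact (unitIdx j : Fin m → ℕ) = 1 := by
  have := mfact_add_unit (0 : Fin m → ℕ) j
  simpa [mfact] using this

/-! ### The Faà di Bruno formula, algebraically -/

/-- Finitely supported families `(k_l^i)`. -/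
abbrev Blk (d n : ℕ) : Type := ((Fin d → ℕ) × Fin n) →₀ ℕ

/-- The total order `∑ |k_l| l`. -/
def Blk.weight (k : Blk d n) : Fin d → ℕ := k.sum fun p c => c • p.1

/-- The order `∑ k_l` of the outer derivative. -/
def Blk.outer (k : Blk d n) : Fin n → ℕ := k.sum fun p c => c • unitIdx p.2

/-- The denominator `∏ k_l^i! (l!)^{k_l^i}`. -/
def Blk.denom (k : Blk d n) : ℝ := k.prod fun p c => (c.factorial : ℝ) * mfact p.1 ^ c

theorem Blk.weight_add (k k' : Blk d n) : (k + k').weight = k.weight + k'.weight :=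
  Finsupp.sum_add_index' (by simp) (by intros; rw [add_smul])

theorem Blk.outer_add (k k' : Blk d n) : (k + k').outer = k.outer + k'.outer :=
  Finsupp.sum_add_index' (by simp) (by intros; rw [add_smul])

@[simp] theorem Blk.weight_single (p : (Fin d → ℕ) × Fin n) :
    Blk.weight (Finsupp.single p 1) = p.1 := by simp [Blk.weight]

@[simp] theorem Blk.outer_single (p : (Fin d → ℕ) × Fin n) :
    Blk.outer (Finsupp.single p 1) = unitIdx p.2 := by simp [Blk.outer]

theorem Blk.denom_ne_zero (k : Blk d n) : k.denom ≠ 0 :=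
  Finset.prod_ne_zero_iff.2 fun p _ =>
    mul_ne_zero (by exact_mod_cast Nat.factorial_ne_zero _) (pow_ne_zero _ (mfact_ne_zero _))

theorem Blk.denom_add_single (k : Blk d n) (p : (Fin d → ℕ) × Fin n) :
    (k + Finsupp.single p 1).denom = (k p + 1) * mfact p.1 * k.denom := by
  classical
  have e1 : (k + Finsupp.single p 1).denom = ∏ q ∈ insert p k.support,
      ((((k + Finsupp.single p 1 : Blk d n) q).factorial : ℝ) *
        mfact q.1 ^ (k + Finsupp.single p 1 : Blk d n) q) := by
    apply Finsupp.prod_of_support_subset _ _ _ (by simp)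
    intro q hq
    rcases Finset.mem_union.1 (Finsupp.support_add hq) with h | h
    · exact Finset.mem_insert_of_mem h
    · have := Finsupp.support_single_subset h
      simp at this; simp [this]
  have e2 : k.denom = ∏ q ∈ insert p k.support, (((k q).factorial : ℝ) * mfact q.1 ^ k q) :=
    Finsupp.prod_of_support_subset _ (Finset.subset_insert _ _) _ (by simp)
  rw [e1, e2, ← Finset.mul_prod_erase _ _ (Finset.mem_insert_self p _),
    ← Finset.mul_prod_erase _ (fun q => (((k q).factorial : ℝ) * mfact q.1 ^ k q))
      (Finset.mem_insert_self p _), ← mul_assoc]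
  congr 1
  · simp [Nat.factorial_succ, pow_succ]; ring
  · refine Finset.prod_congr rfl fun q hq => ?_
    have : p ≠ q := (Finset.ne_of_mem_erase hq).symm
    simp [this]

/-- The family indexed by blocks, extended by zero. -/
def Blk.ofFun {μ : Fin d → ℕ} (k : blocks μ → Fin n → ℕ) : Blk d n :=
  Finsupp.onFinset (blocks μ ×ˢ Finset.univ)
    (fun p => if h : p.1 ∈ blocks μ then k ⟨p.1, h⟩ p.2 else 0) (by
      intro p hp
      by_cases h : p.1 ∈ blocks μ
      · simp [h]
      · simp [h] at hp)

theorem Blk.ofFun_apply {μ : Fin d → ℕ} (k : blocks μ → Fin n → ℕ) (l : blocks μ) (i : Fin n) :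
    Blk.ofFun k (l, i) = k l i := by
  simp [Blk.ofFun]

theorem Blk.ofFun_support {μ : Fin d → ℕ} (k : blocks μ → Fin n → ℕ) :
    (Blk.ofFun k).support ⊆ blocks μ ×ˢ Finset.univ := Finsupp.support_onFinset_subset

theorem Blk.sum_ofFun {M : Type*} [AddCommMonoid M] {μ : Fin d → ℕ} (k : blocks μ → Fin n → ℕ)
    (F : (Fin d → ℕ) × Fin n → ℕ → M) (hF : ∀ p, F p 0 = 0) :
    (Blk.ofFun k).sum F = ∑ l : blocks μ, ∑ i, F (l, i) (k l i) := by
  rw [Finsupp.sum_of_support_subset _ (Blk.ofFun_support k) _ (fun p _ => hF p),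
    Finset.sum_product, ← Finset.sum_coe_sort]
  simp [Blk.ofFun_apply]

theorem Blk.prod_ofFun {M : Type*} [CommMonoid M] {μ : Fin d → ℕ} (k : blocks μ → Fin n → ℕ)
    (F : (Fin d → ℕ) × Fin n → ℕ → M) (hF : ∀ p, F p 0 = 1) :
    (Blk.ofFun k).prod F = ∏ l : blocks μ, ∏ i, F (l, i) (k l i) := by
  rw [Finsupp.prod_of_support_subset _ (Blk.ofFun_support k) _ (fun p _ => hF p),
    Finset.prod_product, ← Finset.prod_coe_sort]
  simp [Blk.ofFun_apply]

theorem Blk.ofFun_injective {μ : Fin d → ℕ} :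
    Function.Injective (Blk.ofFun : (blocks μ → Fin n → ℕ) → Blk d n) := by
  intro k k' h
  funext l i
  rw [← Blk.ofFun_apply k, ← Blk.ofFun_apply k', h]

theorem Blk.le_weight (k : Blk d n) {p : (Fin d → ℕ) × Fin n} (hp : p ∈ k.support) :
    k p • p.1 ≤ k.weight :=
  Finset.single_le_sum (f := fun p => k p • p.1) (fun _ _ => zero_le) hp

/-- The families of total order `μ`. -/
def Blk.ofWeight (μ : Fin d → ℕ) : Finset (Blk d n) :=
  (fdbIndex Finset.univ μ).map ⟨Blk.ofFun, Blk.ofFun_injective⟩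

/-- Blocks `l = 0` carry no weight and have to be excluded by hand. Any other block that occurs lies
below `μ`, and its multiplicity is at most `∑ μ_j`, so the finite box in `fdbIndex` loses nothing.
-/
theorem Blk.mem_ofWeight {μ : Fin d → ℕ} {k : Blk d n} :
    k ∈ Blk.ofWeight μ ↔ (∀ i, k (0, i) = 0) ∧ k.weight = μ := by
  unfold Blk.ofWeight
  simp only [Finset.mem_map, Function.Embedding.coeFn_mk]
  constructor
  · rintro ⟨k, hk, rfl⟩
    refine ⟨fun i => ?_, ?_⟩
    · simp [Blk.ofFun, blocks]
    · have := (Finset.mem_filter.1 hk).2.1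
      rw [Blk.weight, Blk.sum_ofFun _ _ (by simp)]
      exact this
  · rintro ⟨h0, hw⟩
    have hsupp : ∀ p, k p ≠ 0 → p.1 ∈ blocks μ := by
      intro p hp
      have h1 := Blk.le_weight k (Finsupp.mem_support_iff.2 hp)
      rw [hw] at h1
      have h2 : p.1 ≠ 0 := fun h => hp (by rw [← Prod.mk.eta (p := p), h]; exact h0 _)
      simp only [blocks, Finset.mem_erase, Finset.mem_Icc]
      refine ⟨h2, zero_le, le_trans (fun j => ?_) h1⟩
      simp only [Pi.smul_apply, smul_eq_mul]
      exact Nat.le_mul_of_pos_left _ (Nat.pos_of_ne_zero hp)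
    have hk : Blk.ofFun (fun (l : blocks μ) i => k (l, i)) = k := by
      ext p
      by_cases h : p.1 ∈ blocks μ
      · simp [Blk.ofFun, h]
      · have : k p = 0 := by by_contra hp; exact h (hsupp p hp)
        simp [Blk.ofFun, h, this]
    refine ⟨fun l i => k (l, i), ?_, hk⟩
    simp only [fdbIndex, Finset.mem_filter, Fintype.mem_piFinset, Finset.mem_range]
    refine ⟨fun l i => ?_, ?_, by simp⟩
    · by_cases hz : k (l, i) = 0
      · rw [hz]; omega
      have h1 := Blk.le_weight k (Finsupp.mem_support_iff.2 hz)
      rw [hw] at h1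
      have h2 : (l : Fin d → ℕ) ≠ 0 := (Finset.mem_erase.1 l.2).1
      obtain ⟨j, hj⟩ := Function.ne_iff.1 h2
      have h3 := h1 j
      simp only [Pi.smul_apply, smul_eq_mul] at h3
      have h4 : μ j ≤ ∑ j, μ j := Finset.single_le_sum (f := μ) (fun _ _ => zero_le)
        (Finset.mem_univ j)
      have h5 : k (l, i) ≤ k (l, i) * (l : Fin d → ℕ) j :=
        Nat.le_mul_of_pos_right _ (Nat.pos_of_ne_zero hj)
      omega
    · conv_rhs => rw [← hw, ← hk]
      rw [Blk.weight, Blk.sum_ofFun _ _ (by simp)]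

section Algebra

variable {A : Type*} [CommRing A]

/-- The monomial attached to a family. -/
def Blk.monomial (x : (Fin d → ℕ) → Fin n → A) (k : Blk d n) : A :=
  k.prod fun p c => x p.1 p.2 ^ c

theorem Blk.monomial_add (x : (Fin d → ℕ) → Fin n → A) (k k' : Blk d n) :
    (k + k').monomial x = k.monomial x * k'.monomial x :=
  Finsupp.prod_add_index' (by simp) (by intros; rw [pow_add])

@[simp] theorem Blk.monomial_single (x : (Fin d → ℕ) → Fin n → A) (p : (Fin d → ℕ) × Fin n) :
    Blk.monomial x (Finsupp.single p 1) = x p.1 p.2 := by simp [Blk.monomial]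

/-- One term of the Faà di Bruno formula, without its coefficient. -/
def Blk.term (G : (Fin n → ℕ) → A) (x : (Fin d → ℕ) → Fin n → A) (k : Blk d n) : A :=
  G k.outer * k.monomial x

variable [Algebra ℝ A]

theorem derivation_prod {ι : Type*} [DecidableEq ι] (D : Derivation ℝ A A) (s : Finset ι)
    (f : ι → A) : D (∏ a ∈ s, f a) = ∑ a ∈ s, (∏ b ∈ s.erase a, f b) • D (f a) := by
  induction s using Finset.induction_on with
  | empty => simp
  | insert a s ha ih =>
    rw [Finset.prod_insert ha, Derivation.leibniz, ih, Finset.sum_insert ha,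
      Finset.erase_insert ha, add_comm, Finset.smul_sum]
    congr 1
    refine Finset.sum_congr rfl fun b hb => ?_
    have hab : a ≠ b := fun h => ha (h ▸ hb)
    rw [Finset.erase_insert_of_ne hab, Finset.prod_insert (fun h => ha (Finset.mem_of_mem_erase h)),
      smul_smul]

theorem Blk.derivation_monomial (D : Derivation ℝ A A) (x x' : (Fin d → ℕ) → Fin n → A)
    (hx : ∀ l i, D (x l i) = x' l i) (k : Blk d n) :
    D (k.monomial x) = ∑ p ∈ k.support,
      (k p : ℝ) • ((k - Finsupp.single p 1).monomial x * x' p.1 p.2) := by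
  classical
  unfold Blk.monomial Finsupp.prod
  rw [derivation_prod]
  refine Finset.sum_congr rfl fun p hp => ?_
  have hkp : k p ≠ 0 := Finsupp.mem_support_iff.1 hp
  have hle : (k - Finsupp.single p 1).support ⊆ k.support := Finsupp.support_tsub
  have e : (k - Finsupp.single p 1).prod (fun p c => x p.1 p.2 ^ c) =
      x p.1 p.2 ^ (k p - 1) * ∏ q ∈ k.support.erase p, x q.1 q.2 ^ k q := by
    rw [Finsupp.prod_of_support_subset _ hle _ (by simp), ← Finset.mul_prod_erase _ _ hp]
    congr 1
    · simp
    · refine Finset.prod_congr rfl fun q hq => ?_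
      have : p ≠ q := (Finset.ne_of_mem_erase hq).symm
      simp [this]
  unfold Finsupp.prod at e
  rw [e, Derivation.leibniz_pow, hx]
  simp only [smul_eq_mul, Algebra.smul_def, map_natCast, eq_natCast]
  ring

variable (D : Fin d → Derivation ℝ A A) (G : (Fin n → ℕ) → A) (x : (Fin d → ℕ) → Fin n → A)

/-- The derivative falls either on the outer factor, which opens a new block of order `1_j`, or on
one of the `k p` equal inner factors, whose block is then raised by `1_j`. -/
theorem Blk.derivation_term (hG : ∀ j l, D j (G l) = ∑ i, G (l + unitIdx i) * x (unitIdx j) i)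
    (hx : ∀ j l i, D j (x l i) = x (l + unitIdx j) i) (j : Fin d) (k : Blk d n) :
    D j (k.term G x) = (∑ i, (k + Finsupp.single (unitIdx j, i) 1).term G x) +
      ∑ p ∈ k.support, (k p : ℝ) • (k - Finsupp.single p 1 +
        Finsupp.single (p.1 + unitIdx j, p.2) 1).term G x := by
  classical
  unfold Blk.term
  rw [Derivation.leibniz, hG, add_comm, Blk.derivation_monomial (D j) x _ (hx j)]
  congr 1
  · rw [Finset.smul_sum]
    refine Finset.sum_congr rfl fun i _ => ?_
    simp only [Blk.outer_add, Blk.outer_single, Blk.monomial_add, Blk.monomial_single, smul_eq_mul]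
    ring
  · rw [Finset.smul_sum]
    refine Finset.sum_congr rfl fun p hp => ?_
    have hle : Finsupp.single p 1 ≤ k := by
      rw [Finsupp.single_le_iff]; exact Nat.pos_of_ne_zero (Finsupp.mem_support_iff.1 hp)
    have ho : k.outer = (k - Finsupp.single p 1 +
        Finsupp.single (p.1 + unitIdx j, p.2) 1).outer := by
      conv_lhs => rw [← tsub_add_cancel_of_le hle]
      simp [Blk.outer_add]
    rw [← ho]
    simp only [Blk.monomial_add, Blk.monomial_single, smul_eq_mul, Algebra.smul_def]
    ring

/-- A term divided by its denominator. -/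
def Blk.dterm (k : Blk d n) : A := (k.denom)⁻¹ • k.term G x

/-- Once each term is divided by its denominator, the weight of a new term can be read off from the
resulting family alone: it is the multiplicity of the block that was created, times the `j`-th
coordinate of that block. -/
theorem Blk.derivation_dterm
    (hG : ∀ j l, D j (G l) = ∑ i, G (l + unitIdx i) * x (unitIdx j) i)
    (hx : ∀ j l i, D j (x l i) = x (l + unitIdx j) i) (j : Fin d) (k : Blk d n) :
    D j (k.dterm G x) =
      (∑ i, (((k + Finsupp.single (unitIdx j, i) 1 : Blk d n) (unitIdx j, i) : ℕ) : ℝ) •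
        (k + Finsupp.single (unitIdx j, i) 1).dterm G x) +
      ∑ p ∈ k.support, (((k - Finsupp.single p 1 + Finsupp.single (p.1 + unitIdx j, p.2) 1 : Blk d n)
          (p.1 + unitIdx j, p.2) * (p.1 + unitIdx j) j : ℕ) : ℝ) •
        (k - Finsupp.single p 1 + Finsupp.single (p.1 + unitIdx j, p.2) 1).dterm G x := by
  classical
  unfold Blk.dterm
  rw [Derivation.map_smul, Blk.derivation_term D G x hG hx, smul_add, Finset.smul_sum,
    Finset.smul_sum]
  congr 1
  · refine Finset.sum_congr rfl fun i _ => ?_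
    rw [smul_smul, Blk.denom_add_single]
    congr 1
    have := k.denom_ne_zero
    have h2 : ((k (unitIdx j, i) : ℝ) + 1) ≠ 0 := by positivity
    simp only [Finsupp.add_apply, Finsupp.single_eq_same, mfact_unit]
    push_cast
    field_simp
  · refine Finset.sum_congr rfl fun p hp => ?_
    have hkp := Finsupp.mem_support_iff.1 hp
    have hle : Finsupp.single p 1 ≤ k := by
      rw [Finsupp.single_le_iff]; exact Nat.pos_of_ne_zero hkp
    obtain ⟨κ, rfl⟩ : ∃ κ : Blk d n, k = κ + Finsupp.single p 1 := ⟨_, (tsub_add_cancel_of_le hle).symm⟩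
    rw [add_tsub_cancel_right, smul_smul, smul_smul, Blk.denom_add_single, Blk.denom_add_single]
    congr 1
    have := κ.denom_ne_zero
    have h2 : ((κ p : ℝ) + 1) ≠ 0 := by positivity
    have h3 : ((κ (p.1 + unitIdx j, p.2) : ℝ) + 1) ≠ 0 := by positivity
    have h4 := mfact_ne_zero p.1
    have h5 : (p.1 j : ℝ) + 1 ≠ 0 := by positivity
    simp only [Finsupp.add_apply, Finsupp.single_eq_same, mfact_add_unit, Pi.add_apply,
      Pi.single_eq_same]
    push_cast
    field_simp

/-- Double counting. A family of weight `μ + 1_j` is reached once for each of its blocks `q` with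
`q_j ≠ 0`, with weight `k_q q_j`. The sum of these weights is the `j`-th coordinate of the total
weight, `μ_j + 1`. -/
theorem Blk.sum_derivation_dterm
    (hG : ∀ j l, D j (G l) = ∑ i, G (l + unitIdx i) * x (unitIdx j) i)
    (hx : ∀ j l i, D j (x l i) = x (l + unitIdx j) i) (μ : Fin d → ℕ) (j : Fin d) :
    ∑ k ∈ Blk.ofWeight μ, D j (Blk.dterm G x k) =
      ((μ j : ℝ) + 1) • ∑ k ∈ Blk.ofWeight (μ + unitIdx j), Blk.dterm G x k := by
  classical
  -- The factor `μ_j + 1` is spread over pairs of a family and a marked block of it.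
  have hR : ((μ j : ℝ) + 1) • ∑ k ∈ Blk.ofWeight (μ + unitIdx j), Blk.dterm G x k =
      ∑ q ∈ (Blk.ofWeight (μ + unitIdx j)).sigma
          (fun k : Blk d n => k.support.filter (fun q => q.1 j ≠ 0)),
        ((q.1 q.2 * q.2.1 j : ℕ) : ℝ) • Blk.dterm G x q.1 := by
    rw [Finset.sum_sigma, Finset.smul_sum]
    refine Finset.sum_congr rfl fun k hk => ?_
    dsimp only
    rw [← Finset.sum_smul]
    congr 1
    have hw := (Blk.mem_ofWeight.1 hk).2
    have h1 : (∑ p ∈ k.support, k p * p.1 j) = μ j + 1 := by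
      have := congrFun hw j
      simpa [Blk.weight, Finsupp.sum] using this
    rw [← Nat.cast_sum, ← Nat.cast_succ, Nat.succ_eq_add_one, ← h1]
    congr 1
    symm
    apply Finset.sum_subset (Finset.filter_subset _ _)
    intro p hp hp2
    simp only [Finset.mem_filter, hp, true_and, not_not] at hp2
    simp [hp2]
  have hunit : ∀ q : Fin d → ℕ, q j ≠ 0 → q - unitIdx j + unitIdx j = q := fun q hq =>
    sub_unit_add_unit (Nat.pos_of_ne_zero hq)
  have hune : (unitIdx j : Fin d → ℕ) ≠ 0 := by
    intro h; have := congrFun h j; simp at this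
  -- Marked blocks equal to `1_j` correspond to blocks newly opened; all other marked blocks arise
  -- by raising the nonzero block `q - 1_j`.
  rw [hR, Finset.sum_congr rfl fun k _ => Blk.derivation_dterm D G x hG hx j k,
    Finset.sum_add_distrib, ← Finset.sum_filter_add_sum_filter_not _
      (fun q : (Σ _ : Blk d n, (Fin d → ℕ) × Fin n) => q.2.1 = unitIdx j)]
  congr 1
  · rw [← Finset.sum_product']
    refine Finset.sum_bij' (fun p _ => ⟨p.1 + Finsupp.single (unitIdx j, p.2) 1, (unitIdx j, p.2)⟩)
      (fun q _ => (q.1 - Finsupp.single q.2 1, q.2.2)) ?_ ?_ ?_ ?_ ?_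
    · rintro ⟨k, i⟩ hk
      have hk := Blk.mem_ofWeight.1 (Finset.mem_product.1 hk).1
      simp only [Finset.mem_filter, Finset.mem_sigma, Blk.mem_ofWeight, Finsupp.mem_support_iff]
      refine ⟨⟨⟨fun i' => ?_, ?_⟩, ?_⟩, trivial⟩
      · have : ((unitIdx j : Fin d → ℕ), i) ≠ (0, i') := fun h => hune (Prod.ext_iff.1 h).1
        simp [hk.1, this]
      · rw [Blk.weight_add, hk.2, Blk.weight_single]
      · simp
    · rintro ⟨k, q⟩ hk
      simp only [Finset.mem_filter, Finset.mem_sigma, Blk.mem_ofWeight, Finsupp.mem_support_iff]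
        at hk
      obtain ⟨⟨⟨h0, hw⟩, hq, hqj⟩, hqu⟩ := hk
      simp only [Finset.mem_product, Blk.mem_ofWeight, Finset.mem_univ, and_true]
      have hle : Finsupp.single q 1 ≤ k := by
        rw [Finsupp.single_le_iff]; exact Nat.pos_of_ne_zero hq
      refine ⟨fun i => ?_, ?_⟩
      · simp [h0]
      · have : (k - Finsupp.single q 1 + Finsupp.single q 1).weight = μ + unitIdx j := by
          rw [tsub_add_cancel_of_le hle, hw]
        rw [Blk.weight_add, Blk.weight_single, hqu] at this
        exact add_right_cancel this
    · rintro ⟨k, i⟩ hk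
      simp
    · rintro ⟨k, q⟩ hk
      simp only [Finset.mem_filter, Finset.mem_sigma, Finsupp.mem_support_iff] at hk
      have hle : Finsupp.single q 1 ≤ k := by
        rw [Finsupp.single_le_iff]; exact Nat.pos_of_ne_zero hk.1.2.1
      have hq : (unitIdx j, q.2) = q := by rw [← hk.2]
      simp only [hq, tsub_add_cancel_of_le hle]
    · rintro ⟨k, i⟩ hk
      simp
  · rw [Finset.sum_sigma']
    refine Finset.sum_bij'
      (fun p _ => ⟨p.1 - Finsupp.single p.2 1 + Finsupp.single (p.2.1 + unitIdx j, p.2.2) 1,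
        (p.2.1 + unitIdx j, p.2.2)⟩)
      (fun q _ => ⟨q.1 - Finsupp.single q.2 1 + Finsupp.single (q.2.1 - unitIdx j, q.2.2) 1,
        (q.2.1 - unitIdx j, q.2.2)⟩) ?_ ?_ ?_ ?_ ?_
    · rintro ⟨k, p⟩ hk
      simp only [Finset.mem_sigma, Blk.mem_ofWeight, Finsupp.mem_support_iff] at hk
      obtain ⟨⟨h0, hw⟩, hp⟩ := hk
      have hle : Finsupp.single p 1 ≤ k := by
        rw [Finsupp.single_le_iff]; exact Nat.pos_of_ne_zero hp
      simp only [Finset.mem_filter, Finset.mem_sigma, Blk.mem_ofWeight, Finsupp.mem_support_iff]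
      refine ⟨⟨⟨fun i' => ?_, ?_⟩, ?_⟩, ?_⟩
      · have : ((p.1 + unitIdx j : Fin d → ℕ), p.2) ≠ (0, i') := fun h => by
          have := congrFun (Prod.ext_iff.1 h).1 j
          simp at this
        simp [h0, this]
      · have : (k - Finsupp.single p 1 + Finsupp.single p 1).weight = μ := by
          rw [tsub_add_cancel_of_le hle, hw]
        rw [Blk.weight_add, Blk.weight_single] at this
        rw [Blk.weight_add, Blk.weight_single, ← this, add_assoc]
      · simp
      · intro h
        have : p.1 = 0 := by simpa using h
        exact hp (by rw [← Prod.mk.eta (p := p), this]; exact h0 _)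
    · rintro ⟨k, q⟩ hk
      simp only [Finset.mem_filter, Finset.mem_sigma, Blk.mem_ofWeight, Finsupp.mem_support_iff]
        at hk
      obtain ⟨⟨⟨h0, hw⟩, hq, hqj⟩, hqu⟩ := hk
      have hle : Finsupp.single q 1 ≤ k := by
        rw [Finsupp.single_le_iff]; exact Nat.pos_of_ne_zero hq
      simp only [Finset.mem_sigma, Blk.mem_ofWeight, Finsupp.mem_support_iff]
      refine ⟨⟨fun i' => ?_, ?_⟩, by simp⟩
      · have : ((q.1 - unitIdx j : Fin d → ℕ), q.2) ≠ (0, i') := fun h => by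
          apply hqu
          have h0' : q.1 - unitIdx j = 0 := (Prod.ext_iff.1 h).1
          rw [← hunit q.1 hqj, h0', zero_add]
        simp [h0, this]
      · have : (k - Finsupp.single q 1 + Finsupp.single q 1).weight = μ + unitIdx j := by
          rw [tsub_add_cancel_of_le hle, hw]
        rw [Blk.weight_add, Blk.weight_single] at this
        rw [Blk.weight_add, Blk.weight_single]
        apply add_right_cancel (b := unitIdx j)
        rw [add_assoc, hunit q.1 hqj, this]
    · rintro ⟨k, p⟩ hk
      simp only [Finset.mem_sigma, Finsupp.mem_support_iff] at hk
      have hle : Finsupp.single p 1 ≤ k := by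
        rw [Finsupp.single_le_iff]; exact Nat.pos_of_ne_zero hk.2
      simp [tsub_add_cancel_of_le hle]
    · rintro ⟨k, q⟩ hk
      simp only [Finset.mem_filter, Finset.mem_sigma, Finsupp.mem_support_iff] at hk
      have hle : Finsupp.single q 1 ≤ k := by
        rw [Finsupp.single_le_iff]; exact Nat.pos_of_ne_zero hk.1.2.1
      simp [hunit q.1 hk.1.2.2, tsub_add_cancel_of_le hle]
    · rintro ⟨k, i⟩ hk
      simp

theorem Blk.ofWeight_zero : (Blk.ofWeight 0 : Finset (Blk d n)) = {0} := by
  ext k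
  rw [Blk.mem_ofWeight, Finset.mem_singleton]
  constructor
  · rintro ⟨h0, hw⟩
    ext p
    by_contra hp
    have h1 := Blk.le_weight k (Finsupp.mem_support_iff.2 hp)
    rw [hw] at h1
    have : p.1 = 0 := by
      funext j
      have := h1 j
      simp at this
      rcases this with h | h
      · exact absurd h hp
      · exact h
    exact hp (by rw [← Prod.mk.eta (p := p), this]; exact h0 _)
  · rintro rfl
    simp [Blk.weight]

/-- The Faà di Bruno formula for commuting derivations of an algebra. -/
theorem faaDiBruno_algebra (H : (Fin d → ℕ) → A)
    (hG : ∀ j l, D j (G l) = ∑ i, G (l + unitIdx i) * x (unitIdx j) i)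
    (hx : ∀ j l i, D j (x l i) = x (l + unitIdx j) i)
    (hH0 : H 0 = G 0) (hH : ∀ μ j, H (μ + unitIdx j) = D j (H μ)) (μ : Fin d → ℕ) :
    H μ = ∑ k ∈ fdbIndex Finset.univ μ,
      fdbCoeff μ k • (G (fun i => ∑ l, k l i) * ∏ l : blocks μ, ∏ i, x l i ^ k l i) := by
  -- Dividing by `μ!` makes the induction close: `(μ + 1_j)! = (μ_j + 1) μ!` absorbs the factor from
  -- the double counting.
  have key : H μ = mfact μ • ∑ k ∈ Blk.ofWeight μ, Blk.dterm G x k := by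
    induction μ using multiIndex_induction with
    | h0 =>
      simp [Blk.ofWeight_zero, hH0, mfact, Blk.dterm, Blk.term, Blk.denom, Blk.outer, Blk.monomial]
    | hs μ j ih =>
      rw [hH, ih, Derivation.map_smul, map_sum, Blk.sum_derivation_dterm D G x hG hx, smul_smul,
        mfact_add_unit, mul_comm]
  rw [key, Blk.ofWeight, Finset.sum_map, Finset.smul_sum]
  refine Finset.sum_congr rfl fun k _ => ?_
  simp only [Function.Embedding.coeFn_mk, Blk.dterm, Blk.term, smul_smul]
  have h1 : (Blk.ofFun k).outer = fun i => ∑ l, k l i := by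
    rw [Blk.outer, Blk.sum_ofFun _ _ (by simp)]
    funext i
    simp [Finset.sum_apply, Pi.single_apply]
  have h2 : (Blk.ofFun k).monomial x = ∏ l : blocks μ, ∏ i, x l i ^ k l i := by
    rw [Blk.monomial, Blk.prod_ofFun _ _ (by simp)]
  rw [h1, h2]
  congr 1
  rw [fdbCoeff, Blk.denom, Blk.prod_ofFun _ _ (by simp), div_eq_mul_inv]
  rfl

end Algebra

/-! ### Partial derivatives of smooth functions -/

/-- Smooth real functions on `ℝᵐ`. -/
abbrev Smooth (g : E m → ℝ) : Prop := ContDiff ℝ ((⊤ : ℕ∞) : WithTop ℕ∞) g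

theorem Smooth.differentiable {g : E m → ℝ} (hg : Smooth g) : Differentiable ℝ g :=
  ContDiff.differentiable hg (by simp)

theorem Smooth.hasLineDerivAt {g : E m → ℝ} (hg : Smooth g) (i : Fin m) (x : E m) :
    HasLineDerivAt ℝ g (pd i g x) x (EuclideanSpace.single i 1) :=
  (hg.differentiable x).lineDifferentiableAt.hasLineDerivAt

theorem Smooth.pd_eq {g : E m → ℝ} (hg : Smooth g) (i : Fin m) (x : E m) :
    pd i g x = fderiv ℝ g x (EuclideanSpace.single i 1) :=
  (hg.differentiable x).lineDeriv_eq_fderiv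

theorem Smooth.pd {g : E m → ℝ} (hg : Smooth g) (i : Fin m) : Smooth (pd i g) := by
  have : CodedTree.pd i g = fun x => fderiv ℝ g x (EuclideanSpace.single i 1) :=
    funext fun x => hg.pd_eq i x
  rw [this]
  exact (hg.fderiv_right (m := ((⊤ : ℕ∞) : WithTop ℕ∞)) (by simp)).clm_apply contDiff_const

theorem Smooth.pd_pd_eq {g : E m → ℝ} (hg : Smooth g) (i j : Fin m) (x : E m) :
    CodedTree.pd i (CodedTree.pd j g) x =
      fderiv ℝ (fderiv ℝ g) x (EuclideanSpace.single i 1) (EuclideanSpace.single j 1) := by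
  rw [(hg.pd j).pd_eq]
  have : CodedTree.pd j g = fun x => fderiv ℝ g x (EuclideanSpace.single j 1) :=
    funext fun x => hg.pd_eq j x
  have hd : DifferentiableAt ℝ (fderiv ℝ g) x :=
    (hg.fderiv_right (m := ((⊤ : ℕ∞) : WithTop ℕ∞)) (by simp)).differentiable (by simp) x
  rw [this, fderiv_clm_apply hd (by fun_prop)]
  simp

theorem pd_comm {g : E m → ℝ} (hg : Smooth g) (i j : Fin m) : pd i (pd j g) = pd j (pd i g) := by
  funext x
  rw [hg.pd_pd_eq, hg.pd_pd_eq]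
  exact (hg.contDiffAt.isSymmSndFDerivAt (by
    rw [minSmoothness_of_isRCLikeNormedField]
    exact WithTop.coe_le_coe.2 (le_top : (2 : ℕ∞) ≤ ⊤))).eq _ _

theorem laplacian_eq_sum_pd {g : E m → ℝ} (hg : Smooth g) (x : E m) :
    Laplacian.laplacian g x = ∑ k, pd k (pd k g) x := by
  rw [InnerProductSpace.laplacian_eq_iteratedFDeriv_orthonormalBasis g
    (EuclideanSpace.basisFun (Fin m) ℝ)]
  refine Finset.sum_congr rfl fun k _ => ?_
  rw [iteratedFDeriv_two_apply, hg.pd_pd_eq]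
  simp

theorem pd_add {f g : E m → ℝ} (hf : Smooth f) (hg : Smooth g) (i : Fin m) :
    pd i (f + g) = pd i f + pd i g := by
  funext x
  exact (HasDerivAt.add (hf.hasLineDerivAt i x) (hg.hasLineDerivAt i x)).deriv

theorem pd_smul {f : E m → ℝ} (hf : Smooth f) (c : ℝ) (i : Fin m) :
    pd i (c • f) = c • pd i f := by
  funext x
  exact (HasDerivAt.const_smul c (hf.hasLineDerivAt i x)).deriv

theorem pd_mul {f g : E m → ℝ} (hf : Smooth f) (hg : Smooth g) (i : Fin m) :
    pd i (f * g) = f * pd i g + g * pd i f := by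
  funext x
  have := HasDerivAt.mul (hf.hasLineDerivAt i x) (hg.hasLineDerivAt i x)
  have h2 := this.deriv
  simp only [zero_smul, add_zero] at h2
  change deriv (fun t : ℝ => f (x + t • EuclideanSpace.single i 1) *
    g (x + t • EuclideanSpace.single i 1)) 0 = _
  simp only [Pi.mul_apply, Pi.add_apply]
  rw [show (fun t : ℝ => f (x + t • EuclideanSpace.single i 1) *
    g (x + t • EuclideanSpace.single i 1)) = (fun t : ℝ => f (x + t • EuclideanSpace.single i 1)) *
    (fun t : ℝ => g (x + t • EuclideanSpace.single i 1)) from rfl, h2]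
  ring

/-- The algebra of smooth functions. -/
def smoothAlg (m : ℕ) : Subalgebra ℝ (E m → ℝ) where
  carrier := {g | Smooth g}
  mul_mem' {f g} hf hg := by
    change Smooth f at hf
    change Smooth g at hg
    exact ContDiff.mul hf hg
  add_mem' {f g} hf hg := by
    change Smooth f at hf
    change Smooth g at hg
    exact ContDiff.add hf hg
  algebraMap_mem' r := by
    change Smooth (fun _ => r)
    exact contDiff_const

theorem smoothAlg_smooth (g : smoothAlg m) : Smooth (g : E m → ℝ) := g.2

/-- The partial derivative as a derivation. -/
def pdDer (i : Fin m) : Derivation ℝ (smoothAlg m) (smoothAlg m) :=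
  Derivation.mk'
    { toFun := fun g => ⟨pd i g, (smoothAlg_smooth g).pd i⟩
      map_add' := fun f g => Subtype.ext (pd_add (smoothAlg_smooth f) (smoothAlg_smooth g) i)
      map_smul' := fun c f => Subtype.ext (pd_smul (smoothAlg_smooth f) c i) }
    (fun f g => Subtype.ext (pd_mul (smoothAlg_smooth f) (smoothAlg_smooth g) i))

@[simp] theorem pdDer_coe (i : Fin m) (g : smoothAlg m) : (pdDer i g : E m → ℝ) = pd i g := rfl

@[simp] theorem mderiv_zero (g : E m → ℝ) : mderiv 0 g = g := by
  unfold mderiv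
  induction List.finRange m with
  | nil => rfl
  | cons i L ih => simp

theorem Smooth.pd_iterate {g : E m → ℝ} (hg : Smooth g) (i : Fin m) (k : ℕ) :
    Smooth ((CodedTree.pd i)^[k] g) := by
  induction k with
  | zero => exact hg
  | succ k ih => rw [Function.iterate_succ_apply']; exact ih.pd i

theorem pd_iterate_comm {g : E m → ℝ} (hg : Smooth g) (i j : Fin m) (k : ℕ) :
    (pd i)^[k] (pd j g) = pd j ((pd i)^[k] g) := by
  induction k with
  | zero => rfl
  | succ k ih =>
    rw [Function.iterate_succ_apply', Function.iterate_succ_apply', ih,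
      pd_comm (hg.pd_iterate i k)]

theorem Smooth.foldr_pd {g : E m → ℝ} (hg : Smooth g) (μ : Fin m → ℕ) (L : List (Fin m)) :
    Smooth (L.foldr (fun i h => (CodedTree.pd i)^[μ i] h) g) := by
  induction L with
  | nil => exact hg
  | cons i L ih => exact ih.pd_iterate i _

theorem Smooth.mderiv {g : E m → ℝ} (hg : Smooth g) (μ : Fin m → ℕ) : Smooth (mderiv μ g) :=
  hg.foldr_pd μ _

/-- `mderiv` applies the coordinates in a fixed order; symmetry of second derivatives allows the
extra derivative to be moved to the outside. This recursion drives all inductions on multi-indices.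
In the proof, lists without repetition ensure that the extra derivative is counted once. -/
theorem mderiv_add_unit {g : E m → ℝ} (hg : Smooth g) (μ : Fin m → ℕ) (j : Fin m) :
    mderiv (μ + unitIdx j) g = pd j (mderiv μ g) := by
  have key : ∀ L : List (Fin m), L.Nodup →
      L.foldr (fun i h => (pd i)^[(μ + unitIdx j) i] h) g =
      if j ∈ L then pd j (L.foldr (fun i h => (pd i)^[μ i] h) g)
        else L.foldr (fun i h => (pd i)^[μ i] h) g := by
    intro L hL
    induction L with
    | nil => simp
    | cons i L ih =>
      rw [List.nodup_cons] at hL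
      rw [List.foldr_cons, List.foldr_cons, ih hL.2]
      by_cases hij : j = i
      · subst hij
        simp [hL.1, Function.iterate_succ_apply']
      · have h1 : (μ + unitIdx j) i = μ i := by simp [Ne.symm hij]
        rw [h1]
        by_cases hjL : j ∈ L
        · simp only [hjL, if_true, List.mem_cons, or_true]
          exact pd_iterate_comm (hg.foldr_pd μ L) i j _
        · simp [hjL, hij]
  have := key _ (List.nodup_finRange m)
  simpa [mderiv] using this

@[simp] theorem mderiv_unit {g : E m → ℝ} (hg : Smooth g) (j : Fin m) :
    mderiv (unitIdx j) g = pd j g := by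
  simpa using mderiv_add_unit hg 0 j

theorem mderiv_mderiv {g : E m → ℝ} (hg : Smooth g) (μ κ : Fin m → ℕ) :
    mderiv μ (mderiv κ g) = mderiv (κ + μ) g := by
  induction μ using multiIndex_induction with
  | h0 => simp
  | hs μ j ih => rw [mderiv_add_unit (hg.mderiv κ), ih, ← add_assoc, mderiv_add_unit hg]

theorem mderiv_pd {g : E m → ℝ} (hg : Smooth g) (μ : Fin m → ℕ) (j : Fin m) :
    mderiv μ (pd j g) = pd j (mderiv μ g) := by
  rw [← mderiv_unit hg, mderiv_mderiv hg, add_comm, mderiv_add_unit hg]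

theorem mderiv_smul {g : E m → ℝ} (hg : Smooth g) (c : ℝ) (μ : Fin m → ℕ) :
    mderiv μ (c • g) = c • mderiv μ g := by
  have hc : Smooth (c • g) := contDiff_const.smul hg
  induction μ using multiIndex_induction with
  | h0 => simp
  | hs μ j ih => rw [mderiv_add_unit hc, ih, pd_smul (hg.mderiv μ), mderiv_add_unit hg]

theorem mderiv_add {f g : E m → ℝ} (hf : Smooth f) (hg : Smooth g) (μ : Fin m → ℕ) :
    mderiv μ (f + g) = mderiv μ f + mderiv μ g := by
  have hc : Smooth (f + g) := ContDiff.add hf hg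
  induction μ using multiIndex_induction with
  | h0 => simp
  | hs μ j ih =>
    rw [mderiv_add_unit hc, ih, pd_add (hf.mderiv μ) (hg.mderiv μ), mderiv_add_unit hg,
      mderiv_add_unit hf]

theorem Smooth.sum {ι : Type*} (s : Finset ι) {f : ι → E m → ℝ} (hf : ∀ i ∈ s, Smooth (f i)) :
    Smooth (∑ i ∈ s, f i) := by
  induction s using Finset.cons_induction with
  | empty => exact contDiff_const (c := (0 : ℝ))
  | cons a s ha ih =>
    rw [Finset.sum_cons]
    exact ContDiff.add (hf a (Finset.mem_cons_self a s))
      (ih fun i hi => hf i (Finset.mem_cons_of_mem hi))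

theorem mderiv_zero_fun (μ : Fin m → ℕ) : mderiv μ (0 : E m → ℝ) = 0 := by
  have := mderiv_smul (g := (0 : E m → ℝ)) contDiff_const 0 μ
  simpa using this

theorem mderiv_sum {ι : Type*} (s : Finset ι) {f : ι → E m → ℝ} (hf : ∀ i ∈ s, Smooth (f i))
    (μ : Fin m → ℕ) : mderiv μ (∑ i ∈ s, f i) = ∑ i ∈ s, mderiv μ (f i) := by
  induction s using Finset.cons_induction with
  | empty => simp [mderiv_zero_fun]
  | cons a s ha ih =>
    rw [Finset.sum_cons, Finset.sum_cons, mderiv_add (hf a (Finset.mem_cons_self a s))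
      (Smooth.sum s fun i hi => hf i (Finset.mem_cons_of_mem hi)),
      ih fun i hi => hf i (Finset.mem_cons_of_mem hi)]

/-- The product of the binomial coefficients. -/
def mchoose (μ l : Fin m → ℕ) : ℝ := ∏ r, ((μ r).choose (l r) : ℝ)

theorem mchoose_add_unit (μ l : Fin m → ℕ) (j : Fin m) :
    mchoose (μ + unitIdx j) (l + unitIdx j) = mchoose μ l + mchoose μ (l + unitIdx j) := by
  unfold mchoose
  rw [← Finset.mul_prod_erase _ _ (Finset.mem_univ j),
    ← Finset.mul_prod_erase _ (fun r => (((μ r).choose (l r) : ℕ) : ℝ)) (Finset.mem_univ j),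
    ← Finset.mul_prod_erase _ (fun r => (((μ r).choose ((l + unitIdx j) r) : ℕ) : ℝ))
      (Finset.mem_univ j)]
  have h1 : ∏ r ∈ Finset.univ.erase j, ((((μ + unitIdx j) r).choose ((l + unitIdx j) r) : ℕ) : ℝ)
      = ∏ r ∈ Finset.univ.erase j, (((μ r).choose (l r) : ℕ) : ℝ) :=
    Finset.prod_congr rfl fun r hr => by simp [Finset.ne_of_mem_erase hr]
  have h2 : ∏ r ∈ Finset.univ.erase j, (((μ r).choose ((l + unitIdx j) r) : ℕ) : ℝ)
      = ∏ r ∈ Finset.univ.erase j, (((μ r).choose (l r) : ℕ) : ℝ) :=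
    Finset.prod_congr rfl fun r hr => by simp [Finset.ne_of_mem_erase hr]
  rw [h1, h2, ← add_mul]
  congr 1
  simp [Nat.choose_succ_succ]

theorem mchoose_add_unit_of_eq_zero {μ l : Fin m → ℕ} {j : Fin m} (h : l j = 0) :
    mchoose (μ + unitIdx j) l = mchoose μ l := by
  unfold mchoose
  refine Finset.prod_congr rfl fun r _ => ?_
  by_cases hr : r = j
  · subst hr; simp [h]
  · simp [hr]

theorem mchoose_eq_zero {μ l : Fin m → ℕ} (h : ¬ l ≤ μ) : mchoose μ l = 0 := by
  obtain ⟨r, hr⟩ := not_forall.1 h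
  exact Finset.prod_eq_zero (Finset.mem_univ r)
    (by exact_mod_cast Nat.choose_eq_zero_of_lt (not_le.1 hr))

/-- The Leibniz formula for commuting derivations. -/
theorem leibniz_algebra {A : Type*} [CommRing A] [Algebra ℝ A] (D : Fin m → Derivation ℝ A A)
    (a b H : (Fin m → ℕ) → A) (ha : ∀ j l, D j (a l) = a (l + unitIdx j))
    (hb : ∀ j l, D j (b l) = b (l + unitIdx j)) (hH0 : H 0 = a 0 * b 0)
    (hH : ∀ μ j, H (μ + unitIdx j) = D j (H μ)) (μ : Fin m → ℕ) :
    H μ = ∑ l ∈ Finset.Icc 0 μ, mchoose μ l • (a (μ - l) * b l) := by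
  induction μ using multiIndex_induction with
  | h0 => simp [hH0, mchoose]
  | hs μ j ih =>
    have e1 : H (μ + unitIdx j) = ∑ l ∈ Finset.Icc 0 μ, mchoose μ l •
          (a (μ - l + unitIdx j) * b l) +
        ∑ l ∈ Finset.Icc 0 μ, mchoose μ l • (a (μ - l) * b (l + unitIdx j)) := by
      rw [hH, ih, map_sum, ← Finset.sum_add_distrib]
      refine Finset.sum_congr rfl fun l _ => ?_
      rw [Derivation.map_smul, Derivation.leibniz, ha, hb, ← smul_add]
      simp only [smul_eq_mul]
      congr 1
      ring
    -- Pascal's rule in coordinate `j`. The case `l j = 0` is separate because `l - 1_j` is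
    -- truncated subtraction.
    have e2 : ∀ l, mchoose (μ + unitIdx j) l = mchoose μ l +
        if l j = 0 then 0 else mchoose μ (l - unitIdx j) := by
      intro l
      split_ifs with h
      · rw [mchoose_add_unit_of_eq_zero h, add_zero]
      · have := sub_unit_add_unit (Nat.pos_of_ne_zero h)
        conv_lhs => rw [← this]
        rw [mchoose_add_unit, this, add_comm]
    rw [e1]
    simp_rw [e2, add_smul]
    rw [Finset.sum_add_distrib]
    congr 1
    · have hsub : Finset.Icc 0 μ ⊆ Finset.Icc 0 (μ + unitIdx j) :=
        Finset.Icc_subset_Icc_right le_self_add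
      rw [← Finset.sum_subset hsub]
      · refine Finset.sum_congr rfl fun l hl => ?_
        have hl := (Finset.mem_Icc.1 hl).2
        have : μ + unitIdx j - l = μ - l + unitIdx j := by
          rw [tsub_add_eq_add_tsub hl]
        rw [this]
      · intro l _ hl
        rw [mchoose_eq_zero (fun h => hl (Finset.mem_Icc.2 ⟨zero_le, h⟩)), zero_smul]
    · have : ∀ l, (if l j = 0 then 0 else mchoose μ (l - unitIdx j)) •
          (a (μ + unitIdx j - l) * b l) = if l j ≠ 0 then mchoose μ (l - unitIdx j) •
          (a (μ + unitIdx j - l) * b l) else 0 := by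
        intro l; split_ifs <;> simp_all
      simp_rw [this]
      rw [← Finset.sum_filter]
      refine Finset.sum_bij' (fun l _ => l + unitIdx j) (fun l _ => l - unitIdx j) ?_ ?_ ?_ ?_ ?_
      · intro l hl
        simp only [Finset.mem_filter, Finset.mem_Icc, zero_le, true_and] at hl ⊢
        refine ⟨by gcongr, by simp⟩
      · intro l hl
        simp only [Finset.mem_filter, Finset.mem_Icc, zero_le, true_and] at hl ⊢
        exact tsub_le_iff_right.2 hl.1
      · intro l hl; simp
      · intro l hl
        exact sub_unit_add_unit (Nat.pos_of_ne_zero (Finset.mem_filter.1 hl).2)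
      · intro l hl
        have : μ + unitIdx j - (l + unitIdx j) = μ - l := add_tsub_add_eq_tsub_right _ _ _
        rw [this]; simp

theorem mderiv_mul {f g : E m → ℝ} (hf : Smooth f) (hg : Smooth g) (μ : Fin m → ℕ) :
    mderiv μ (f * g) =
      ∑ l ∈ Finset.Icc 0 μ, mchoose μ l • (mderiv (μ - l) f * mderiv l g) := by
  have hfg : Smooth (f * g) := ContDiff.mul hf hg
  have := leibniz_algebra (A := smoothAlg m) pdDer (fun l => ⟨mderiv l f, hf.mderiv l⟩)
    (fun l => ⟨mderiv l g, hg.mderiv l⟩) (fun l => ⟨mderiv l (f * g), hfg.mderiv l⟩)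
    (fun j l => Subtype.ext (mderiv_add_unit hf l j).symm)
    (fun j l => Subtype.ext (mderiv_add_unit hg l j).symm)
    (Subtype.ext (by simp)) (fun l j => Subtype.ext (mderiv_add_unit hfg l j)) μ
  have h2 := congrArg (fun z : smoothAlg m => (z : E m → ℝ)) this
  simp only [AddSubmonoidClass.coe_finsetSum] at h2
  exact h2

/-! ### Composition -/

/-- The function with components `v_i`. -/
def assemble (v : Fin n → E d → ℝ) (y : E d) : E n := WithLp.toLp 2 fun i => v i y

theorem contDiff_assemble {v : Fin n → E d → ℝ} (hv : ∀ i, Smooth (v i)) :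
    ContDiff ℝ ((⊤ : ℕ∞) : WithTop ℕ∞) (assemble v) := by
  rw [contDiff_euclidean]
  exact hv

theorem Smooth.comp_assemble {g : E n → ℝ} (hg : Smooth g) {v : Fin n → E d → ℝ}
    (hv : ∀ i, Smooth (v i)) : Smooth (fun y => g (assemble v y)) :=
  ContDiff.comp hg (contDiff_assemble hv)

theorem sum_smul_single (z : E n) : z = ∑ i, z i • EuclideanSpace.single i (1 : ℝ) := by
  ext j
  simp [Pi.single_apply]

theorem Smooth.fderiv_eq_sum {g : E n → ℝ} (hg : Smooth g) (x z : E n) :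
    fderiv ℝ g x z = ∑ i, z i * CodedTree.pd i g x := by
  conv_lhs => rw [sum_smul_single z]
  simp [hg.pd_eq]

theorem pd_comp {g : E n → ℝ} (hg : Smooth g) {v : Fin n → E d → ℝ} (hv : ∀ i, Smooth (v i))
    (j : Fin d) (x : E d) : pd j (fun y => g (assemble v y)) x =
      ∑ i, pd i g (assemble v x) * pd j (v i) x := by
  rw [(hg.comp_assemble hv).pd_eq]
  have hd := (contDiff_assemble hv).differentiable (by simp) x
  have h1 : fderiv ℝ (fun y => g (assemble v y)) x =
      (fderiv ℝ g (assemble v x)).comp (fderiv ℝ (assemble v) x) :=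
    fderiv_comp x (hg.differentiable _) hd
  rw [h1, ContinuousLinearMap.comp_apply, hg.fderiv_eq_sum]
  refine Finset.sum_congr rfl fun i _ => ?_
  rw [mul_comm, (hv i).pd_eq]
  congr 1
  have h2 : HasFDerivAt (fun y => (EuclideanSpace.proj i : E n →L[ℝ] ℝ) (assemble v y))
    ((EuclideanSpace.proj i : E n →L[ℝ] ℝ).comp (fderiv ℝ (assemble v) x)) x :=
    (EuclideanSpace.proj i : E n →L[ℝ] ℝ).hasFDerivAt.comp x hd.hasFDerivAt
  have h3 := h2.fderiv
  have : (fun y => (EuclideanSpace.proj i : E n →L[ℝ] ℝ) (assemble v y)) = v i := rfl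
  rw [this] at h3
  rw [h3]; rfl

/-- `g` depends only on the variables in `A`. -/
def DependsOnlyOn (A : Finset (Fin n)) (g : E n → ℝ) : Prop :=
  ∀ z z' : E n, (∀ j ∈ A, z j = z' j) → g z = g z'

theorem DependsOnlyOn.pd {A : Finset (Fin n)} {g : E n → ℝ} (h : DependsOnlyOn A g) (i : Fin n) :
    DependsOnlyOn A (pd i g) := by
  intro z z' hz
  unfold CodedTree.pd lineDeriv
  congr 1
  funext t
  exact h _ _ fun j hj => by simp [hz j hj]

theorem DependsOnlyOn.pd_eq_zero {A : Finset (Fin n)} {g : E n → ℝ} (h : DependsOnlyOn A g)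
    {i : Fin n} (hi : i ∉ A) : CodedTree.pd i g = 0 := by
  funext z
  unfold CodedTree.pd lineDeriv
  have : (fun t : ℝ => g (z + t • EuclideanSpace.single i 1)) = fun _ => g z := by
    funext t
    refine h _ _ fun j hj => ?_
    have : j ≠ i := fun e => hi (e ▸ hj)
    simp [this]
  rw [this]; simp

theorem DependsOnlyOn.mderiv {A : Finset (Fin n)} {g : E n → ℝ} (hg : Smooth g)
    (h : DependsOnlyOn A g) (l : Fin n → ℕ) : DependsOnlyOn A (mderiv l g) := by
  induction l using multiIndex_induction with
  | h0 => simpa using h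
  | hs l j ih => rw [mderiv_add_unit hg]; exact ih.pd j

theorem DependsOnlyOn.mderiv_eq_zero {A : Finset (Fin n)} {g : E n → ℝ} (hg : Smooth g)
    (h : DependsOnlyOn A g) {l : Fin n → ℕ} {i : Fin n} (hi : i ∉ A) (hl : l i ≠ 0) :
    CodedTree.mderiv l g = 0 := by
  rw [← sub_unit_add_unit (Nat.pos_of_ne_zero hl), mderiv_add_unit hg,
    (h.mderiv hg _).pd_eq_zero hi]

/-- The multivariate Faà di Bruno formula. -/
theorem mderiv_comp {A : Finset (Fin n)} {g : E n → ℝ} (hg : Smooth g) (hA : DependsOnlyOn A g)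
    {v : Fin n → E d → ℝ} (hv : ∀ i, Smooth (v i)) (μ : Fin d → ℕ) (x : E d) :
    mderiv μ (fun y => g (assemble v y)) x = ∑ k ∈ fdbIndex A μ,
      fdbCoeff μ k * (mderiv (fun i => ∑ l, k l i) g (assemble v x) *
        ∏ l : blocks μ, ∏ i, mderiv l (v i) x ^ k l i) := by
  have hH := hg.comp_assemble hv
  have := faaDiBruno_algebra (A := smoothAlg d) pdDer
    (fun l => ⟨fun y => mderiv l g (assemble v y), (hg.mderiv l).comp_assemble hv⟩)
    (fun l i => ⟨mderiv l (v i), (hv i).mderiv l⟩)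
    (fun l => ⟨mderiv l (fun y => g (assemble v y)), hH.mderiv l⟩)
    (fun j l => Subtype.ext (by
      funext y
      rw [pdDer_coe]
      simp only
      rw [pd_comp (hg.mderiv l) hv]
      simp only [AddSubmonoidClass.coe_finsetSum, Finset.sum_apply, mderiv_add_unit hg]
      exact Finset.sum_congr rfl fun i _ =>
        (congrArg (pd i (mderiv l g) (assemble v y) * ·)
          (congrFun (mderiv_unit (hv i) j) y)).symm))
    (fun j l i => Subtype.ext (mderiv_add_unit (hv i) l j).symm)
    (Subtype.ext (by simp)) (fun l j => Subtype.ext (mderiv_add_unit hH l j)) μ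
  have h2 := congrFun (congrArg (fun z : smoothAlg d => (z : E d → ℝ)) this) x
  simp only [AddSubmonoidClass.coe_finsetSum, Finset.sum_apply] at h2
  rw [h2]
  symm
  -- The general formula runs over all variables. A family that uses a variable outside `A`
  -- differentiates `g` in a direction in which it is constant, so its term vanishes.
  refine Finset.sum_subset_zero_on_sdiff ?_ ?_ ?_
  · intro k hk
    simp only [fdbIndex, Finset.mem_filter] at hk ⊢
    exact ⟨hk.1, hk.2.1, by simp⟩
  · intro k hk
    rw [Finset.mem_sdiff] at hk
    have : ∃ l i, i ∉ A ∧ k l i ≠ 0 := by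
      by_contra! hc
      apply hk.2
      have h1 := hk.1
      simp only [fdbIndex, Finset.mem_filter] at h1 ⊢
      exact ⟨h1.1, h1.2.1, hc⟩
    obtain ⟨l, i, hi, hki⟩ := this
    have h0 : mderiv (fun i => ∑ l, k l i) g = 0 := by
      refine hA.mderiv_eq_zero hg hi ?_
      intro h
      exact hki (Finset.sum_eq_zero_iff.1 h l (Finset.mem_univ l))
    change fdbCoeff μ k * (mderiv (fun i => ∑ l, k l i) g (assemble v x) * _) = 0
    rw [h0]; simp
  · intro k _
    change _ = fdbCoeff μ k * (_ * (((∏ l : blocks μ, ∏ i, _ : smoothAlg d) : E d → ℝ) x))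
    congr 2
    simp only [SubmonoidClass.coe_finsetProd, Finset.prod_apply]
    rfl

/-! ### The Gaussian measure and the heat kernel -/

theorem continuous_heatKernel (s2 t : ℝ) : Continuous (heatKernel s2 t : E d → ℝ) := by
  unfold heatKernel; fun_prop

theorem heatKernel_nonneg {s2 t : ℝ} (h : 0 ≤ s2 * t) (x : E d) : 0 ≤ heatKernel s2 t x := by
  unfold heatKernel
  have : 0 ≤ 2 * Real.pi * s2 * t := by
    have := Real.pi_pos; rw [mul_assoc]; positivity
  positivity

theorem integrable_exp_neg_mul_sq_norm {b : ℝ} (hb : 0 < b) :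
    Integrable (fun x : E d => Real.exp (-b * ‖x‖ ^ 2)) := by
  have := (GaussianFourier.integrable_cexp_neg_mul_sq_norm_add (V := E d) (b := (b : ℂ))
    (by simpa using hb) 0 0).re
  refine this.congr (Eventually.of_forall fun x => ?_)
  simp only [zero_mul, add_zero]
  rw [show (-(b : ℂ) * (‖x‖ : ℂ) ^ 2) = ((-b * ‖x‖ ^ 2 : ℝ) : ℂ) by push_cast; ring]
  exact Complex.exp_ofReal_re _

theorem heatKernel_one_one (x : E d) :
    heatKernel 1 1 x = Real.exp (-(1 / 2) * ‖x‖ ^ 2) / (2 * Real.pi) ^ ((d : ℝ) / 2) := by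
  unfold heatKernel
  congr 2
  · ring
  · ring

/-- Both finite measures have the characteristic function `exp(-|t|²/2)`, by the Gaussian Fourier
integral. -/
theorem stdGaussian_eq_withDensity : stdGaussian (E d) =
    volume.withDensity (fun x => ENNReal.ofReal (heatKernel 1 1 x)) := by
  have hint : Integrable (heatKernel 1 1 : E d → ℝ) := by
    simp_rw [funext heatKernel_one_one]
    exact (integrable_exp_neg_mul_sq_norm (by norm_num)).div_const _
  have : IsFiniteMeasure ((volume : Measure (E d)).withDensity
      (fun x => ENNReal.ofReal (heatKernel 1 1 x))) :=
    isFiniteMeasure_withDensity_ofReal hint.2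
  apply Measure.ext_of_charFun
  funext t
  rw [charFun_stdGaussian, charFun_apply, integral_withDensity_eq_integral_toReal_smul
    (by have := continuous_heatKernel (d := d) 1 1; fun_prop) (by simp)]
  have h1 : ∀ x : E d, (ENNReal.ofReal (heatKernel 1 1 x)).toReal •
      Complex.exp (inner ℝ x t * Complex.I) = ((2 * Real.pi : ℝ) : ℂ) ^ (-((d : ℂ) / 2)) *
      Complex.exp (-(1 / 2 : ℂ) * ‖x‖ ^ 2 + Complex.I * inner ℝ t x) := by
    intro x
    rw [ENNReal.toReal_ofReal (heatKernel_nonneg (by norm_num) x), heatKernel_one_one,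
      Complex.exp_add, real_inner_comm, Complex.real_smul, Complex.ofReal_div, Complex.ofReal_cpow
      (by positivity), Complex.cpow_neg, Complex.ofReal_exp]
    push_cast
    rw [mul_comm (Complex.I)]
    ring
  simp_rw [h1]
  rw [integral_const_mul, GaussianFourier.integral_cexp_neg_mul_sq_norm_add (by norm_num)]
  have h2 : (Real.pi / (1 / 2) : ℂ) = ((2 * Real.pi : ℝ) : ℂ) := by push_cast; ring
  rw [h2, finrank_euclideanSpace_fin, ← mul_assoc, ← Complex.cpow_add _ _ (by
    simp [Real.pi_ne_zero])]
  simp only [neg_add_cancel, Complex.cpow_zero, one_mul, Complex.I_sq]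
  congr 1
  ring

theorem integrable_stdGaussian_iff {F : E d → ℝ} : Integrable F (stdGaussian (E d)) ↔
    Integrable (fun x => heatKernel 1 1 x * F x) := by
  rw [stdGaussian_eq_withDensity, integrable_withDensity_iff_integrable_smul']
  · have : ∀ x : E d, (ENNReal.ofReal (heatKernel 1 1 x)).toReal • F x =
        heatKernel 1 1 x * F x := fun x => by
      rw [ENNReal.toReal_ofReal (heatKernel_nonneg (by norm_num) x), smul_eq_mul]
    simp_rw [this]
  · have := continuous_heatKernel (d := d) 1 1; fun_prop
  · simp

theorem integral_stdGaussian_eq (F : E d → ℝ) : ∫ x, F x ∂(stdGaussian (E d)) =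
    ∫ x, heatKernel 1 1 x * F x := by
  rw [stdGaussian_eq_withDensity, integral_withDensity_eq_integral_toReal_smul]
  · have : ∀ x : E d, (ENNReal.ofReal (heatKernel 1 1 x)).toReal • F x =
        heatKernel 1 1 x * F x := fun x => by
      rw [ENNReal.toReal_ofReal (heatKernel_nonneg (by norm_num) x), smul_eq_mul]
    simp_rw [this]
  · have := continuous_heatKernel (d := d) 1 1; fun_prop
  · simp

theorem heatKernel_scale {s2 t : ℝ} (h : 0 < s2 * t) (z : E d) :
    heatKernel s2 t z = (√(s2 * t) ^ d)⁻¹ * heatKernel 1 1 ((√(s2 * t))⁻¹ • z) := by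
  rw [heatKernel_one_one, heatKernel]
  have hs : 0 < √(s2 * t) := Real.sqrt_pos.2 h
  have h1 : (2 * Real.pi * s2 * t) ^ ((d : ℝ) / 2) =
      (2 * Real.pi) ^ ((d : ℝ) / 2) * √(s2 * t) ^ d := by
    rw [mul_assoc, Real.mul_rpow (by positivity) h.le]
    congr 1
    rw [Real.sqrt_eq_rpow, ← Real.rpow_natCast, ← Real.rpow_mul h.le]
    congr 1; ring
  rw [h1, norm_smul, mul_pow, norm_inv, Real.norm_of_nonneg hs.le, inv_pow, Real.sq_sqrt h.le]
  have : -‖z‖ ^ 2 / (2 * s2 * t) = -(1 / 2) * ((s2 * t)⁻¹ * ‖z‖ ^ 2) := by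
    have h2 : s2 ≠ 0 := fun h0 => by simp [h0] at h
    have h3 : t ≠ 0 := fun h0 => by simp [h0] at h
    field_simp
  rw [this]
  field_simp

/-- The substitution `y = x + √(s2 t) ξ`. It is the passage between the normal vectors of the
algorithm and the heat kernels of the integral system. -/
theorem integrable_gaussian_shift_iff {s2 t : ℝ} (h : 0 < s2 * t) (x : E d) {F : E d → ℝ} :
    Integrable (fun ξ => F (x + √(s2 * t) • ξ)) (stdGaussian (E d)) ↔
      Integrable (fun y => heatKernel s2 t (y - x) * F y) := by
  have hs : 0 < √(s2 * t) := Real.sqrt_pos.2 h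
  rw [integrable_stdGaussian_iff]
  have e1 : (fun ξ : E d => heatKernel 1 1 ξ * F (x + √(s2 * t) • ξ)) =
      fun ξ => (fun z => heatKernel 1 1 ((√(s2 * t))⁻¹ • z) * F (x + z)) (√(s2 * t) • ξ) := by
    funext ξ; simp [smul_smul, hs.ne']
  have e2 : (fun z : E d => heatKernel 1 1 ((√(s2 * t))⁻¹ • z) * F (x + z)) =
      fun z => √(s2 * t) ^ d * (heatKernel s2 t z * F (x + z)) := by
    funext z; rw [heatKernel_scale h]; field_simp
  have e3 : (fun y : E d => heatKernel s2 t (y - x) * F y) =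
      fun y => (fun z => heatKernel s2 t z * F (x + z)) (y - x) := by
    funext y; simp
  rw [e1, integrable_comp_smul_iff volume (fun z => heatKernel 1 1 ((√(s2 * t))⁻¹ • z) * F (x + z))
    hs.ne', e2, integrable_const_mul_iff (isUnit_iff_ne_zero.2 (by positivity)), e3]
  constructor
  · intro H; exact H.comp_sub_right x
  · intro H
    simpa using H.comp_add_right x

theorem integral_gaussian_shift {s2 t : ℝ} (h : 0 < s2 * t) (x : E d) (F : E d → ℝ) :
    ∫ ξ, F (x + √(s2 * t) • ξ) ∂(stdGaussian (E d)) =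
      ∫ y, heatKernel s2 t (y - x) * F y := by
  have hs : 0 < √(s2 * t) := Real.sqrt_pos.2 h
  rw [integral_stdGaussian_eq]
  have e1 : (fun ξ : E d => heatKernel 1 1 ξ * F (x + √(s2 * t) • ξ)) =
      fun ξ => (fun z => heatKernel 1 1 ((√(s2 * t))⁻¹ • z) * F (x + z)) (√(s2 * t) • ξ) := by
    funext ξ; simp [smul_smul, hs.ne']
  have e2 : (fun z : E d => heatKernel 1 1 ((√(s2 * t))⁻¹ • z) * F (x + z)) =
      fun z => √(s2 * t) ^ d * (heatKernel s2 t z * F (x + z)) := by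
    funext z; rw [heatKernel_scale h]; field_simp
  have e3 : (fun y : E d => heatKernel s2 t (y - x) * F y) =
      fun y => (fun z => heatKernel s2 t z * F (x + z)) (y - x) := by
    funext y; simp
  rw [e1, Measure.integral_comp_smul volume
    (fun z => heatKernel 1 1 ((√(s2 * t))⁻¹ • z) * F (x + z)), e2, integral_const_mul, e3,
    integral_sub_right_eq_self (fun z => heatKernel s2 t z * F (x + z)) x,
    finrank_euclideanSpace_fin, abs_of_pos (by positivity), smul_eq_mul]
  field_simp

theorem integrable_exp_sq_stdGaussian {c : ℝ} (hc : c < 1 / 2) :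
    Integrable (fun ξ : E d => Real.exp (c * ‖ξ‖ ^ 2)) (stdGaussian (E d)) := by
  rw [integrable_stdGaussian_iff]
  refine ((integrable_exp_neg_mul_sq_norm (d := d) (b := 1 / 2 - c) (by linarith)).div_const
    ((2 * Real.pi) ^ ((d : ℝ) / 2))).congr (Eventually.of_forall fun x => ?_)
  simp only
  rw [heatKernel_one_one, div_mul_eq_mul_div, ← Real.exp_add]
  congr 2; ring

/-! ### Functions of subgaussian growth -/

/-- Continuous functions on `[0,T] × ℝᵈ` that grow more slowly than every `exp (ε |x|²)`. -/
structure SubGaussian (T : ℝ) (w : ℝ → E d → ℝ) : Prop where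
  continuousOn : ContinuousOn (fun p : ℝ × E d => w p.1 p.2) (Icc 0 T ×ˢ univ)
  growth : ∀ ε > 0, ∃ K : ℝ, ∀ t ∈ Icc 0 T, ∀ x, |w t x| ≤ K * Real.exp (ε * ‖x‖ ^ 2)

namespace SubGaussian

variable {T : ℝ} {w w' : ℝ → E d → ℝ}

theorem add (h : SubGaussian T w) (h' : SubGaussian T w') :
    SubGaussian T (fun t x => w t x + w' t x) where
  continuousOn := h.1.add h'.1
  growth ε hε := by
    obtain ⟨K, hK⟩ := h.2 ε hε
    obtain ⟨K', hK'⟩ := h'.2 ε hε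
    refine ⟨K + K', fun t ht x => (abs_add_le _ _).trans ?_⟩
    rw [add_mul]; exact add_le_add (hK t ht x) (hK' t ht x)

theorem mul (h : SubGaussian T w) (h' : SubGaussian T w') :
    SubGaussian T (fun t x => w t x * w' t x) where
  continuousOn := h.1.mul h'.1
  growth ε hε := by
    obtain ⟨K, hK⟩ := h.2 (ε / 2) (by positivity)
    obtain ⟨K', hK'⟩ := h'.2 (ε / 2) (by positivity)
    refine ⟨K * K', fun t ht x => ?_⟩
    rw [abs_mul]
    calc |w t x| * |w' t x| ≤ (K * Real.exp (ε / 2 * ‖x‖ ^ 2)) * (K' * Real.exp (ε / 2 * ‖x‖ ^ 2)) :=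
          mul_le_mul (hK t ht x) (hK' t ht x) (abs_nonneg _) ((abs_nonneg _).trans (hK t ht x))
      _ = K * K' * (Real.exp (ε / 2 * ‖x‖ ^ 2) * Real.exp (ε / 2 * ‖x‖ ^ 2)) := by ring
      _ = _ := by rw [← Real.exp_add]; congr 2; ring

theorem const (c : ℝ) : SubGaussian T (fun (_ : ℝ) (_ : E d) => c) where
  continuousOn := continuousOn_const
  growth ε hε := ⟨|c|, fun t _ x => by
    have : 1 ≤ Real.exp (ε * ‖x‖ ^ 2) := Real.one_le_exp (by positivity)
    nlinarith [abs_nonneg c]⟩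

theorem congr (h : SubGaussian T w) (hw : ∀ t ∈ Icc 0 T, ∀ x, w t x = w' t x) :
    SubGaussian T w' where
  continuousOn := h.1.congr fun p hp => (hw p.1 hp.1 p.2).symm
  growth ε hε := by
    obtain ⟨K, hK⟩ := h.2 ε hε
    exact ⟨K, fun t ht x => hw t ht x ▸ hK t ht x⟩

theorem sum {ι : Type*} (s : Finset ι) {w : ι → ℝ → E d → ℝ}
    (h : ∀ i ∈ s, SubGaussian T (w i)) : SubGaussian T (fun t x => ∑ i ∈ s, w i t x) := by
  induction s using Finset.cons_induction with
  | empty => simpa using const 0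
  | cons a s ha ih =>
    simp only [Finset.sum_cons]
    exact (h a (Finset.mem_cons_self a s)).add (ih fun i hi => h i (Finset.mem_cons_of_mem hi))

theorem listSum {ι : Type*} (L : List ι) {w : ι → ℝ → E d → ℝ}
    (h : ∀ i ∈ L, SubGaussian T (w i)) :
    SubGaussian T (fun t x => (L.map fun i => w i t x).sum) := by
  induction L with
  | nil => simpa using const 0
  | cons a L ih =>
    simp only [List.map_cons, List.sum_cons]
    exact (h a List.mem_cons_self).add (ih fun i hi => h i (List.mem_cons_of_mem _ hi))

theorem listProd {ι : Type*} (L : List ι) {w : ι → ℝ → E d → ℝ}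
    (h : ∀ i ∈ L, SubGaussian T (w i)) :
    SubGaussian T (fun t x => (L.map fun i => w i t x).prod) := by
  induction L with
  | nil => simpa using const 1
  | cons a L ih =>
    simp only [List.map_cons, List.prod_cons]
    exact (h a List.mem_cons_self).mul (ih fun i hi => h i (List.mem_cons_of_mem _ hi))

theorem continuous_space (h : SubGaussian T w) {t : ℝ} (ht : t ∈ Icc 0 T) : Continuous (w t) := by
  rw [← continuousOn_univ]
  exact h.1.comp (f := fun x => (t, x)) (by fun_prop) fun x _ => ⟨ht, mem_univ _⟩

/-- A bound uniform in time along all paths used below. The exponent `1/8` leaves room for a further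
polynomial factor while staying below the Gaussian threshold `1/2`. -/
theorem bound (h : SubGaussian T w) (x : E d) (M : ℝ) (hM : 0 ≤ M) : ∃ C : ℝ, 0 ≤ C ∧
    ∀ s ∈ Icc 0 T, ∀ c : ℝ, c ^ 2 ≤ M → ∀ ξ, |w s (x + c • ξ)| ≤ C * Real.exp (1 / 8 * ‖ξ‖ ^ 2) := by
  -- Chosen so that `ε |x + c ξ|² ≤ ε (2|x|² + 2(M+1)|ξ|²)` has coefficient exactly `1/8` in front
  -- of `|ξ|²`.
  obtain ⟨K, hK⟩ := h.2 (1 / (16 * (M + 1))) (by positivity)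
  refine ⟨|K| * Real.exp (1 / (16 * (M + 1)) * (2 * ‖x‖ ^ 2)), by positivity,
    fun s hs c hc ξ => (hK s hs _).trans ?_⟩
  rw [mul_assoc, ← Real.exp_add]
  refine mul_le_mul (le_abs_self K) (Real.exp_le_exp.2 ?_) (by positivity) (by positivity)
  have h1 : ‖x + c • ξ‖ ^ 2 ≤ 2 * ‖x‖ ^ 2 + 2 * (c ^ 2 * ‖ξ‖ ^ 2) := by
    have h2 : ‖x + c • ξ‖ ≤ ‖x‖ + |c| * ‖ξ‖ := (norm_add_le _ _).trans (by rw [norm_smul]; rfl)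
    have h3 : ‖x + c • ξ‖ ^ 2 ≤ (‖x‖ + |c| * ‖ξ‖) ^ 2 := by gcongr
    have h4 : c ^ 2 = |c| ^ 2 := (sq_abs c).symm
    rw [h4]
    nlinarith [sq_nonneg (‖x‖ - |c| * ‖ξ‖)]
  have h5 : c ^ 2 * ‖ξ‖ ^ 2 ≤ (M + 1) * ‖ξ‖ ^ 2 := by
    gcongr; linarith
  calc 1 / (16 * (M + 1)) * ‖x + c • ξ‖ ^ 2
      ≤ 1 / (16 * (M + 1)) * (2 * ‖x‖ ^ 2 + 2 * ((M + 1) * ‖ξ‖ ^ 2)) := by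
        gcongr; linarith
    _ = _ := by field_simp; ring

theorem integrable_shift (h : SubGaussian T w) {t : ℝ} (ht : t ∈ Icc 0 T) (x : E d) (c : ℝ) :
    Integrable (fun ξ => w t (x + c • ξ)) (stdGaussian (E d)) := by
  obtain ⟨C, _, hC⟩ := h.bound x (c ^ 2) (sq_nonneg c)
  refine ((integrable_exp_sq_stdGaussian (d := d) (c := 1 / 8) (by norm_num)).const_mul C).mono'
    ?_ (Eventually.of_forall fun ξ => hC t ht c le_rfl ξ)
  have := h.continuous_space ht
  exact Continuous.aestronglyMeasurable (by fun_prop)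

/-- Dominated convergence with the uniform bound. The end point `s = t`, where the variance
degenerates, is included; the Duhamel formula needs it. -/
theorem continuousOn_average (h : SubGaussian T w) {ν t : ℝ} (hν : 0 < ν) (ht : t ∈ Icc 0 T)
    (x : E d) : ContinuousOn
      (fun s => ∫ ξ, w s (x + √(2 * ν * (s - t)) • ξ) ∂(stdGaussian (E d))) (Icc t T) := by
  obtain ⟨C, _, hC⟩ := h.bound x (2 * ν * (T - t)) (mul_nonneg (by positivity) (by linarith [ht.2]))
  have hsub : ∀ s ∈ Icc t T, s ∈ Icc 0 T := fun s hs => ⟨ht.1.trans hs.1, hs.2⟩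
  refine continuousOn_of_dominated
    (bound := fun ξ => C * Real.exp (1 / 8 * ‖ξ‖ ^ 2)) ?_ ?_ ?_ ?_
  · intro s hs
    exact (h.integrable_shift (hsub s hs) x _).1
  · intro s hs
    refine Eventually.of_forall fun ξ => hC s (hsub s hs) _ ?_ ξ
    rw [Real.sq_sqrt (mul_nonneg (by positivity) (by linarith [hs.1]))]
    gcongr; exact hs.2
  · exact (integrable_exp_sq_stdGaussian (d := d) (c := 1 / 8) (by norm_num)).const_mul C
  · refine Eventually.of_forall fun ξ => ?_
    exact h.1.comp (f := fun s => (s, x + √(2 * ν * (s - t)) • ξ)) (by fun_prop)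
      fun s hs => ⟨hsub s hs, mem_univ _⟩

end SubGaussian

/-! ### Gaussian integration by parts -/

theorem norm_le_exp_sq (ξ : E d) : ‖ξ‖ ≤ 8 * Real.exp (1 / 8 * ‖ξ‖ ^ 2) := by
  have := Real.add_one_le_exp (1 / 8 * ‖ξ‖ ^ 2)
  nlinarith [sq_nonneg (‖ξ‖ - 1 / 2)]

theorem abs_coord_mul_le (ξ : E d) (k : Fin d) {a C : ℝ}
    (ha : |a| ≤ C * Real.exp (1 / 8 * ‖ξ‖ ^ 2)) :
    |ξ k * a| ≤ 8 * C * Real.exp (1 / 4 * ‖ξ‖ ^ 2) := by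
  have h1 : |ξ k| ≤ ‖ξ‖ := PiLp.norm_apply_le ξ k
  rw [abs_mul]
  calc |ξ k| * |a| ≤ (8 * Real.exp (1 / 8 * ‖ξ‖ ^ 2)) * (C * Real.exp (1 / 8 * ‖ξ‖ ^ 2)) :=
        mul_le_mul (h1.trans (norm_le_exp_sq ξ)) ha (abs_nonneg _) (by positivity)
    _ = 8 * C * (Real.exp (1 / 8 * ‖ξ‖ ^ 2) * Real.exp (1 / 8 * ‖ξ‖ ^ 2)) := by ring
    _ = _ := by rw [← Real.exp_add]; congr 2; ring

theorem hasLineDerivAt_heatKernel (ξ : E d) (k : Fin d) :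
    HasLineDerivAt ℝ (heatKernel 1 1 : E d → ℝ) (-(ξ k) * heatKernel 1 1 ξ) ξ
      (EuclideanSpace.single k 1) := by
  have h1 : HasFDerivAt (fun x : E d => ‖x‖ ^ 2) (2 • (innerSL ℝ ξ)) ξ :=
    (hasStrictFDerivAt_norm_sq ξ).hasFDerivAt
  have h2 := ((h1.const_mul (-(1 / 2))).exp.mul_const ((2 * Real.pi) ^ ((d : ℝ) / 2))⁻¹)
  have h3 := h2.hasLineDerivAt (EuclideanSpace.single k 1)
  rw [show (heatKernel 1 1 : E d → ℝ) = fun x => Real.exp (-(1 / 2) * ‖x‖ ^ 2) *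
    ((2 * Real.pi) ^ ((d : ℝ) / 2))⁻¹ from funext fun x => by
      rw [heatKernel_one_one, div_eq_mul_inv]]
  convert! h3 using 1
  simp [EuclideanSpace.inner_single_right]
  ring

/-- Integration by parts against the Gaussian density `φ`, since `∂_k φ = -ξ_k φ`. The growth bounds
make the three products integrable, so no boundary term appears. -/
theorem stein {f : E d → ℝ} (hf : Smooth f) (k : Fin d) {C : ℝ}
    (h0 : ∀ ξ, |f ξ| ≤ C * Real.exp (1 / 8 * ‖ξ‖ ^ 2))
    (h1 : ∀ ξ, |pd k f ξ| ≤ C * Real.exp (1 / 8 * ‖ξ‖ ^ 2)) :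
    ∫ ξ, ξ k * f ξ ∂(stdGaussian (E d)) = ∫ ξ, pd k f ξ ∂(stdGaussian (E d)) := by
  have c0 : Continuous f := hf.continuous
  have c1 : Continuous (pd k f) := (hf.pd k).continuous
  have i0 : Integrable f (stdGaussian (E d)) :=
    ((integrable_exp_sq_stdGaussian (d := d) (c := 1 / 8) (by norm_num)).const_mul C).mono'
      c0.aestronglyMeasurable (Eventually.of_forall h0)
  have i1 : Integrable (pd k f) (stdGaussian (E d)) :=
    ((integrable_exp_sq_stdGaussian (d := d) (c := 1 / 8) (by norm_num)).const_mul C).mono'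
      c1.aestronglyMeasurable (Eventually.of_forall h1)
  have i2 : Integrable (fun ξ => ξ k * f ξ) (stdGaussian (E d)) :=
    ((integrable_exp_sq_stdGaussian (d := d) (c := 1 / 4) (by norm_num)).const_mul (8 * C)).mono'
      (Continuous.aestronglyMeasurable (by fun_prop))
      (Eventually.of_forall fun ξ => abs_coord_mul_le ξ k (h0 ξ))
  rw [integral_stdGaussian_eq, integral_stdGaussian_eq]
  rw [integrable_stdGaussian_iff] at i0 i1 i2
  have := integral_bilinear_hasLineDerivAt_right_eq_neg_left_of_integrable (μ := volume)
    (f := (heatKernel 1 1 : E d → ℝ)) (f' := fun ξ => -(ξ k) * heatKernel 1 1 ξ) (g := f)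
    (g' := pd k f) (v := EuclideanSpace.single k 1) (B := ContinuousLinearMap.mul ℝ ℝ)
    (by
      refine i2.neg.congr (Eventually.of_forall fun ξ => ?_)
      simp; ring)
    (by simpa using i1) (by simpa using i0)
    (fun ξ _ => hasLineDerivAt_heatKernel ξ k) (fun ξ _ => hf.hasLineDerivAt k ξ)
  simp only [ContinuousLinearMap.mul_apply'] at this
  rw [this, ← integral_neg]
  congr 1
  funext ξ
  ring

/-! ### The Duhamel formula -/

theorem continuousAt_fderiv_of_pd {T : ℝ} {v : ℝ → E d → ℝ} (hv : ∀ t ∈ Icc 0 T, Smooth (v t))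
    (h1 : ∀ k, ContinuousOn (fun p : ℝ × E d => pd k (v p.1) p.2) (Icc 0 T ×ˢ univ))
    {s : ℝ} (hs : s ∈ Ioo 0 T) (z : E d) :
    ContinuousAt (fun p : ℝ × E d => fderiv ℝ (v p.1) p.2) (s, z) := by
  have hmem : Icc 0 T ×ˢ (univ : Set (E d)) ∈ 𝓝 (s, z) :=
    prod_mem_nhds (Icc_mem_nhds hs.1 hs.2) univ_mem
  have h2 : ContinuousAt (fun p : ℝ × E d => ∑ k, pd k (v p.1) p.2 •
      (EuclideanSpace.proj k : E d →L[ℝ] ℝ)) (s, z) :=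
    tendsto_finsetSum _ fun k _ => ((h1 k).continuousAt hmem).smul continuousAt_const
  refine h2.congr ?_
  filter_upwards [hmem] with p hp
  ext y
  rw [(hv p.1 hp.1).fderiv_eq_sum]
  simp [mul_comm]

/-- The smoothness class provides time and space derivatives separately. Their joint continuity
upgrades this to joint differentiability at interior times, which the chain rule along a path in
space-time requires. -/
theorem hasFDerivAt_spacetime {T : ℝ} {v vt : ℝ → E d → ℝ} (hv : ∀ t ∈ Icc 0 T, Smooth (v t))
    (h1 : ∀ k, ContinuousOn (fun p : ℝ × E d => pd k (v p.1) p.2) (Icc 0 T ×ˢ univ))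
    (hvt : ContinuousOn (fun p : ℝ × E d => vt p.1 p.2) (Icc 0 T ×ˢ univ))
    (hder : ∀ t ∈ Icc 0 T, ∀ x, HasDerivWithinAt (fun s => v s x) (vt t x) (Icc 0 T) t)
    {s : ℝ} (hs : s ∈ Ioo 0 T) (z : E d) :
    HasFDerivAt (fun p : ℝ × E d => v p.1 p.2)
      ((ContinuousLinearMap.toSpanSingleton ℝ (vt s z)).coprod (fderiv ℝ (v s) z)) (s, z) := by
  have hmem : Ioo 0 T ×ˢ (univ : Set (E d)) ∈ 𝓝 (s, z) :=
    prod_mem_nhds (Ioo_mem_nhds hs.1 hs.2) univ_mem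
  have hmem' : Icc 0 T ×ˢ (univ : Set (E d)) ∈ 𝓝 (s, z) :=
    prod_mem_nhds (Icc_mem_nhds hs.1 hs.2) univ_mem
  refine (hasStrictFDerivAt_uncurry_coprod (𝕜 := ℝ) (u := (s, z)) (f := v)
    (f₁ := fun a b => ContinuousLinearMap.toSpanSingleton ℝ (vt a b))
    (f₂ := fun a b => fderiv ℝ (v a) b) ?_ ?_ ?_ ?_).hasFDerivAt
  · filter_upwards [hmem] with p hp
    exact ((hder p.1 (Ioo_subset_Icc_self hp.1) p.2).hasDerivAt
      (Icc_mem_nhds hp.1.1 hp.1.2)).hasFDerivAt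
  · filter_upwards [hmem] with p hp
    exact ((hv p.1 (Ioo_subset_Icc_self hp.1)).differentiable p.2).hasFDerivAt
  · have := hvt.continuousAt hmem'
    exact ((ContinuousLinearMap.toSpanSingletonCLE (𝕜 := ℝ) (E := ℝ)).continuous.continuousAt.comp
      this)
  · exact continuousAt_fderiv_of_pd hv h1 hs z

theorem hasDerivAt_along {T ν : ℝ} (hν : 0 < ν) {v vt : ℝ → E d → ℝ}
    (hv : ∀ t ∈ Icc 0 T, Smooth (v t))
    (h1 : ∀ k, ContinuousOn (fun p : ℝ × E d => pd k (v p.1) p.2) (Icc 0 T ×ˢ univ))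
    (hvt : ContinuousOn (fun p : ℝ × E d => vt p.1 p.2) (Icc 0 T ×ˢ univ))
    (hder : ∀ t ∈ Icc 0 T, ∀ x, HasDerivWithinAt (fun s => v s x) (vt t x) (Icc 0 T) t)
    {t s : ℝ} (ht : 0 ≤ t) (hs : s ∈ Ioo t T) (x ξ : E d) :
    HasDerivAt (fun s => v s (x + √(2 * ν * (s - t)) • ξ))
      (vt s (x + √(2 * ν * (s - t)) • ξ) + ν / √(2 * ν * (s - t)) *
        ∑ k, ξ k * pd k (v s) (x + √(2 * ν * (s - t)) • ξ)) s := by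
  have hs' : s ∈ Ioo 0 T := ⟨ht.trans_lt hs.1, hs.2⟩
  have hpos : 0 < 2 * ν * (s - t) := mul_pos (by positivity) (sub_pos.2 hs.1)
  have h2 : HasDerivAt (fun s => √(2 * ν * (s - t))) (ν / √(2 * ν * (s - t))) s := by
    have : HasDerivAt (fun s => 2 * ν * (s - t)) (2 * ν) s := by
      simpa using ((hasDerivAt_id s).sub_const t).const_mul (2 * ν)
    convert! this.sqrt hpos.ne' using 1
    rw [mul_div_mul_left _ _ two_ne_zero]
  have h3 : HasDerivAt (fun s => (s, x + √(2 * ν * (s - t)) • ξ))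
      ((1 : ℝ), (ν / √(2 * ν * (s - t))) • ξ) s :=
    (hasDerivAt_id s).prodMk ((h2.smul_const ξ).const_add x)
  have h4 := (hasFDerivAt_spacetime hv h1 hvt hder hs'
    (x + √(2 * ν * (s - t)) • ξ)).comp_hasDerivAt s h3
  convert! h4 using 1
  simp only [ContinuousLinearMap.coprod_apply, ContinuousLinearMap.toSpanSingleton_apply, map_smul,
    smul_eq_mul, one_mul]
  rw [(hv s (Ioo_subset_Icc_self hs')).fderiv_eq_sum]

theorem pd_shift {f : E d → ℝ} (hf : Smooth f) (x : E d) (c : ℝ) (k : Fin d) (ξ : E d) :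
    pd k (fun ξ => f (x + c • ξ)) ξ = c * pd k f (x + c • ξ) := by
  have hs : Smooth (fun ξ => f (x + c • ξ)) := by
    refine ContDiff.comp hf ?_; fun_prop
  have h1 : HasFDerivAt (fun ξ : E d => x + c • ξ) (c • ContinuousLinearMap.id ℝ (E d)) ξ :=
    ((hasFDerivAt_id ξ).const_smul c).const_add x
  have h2 := ((hf.differentiable (x + c • ξ)).hasFDerivAt.comp ξ h1).fderiv
  rw [hs.pd_eq, hf.pd_eq]
  change fderiv ℝ (f ∘ fun ξ => x + c • ξ) ξ _ = _
  rw [h2]; simp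

/-- Along the path `x + c(s) ξ` with `c(s) = √(2ν(s-t))` the time derivative contains `(ν/c) ξ·∇v`.
Stein's identity turns its mean into the mean of `νΔv`, which cancels against the Laplacian in the
equation for `v` and leaves the source. -/
theorem hasDerivAt_average {T ν : ℝ} (hν : 0 < ν) {v src : ℝ → E d → ℝ}
    (hv : ∀ t ∈ Icc 0 T, Smooth (v t)) (h0 : SubGaussian T v)
    (h1 : ∀ k, SubGaussian T (fun t => pd k (v t)))
    (h2 : ∀ k, SubGaussian T (fun t => pd k (pd k (v t)))) (hsrc : SubGaussian T src)
    (hder : ∀ t ∈ Icc 0 T, ∀ x, HasDerivWithinAt (fun s => v s x)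
      (-(ν * ∑ k, pd k (pd k (v t)) x) - src t x) (Icc 0 T) t)
    {t s : ℝ} (ht : 0 ≤ t) (hs : s ∈ Ioo t T) (x : E d) :
    HasDerivAt (fun s => ∫ ξ, v s (x + √(2 * ν * (s - t)) • ξ) ∂(stdGaussian (E d)))
      (-∫ ξ, src s (x + √(2 * ν * (s - t)) • ξ) ∂(stdGaussian (E d))) s := by
  set vt : ℝ → E d → ℝ := fun t x => -(ν * ∑ k, pd k (pd k (v t)) x) - src t x with hvt_def
  have hvt : SubGaussian T vt :=
    ((SubGaussian.const (-1)).mul (((SubGaussian.const ν).mul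
      (SubGaussian.sum Finset.univ fun k _ => h2 k)).add hsrc)).congr fun t _ x => by
        simp only [hvt_def]; ring
  set c : ℝ → ℝ := fun s => √(2 * ν * (s - t)) with hc
  have htT : t < T := hs.1.trans hs.2
  have hM : 0 ≤ 2 * ν * (T - t) := mul_nonneg (by positivity) (by linarith)
  have hcM : ∀ s ∈ Icc t T, c s ^ 2 ≤ 2 * ν * (T - t) := fun s hs => by
    rw [hc]; simp only
    rw [Real.sq_sqrt (mul_nonneg (by positivity) (by linarith [hs.1]))]
    gcongr; exact hs.2
  have hIcc : ∀ s ∈ Icc t T, s ∈ Icc 0 T := fun s hs => ⟨ht.trans hs.1, hs.2⟩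
  obtain ⟨Cv, hCv0, hCv⟩ := hvt.bound x _ hM
  choose C1 hC10 hC1 using fun k => (h1 k).bound x _ hM
  -- The factor `ν / c(r)` blows up as `r → t`. On a neighbourhood of `s` away from `t` it is at
  -- most its value at `s - δ`, which gives an integrable dominating function.
  obtain ⟨δ, hδ, hball⟩ : ∃ δ > 0, Icc (s - δ) (s + δ) ⊆ Ioo t T := by
    obtain ⟨ε, hε, h⟩ := Metric.isOpen_iff.1 isOpen_Ioo s hs
    refine ⟨ε / 2, by positivity, fun r hr => h ?_⟩
    rw [Metric.mem_ball, Real.dist_eq, abs_lt]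
    constructor <;> linarith [hr.1, hr.2]
  have hδt : t < s - δ := (hball ⟨le_rfl, by linarith⟩).1
  set R : ℝ := ν / c (s - δ) with hR
  have hcpos : ∀ r, t < r → 0 < c r := fun r hr =>
    Real.sqrt_pos.2 (mul_pos (by positivity) (sub_pos.2 hr))
  have hcint : Metric.ball s δ ∈ 𝓝 s := Metric.ball_mem_nhds s hδ
  have hballmem : ∀ r ∈ Metric.ball s δ, r ∈ Ioo t T ∧ s - δ ≤ r := fun r hr => by
    rw [Metric.mem_ball, Real.dist_eq, abs_lt] at hr
    exact ⟨hball ⟨by linarith [hr.1], by linarith [hr.2]⟩, by linarith [hr.1]⟩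
  have key := hasDerivAt_integral_of_dominated_loc_of_deriv_le (μ := stdGaussian (E d))
    (F := fun s ξ => v s (x + c s • ξ))
    (F' := fun s ξ => vt s (x + c s • ξ) + ν / c s * ∑ k, ξ k * pd k (v s) (x + c s • ξ))
    (bound := fun ξ => Cv * Real.exp (1 / 4 * ‖ξ‖ ^ 2) +
      R * ∑ k, 8 * C1 k * Real.exp (1 / 4 * ‖ξ‖ ^ 2)) (x₀ := s) hcint ?_ ?_ ?_ ?_ ?_ ?_
  · have h3 := key.2
    convert! h3 using 1
    have hs0 : s ∈ Icc 0 T := hIcc s (Ioo_subset_Icc_self hs)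
    have hi2 : ∀ k, Integrable (fun ξ : E d => ξ k * pd k (v s) (x + c s • ξ))
        (stdGaussian (E d)) := fun k => by
      refine ((integrable_exp_sq_stdGaussian (d := d) (c := 1 / 4) (by norm_num)).const_mul
        (8 * C1 k)).mono' ?_ (Eventually.of_forall fun ξ => abs_coord_mul_le ξ k
          (hC1 k s hs0 _ (hcM s (Ioo_subset_Icc_self hs)) ξ))
      have := (h1 k).continuous_space hs0
      exact Continuous.aestronglyMeasurable (by fun_prop)
    -- Stein's identity for `ξ ↦ ∂_k v(s, x + c ξ)`; the inner derivative gives the factor `c`,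
    -- which cancels the `1/c` of the path.
    have hst : ∀ k, ∫ ξ, ξ k * pd k (v s) (x + c s • ξ) ∂(stdGaussian (E d)) =
        c s * ∫ ξ, pd k (pd k (v s)) (x + c s • ξ) ∂(stdGaussian (E d)) := fun k => by
      obtain ⟨C2, hC20, hC2⟩ := (h2 k).bound x _ hM
      have hsm : Smooth (fun ξ => pd k (v s) (x + c s • ξ)) := by
        refine ContDiff.comp ((hv s hs0).pd k) ?_; fun_prop
      have hcs := hcM s (Ioo_subset_Icc_self hs)
      have := stein hsm k (C := max (C1 k) (|c s| * C2))
        (fun ξ => (hC1 k s hs0 _ hcs ξ).trans (by gcongr; exact le_max_left _ _))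
        (fun ξ => by
          rw [pd_shift ((hv s hs0).pd k), abs_mul]
          calc |c s| * |pd k (pd k (v s)) (x + c s • ξ)|
              ≤ |c s| * (C2 * Real.exp (1 / 8 * ‖ξ‖ ^ 2)) := by gcongr; exact hC2 s hs0 _ hcs ξ
            _ = (|c s| * C2) * Real.exp (1 / 8 * ‖ξ‖ ^ 2) := by ring
            _ ≤ _ := by gcongr; exact le_max_right _ _)
      rw [this]
      simp_rw [pd_shift ((hv s hs0).pd k)]
      rw [integral_const_mul]
    rw [integral_add (hvt.integrable_shift hs0 x _)
      ((integrable_finsetSum _ fun k _ => hi2 k).const_mul _), integral_const_mul,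
      integral_finsetSum _ fun k _ => hi2 k]
    simp_rw [hst]
    rw [← Finset.mul_sum, ← mul_assoc, div_mul_cancel₀ _ (hcpos s hs.1).ne',
      ← integral_finsetSum _ fun k _ => (h2 k).integrable_shift hs0 x _, ← integral_const_mul,
      ← integral_add (hvt.integrable_shift hs0 x _) ((integrable_finsetSum _ fun k _ =>
        (h2 k).integrable_shift hs0 x _).const_mul _), ← integral_neg]
    congr 1
    funext ξ
    simp only [hvt_def]; ring
  · filter_upwards [hcint] with r hr
    exact (h0.integrable_shift (hIcc r (Ioo_subset_Icc_self (hballmem r hr).1)) x _).1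
  · exact h0.integrable_shift (hIcc s (Ioo_subset_Icc_self hs)) x _
  · have hs0 : s ∈ Icc 0 T := hIcc s (Ioo_subset_Icc_self hs)
    have a1 := hvt.continuous_space hs0
    have a2 := fun k => (h1 k).continuous_space hs0
    exact Continuous.aestronglyMeasurable (by fun_prop)
  · refine Eventually.of_forall fun ξ r hr => ?_
    obtain ⟨hr1, hr2⟩ := hballmem r hr
    have hr0 := hIcc r (Ioo_subset_Icc_self hr1)
    have hcr := hcM r (Ioo_subset_Icc_self hr1)
    refine (abs_add_le _ _).trans (add_le_add ?_ ?_)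
    · refine (hCv r hr0 _ hcr ξ).trans ?_
      gcongr; norm_num
    · rw [abs_mul]
      have hcr' : |ν / c r| ≤ R := by
        rw [abs_of_pos (div_pos hν (hcpos r hr1.1)), hR]
        have : c (s - δ) ≤ c r := Real.sqrt_le_sqrt (by gcongr)
        have := hcpos _ hδt
        gcongr
      refine mul_le_mul hcr' ((Finset.abs_sum_le_sum_abs _ _).trans (Finset.sum_le_sum fun k _ =>
        abs_coord_mul_le ξ k (hC1 k r hr0 _ hcr ξ))) (abs_nonneg _) ((abs_nonneg _).trans hcr')
  · have := integrable_exp_sq_stdGaussian (d := d) (c := 1 / 4) (by norm_num)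
    exact (this.const_mul _).add
      ((integrable_finsetSum _ fun k _ => this.const_mul _).const_mul R)
  · refine Eventually.of_forall fun ξ r hr => ?_
    exact hasDerivAt_along hν hv (fun k => (h1 k).1) hvt.1 hder ht (hballmem r hr).1 x ξ

/-- The Duhamel formula. -/
theorem duhamel {T ν : ℝ} (hν : 0 < ν) {v src : ℝ → E d → ℝ}
    (hv : ∀ t ∈ Icc 0 T, Smooth (v t)) (h0 : SubGaussian T v)
    (h1 : ∀ k, SubGaussian T (fun t => pd k (v t)))
    (h2 : ∀ k, SubGaussian T (fun t => pd k (pd k (v t)))) (hsrc : SubGaussian T src)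
    (hder : ∀ t ∈ Icc 0 T, ∀ x, HasDerivWithinAt (fun s => v s x)
      (-(ν * ∑ k, pd k (pd k (v t)) x) - src t x) (Icc 0 T) t)
    {t : ℝ} (ht : t ∈ Ico 0 T) (x : E d) :
    v t x = ∫ ξ, v T (x + √(2 * ν * (T - t)) • ξ) ∂(stdGaussian (E d)) +
      ∫ s in Ioc t T, ∫ ξ, src s (x + √(2 * ν * (s - t)) • ξ) ∂(stdGaussian (E d)) := by
  have ht' : t ∈ Icc 0 T := Ico_subset_Icc_self ht
  have hc := hsrc.continuousOn_average hν ht' x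
  -- The derivative is known only on the open interval; continuity at the ends suffices. At `s = t`
  -- the average of `v` collapses to `v t x`.
  have := intervalIntegral.integral_eq_sub_of_hasDerivAt_of_le ht.2.le
    (h0.continuousOn_average hν ht' x)
    (fun s hs => hasDerivAt_average hν hv h0 h1 h2 hsrc hder ht.1 hs x)
    (hc.neg.intervalIntegrable_of_Icc ht.2.le)
  rw [intervalIntegral.integral_neg, intervalIntegral.integral_of_le ht.2.le] at this
  simp only [sub_self, mul_zero, Real.sqrt_zero, zero_smul, add_zero, integral_const, probReal_univ,
    one_smul] at this
  linarith

/-- For each fixed time the spatial `L¹` norm is a Gaussian average of `|src|`, bounded uniformly in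
time, and the time interval is finite. -/
theorem SubGaussian.integrable_heat {T ν : ℝ} (hν : 0 < ν) {src : ℝ → E d → ℝ}
    (hsrc : SubGaussian T src) {t : ℝ} (ht : t ∈ Ico 0 T) (x : E d) :
    Integrable (fun p : ℝ × E d => heatKernel (2 * ν) (p.1 - t) (p.2 - x) * src p.1 p.2)
      ((volume.restrict (Ioc t T)).prod volume) := by
  have hsub : Ioc t T ×ˢ (univ : Set (E d)) ⊆ Icc 0 T ×ˢ univ :=
    prod_mono (fun s hs => ⟨ht.1.trans hs.1.le, hs.2⟩) le_rfl
  have hmeas : AEStronglyMeasurable (fun p : ℝ × E d => heatKernel (2 * ν) (p.1 - t) (p.2 - x) *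
      src p.1 p.2) ((volume.restrict (Ioc t T)).prod volume) := by
    refine AEStronglyMeasurable.mul ?_ ?_
    · unfold heatKernel
      exact Measurable.aestronglyMeasurable (by fun_prop)
    · have : (volume.restrict (Ioc t T)).prod (volume : Measure (E d)) =
          (volume.prod volume).restrict (Ioc t T ×ˢ univ) := by
        rw [← Measure.prod_restrict, Measure.restrict_univ]
      rw [this]
      exact (hsrc.1.mono hsub).aestronglyMeasurable (measurableSet_Ioc.prod MeasurableSet.univ)
  have hpos : ∀ s ∈ Ioc t T, 0 < 2 * ν * (s - t) := fun s hs =>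
    mul_pos (by positivity) (sub_pos.2 hs.1)
  have hIcc : ∀ s ∈ Ioc t T, s ∈ Icc 0 T := fun s hs => ⟨ht.1.trans hs.1.le, hs.2⟩
  rw [integrable_prod_iff hmeas]
  have hi : ∀ s ∈ Ioc t T, Integrable (fun y => heatKernel (2 * ν) (s - t) (y - x) * src s y) :=
    fun s hs => (integrable_gaussian_shift_iff (hpos s hs) x).1
      (hsrc.integrable_shift (hIcc s hs) x _)
  refine ⟨(ae_restrict_iff' measurableSet_Ioc).2 (Eventually.of_forall hi), ?_⟩
  obtain ⟨C, hC0, hC⟩ := hsrc.bound x (2 * ν * (T - t))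
    (mul_nonneg (by positivity) (by linarith [ht.2]))
  refine Integrable.of_bound hmeas.norm.integral_prod_right' (C * ∫ ξ,
    Real.exp (1 / 8 * ‖ξ‖ ^ 2) ∂(stdGaussian (E d))) ?_
  refine (ae_restrict_iff' measurableSet_Ioc).2 (Eventually.of_forall fun s hs => ?_)
  have e1 : ∀ y, ‖heatKernel (2 * ν) (s - t) (y - x) * src s y‖ =
      heatKernel (2 * ν) (s - t) (y - x) * |src s y| := fun y => by
    rw [norm_mul, Real.norm_of_nonneg (heatKernel_nonneg (hpos s hs).le _)]; rfl
  simp_rw [e1]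
  rw [← integral_gaussian_shift (hpos s hs) x (fun y => |src s y|), Real.norm_of_nonneg
    (integral_nonneg fun _ => abs_nonneg _), ← integral_const_mul]
  refine integral_mono (hsrc.integrable_shift (hIcc s hs) x _).abs
    ((integrable_exp_sq_stdGaussian (d := d) (c := 1 / 8) (by norm_num)).const_mul C) fun ξ => ?_
  refine hC s (hIcc s hs) _ ?_ ξ
  rw [Real.sq_sqrt (hpos s hs).le]
  gcongr; exact hs.2

/-! ### The Newtonian kernel -/

theorem measurable_poissonN : Measurable (poissonN : E d → ℝ) := by
  unfold poissonN
  by_cases h : d = 2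
  · simp only [h, if_true]; fun_prop
  · simp only [h, if_false]; fun_prop

theorem measurable_newtonKernel : Measurable (newtonKernel : E d → ℝ) := by
  unfold newtonKernel
  have := measurable_poissonN (d := d)
  fun_prop

theorem continuousAt_newtonKernel {y : E d} (hy : y ≠ 0) :
    ContinuousAt (newtonKernel : E d → ℝ) y := by
  have hy' : ‖y‖ ≠ 0 := norm_ne_zero_iff.2 hy
  unfold newtonKernel
  refine continuousAt_const.mul (ContinuousAt.div ?_ (by fun_prop) (pow_ne_zero _ hy'))
  unfold poissonN
  by_cases h : d = 2
  · simp only [h, if_true]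
    exact (continuous_norm.pow 2).continuousAt.mul (continuous_norm.continuousAt.log hy')
  · simp only [h, if_false]; fun_prop

/-- The Jacobian bookkeeping for `r ↦ 1/r`, which turns the heat-kernel integral in time into a
Gamma integral. -/
theorem heat_time_substitution {a b : ℝ} {r : ℝ} (hr : 0 < r) :
    (|(-1 : ℝ)| * r ^ ((-1 : ℝ) - 1)) • ((r ^ (-1 : ℝ)) ^ (b - 1) *
      Real.exp (-(a * r ^ (-1 : ℝ)))) = r ^ (-b - 1) * Real.exp (-(a / r)) := by
  rw [← Real.rpow_mul hr.le, smul_eq_mul, ← mul_assoc, abs_neg, abs_one, one_mul,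
    ← Real.rpow_add hr, Real.rpow_neg_one, div_eq_mul_inv]
  congr 2; ring

theorem integrableOn_heat_time {a b : ℝ} (ha : 0 < a) (hb : 0 < b) :
    IntegrableOn (fun r : ℝ => r ^ (-b - 1) * Real.exp (-(a / r))) (Ioi 0) := by
  have h1 : IntegrableOn (fun r : ℝ => r ^ (b - 1) * Real.exp (-(a * r))) (Ioi 0) := by
    have := integrableOn_rpow_mul_exp_neg_mul_rpow (p := 1) (s := b - 1) (b := a)
      (by linarith) one_pos ha
    simpa using this
  rw [← integrableOn_Ioi_comp_rpow_iff _ (neg_ne_zero.2 one_ne_zero)] at h1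
  exact h1.congr_fun (fun r hr => heat_time_substitution hr) measurableSet_Ioi

theorem integral_heat_time {a b : ℝ} (ha : 0 < a) (hb : 0 < b) :
    ∫ r in Ioi (0 : ℝ), r ^ (-b - 1) * Real.exp (-(a / r)) = (1 / a) ^ b * Real.Gamma b := by
  rw [← Real.integral_rpow_mul_exp_neg_mul_Ioi hb ha,
    ← integral_comp_rpow_Ioi (fun t => t ^ (b - 1) * Real.exp (-(a * t)))
      (neg_ne_zero.2 one_ne_zero)]
  exact setIntegral_congr_fun measurableSet_Ioi (fun r hr => (heat_time_substitution hr).symm)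

theorem heatKernel_mul_div (y : E d) (c : ℝ) {s : ℝ} (hs : 0 < s) :
    heatKernel 1 s y * (c / (2 * s)) = (c / 2 / (2 * Real.pi) ^ ((d : ℝ) / 2)) *
      (s ^ (-((d : ℝ) / 2) - 1) * Real.exp (-(‖y‖ ^ 2 / 2 / s))) := by
  unfold heatKernel
  rw [mul_one, mul_one, Real.mul_rpow (by positivity) hs.le, Real.rpow_sub hs, Real.rpow_neg hs.le,
    Real.rpow_one]
  rw [show -‖y‖ ^ 2 / (2 * s) = -(‖y‖ ^ 2 / 2 / s) by field_simp]
  field_simp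

theorem integrableOn_heatKernel_time (hd : 2 ≤ d) {y : E d} (hy : y ≠ 0) (c : ℝ) :
    IntegrableOn (fun s => heatKernel 1 s y * (c / (2 * s))) (Ioi 0) := by
  have hy' : 0 < ‖y‖ := norm_pos_iff.2 hy
  have hd' : (0 : ℝ) < d := by positivity
  have h1 : IntegrableOn (fun s => (c / 2 / (2 * Real.pi) ^ ((d : ℝ) / 2)) *
      (s ^ (-((d : ℝ) / 2) - 1) * Real.exp (-(‖y‖ ^ 2 / 2 / s)))) (Ioi 0) :=
    (integrableOn_heat_time (by positivity) (by positivity)).const_mul _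
  exact h1.congr_fun (fun s hs => (heatKernel_mul_div y c hs).symm) measurableSet_Ioi

/-- For `c = N(y)` this is the Newtonian kernel, and for `c = |N(y)|` its absolute value. The second
case is what permits Fubini. -/
theorem integral_heatKernel_time (hd : 2 ≤ d) {y : E d} (hy : y ≠ 0) (c : ℝ) :
    ∫ s in Ioi (0 : ℝ), heatKernel 1 s y * (c / (2 * s)) =
      Real.Gamma ((d : ℝ) / 2) / (2 * Real.pi ^ ((d : ℝ) / 2)) * (c / ‖y‖ ^ d) := by
  have hy' : 0 < ‖y‖ := norm_pos_iff.2 hy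
  have hd' : (0 : ℝ) < d := by positivity
  rw [setIntegral_congr_fun measurableSet_Ioi (fun s hs => heatKernel_mul_div y c hs),
    integral_const_mul, integral_heat_time (by positivity) (by positivity)]
  have h1 : (1 / (‖y‖ ^ 2 / 2)) ^ ((d : ℝ) / 2) = 2 ^ ((d : ℝ) / 2) / ‖y‖ ^ d := by
    rw [one_div_div, Real.div_rpow (by positivity) (by positivity), ← Real.rpow_natCast ‖y‖ 2,
      ← Real.rpow_mul hy'.le, ← Real.rpow_natCast ‖y‖ d]
    congr 2; push_cast; ring
  rw [h1, Real.mul_rpow (by norm_num) Real.pi_pos.le]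
  have : (0 : ℝ) < 2 ^ ((d : ℝ) / 2) := by positivity
  field_simp

theorem ae_ne_zero (hd : 2 ≤ d) : ∀ᵐ y : E d, y ≠ 0 := by
  have : Nonempty (Fin d) := ⟨⟨0, by omega⟩⟩
  have : Nontrivial (E d) := inferInstance
  exact (measure_eq_zero_iff_ae_notMem (s := {(0 : E d)})).1 (measure_singleton _)

theorem measurable_heat_poisson : Measurable (fun p : ℝ × E d =>
    heatKernel 1 p.1 p.2 * (poissonN p.2 / (2 * p.1))) := by
  unfold heatKernel
  have := measurable_poissonN (d := d)
  fun_prop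

theorem heat_poisson_norm {s : ℝ} (hs : 0 < s) (y : E d) (g : ℝ) :
    ‖heatKernel 1 s y * (poissonN y / (2 * s)) * g‖ =
      heatKernel 1 s y * (|poissonN y| / (2 * s)) * |g| := by
  rw [norm_mul, norm_mul, Real.norm_of_nonneg (heatKernel_nonneg (by linarith) y), Real.norm_eq_abs,
    Real.norm_eq_abs, abs_div, abs_of_pos (by linarith : 0 < 2 * s)]

theorem abs_newtonKernel (hd : 2 ≤ d) (y : E d) : |newtonKernel y| =
    Real.Gamma ((d : ℝ) / 2) / (2 * Real.pi ^ ((d : ℝ) / 2)) * (|poissonN y| / ‖y‖ ^ d) := by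
  have hd' : (0 : ℝ) < d := by positivity
  have := Real.Gamma_pos_of_pos (s := (d : ℝ) / 2) (by positivity)
  unfold newtonKernel
  rw [abs_mul, abs_div (poissonN y), abs_of_nonneg (by positivity), abs_of_nonneg (by positivity :
    0 ≤ ‖y‖ ^ d)]

/-- By Tonelli: integrating the absolute value in time first leaves `|k(y)| |g(y)|`. -/
theorem integrable_heat_poisson (hd : 2 ≤ d) {g : E d → ℝ} (hg : AEStronglyMeasurable g)
    (hK : Integrable (fun y => newtonKernel y * g y)) :
    Integrable (fun p : ℝ × E d => heatKernel 1 p.1 p.2 * (poissonN p.2 / (2 * p.1)) * g p.2)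
      ((volume.restrict (Ioi 0)).prod volume) := by
  have hm : AEStronglyMeasurable (fun p : ℝ × E d => heatKernel 1 p.1 p.2 *
      (poissonN p.2 / (2 * p.1)) * g p.2) ((volume.restrict (Ioi 0)).prod volume) :=
    measurable_heat_poisson.aestronglyMeasurable.mul hg.comp_snd
  rw [integrable_prod_iff' hm]
  constructor
  · filter_upwards [ae_ne_zero hd] with y hy
    exact (integrableOn_heatKernel_time hd hy (poissonN y)).mul_const (g y)
  · refine hK.norm.congr ?_
    filter_upwards [ae_ne_zero hd] with y hy
    rw [setIntegral_congr_fun measurableSet_Ioi (fun s hs => heat_poisson_norm hs y (g y)),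
      integral_mul_const, integral_heatKernel_time hd hy, norm_mul, Real.norm_eq_abs,
      Real.norm_eq_abs, abs_newtonKernel hd]

theorem integral_heat_poisson (hd : 2 ≤ d) {g : E d → ℝ} (hg : AEStronglyMeasurable g)
    (hK : Integrable (fun y => newtonKernel y * g y)) :
    ∫ s in Ioi (0 : ℝ), ∫ y : E d, heatKernel 1 s y * (poissonN y / (2 * s)) * g y =
      ∫ y, newtonKernel y * g y := by
  rw [integral_integral_swap (f := fun s (y : E d) =>
    heatKernel 1 s y * (poissonN y / (2 * s)) * g y) (integrable_heat_poisson hd hg hK)]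
  refine integral_congr_ae ?_
  filter_upwards [ae_ne_zero hd] with y hy
  rw [integral_mul_const, integral_heatKernel_time hd hy, newtonKernel]

/-- In polar coordinates the factor `r^{d-1}` cancels the singularity. -/
theorem integrableOn_newtonKernel (hd : 2 ≤ d) (R : ℝ) :
    IntegrableOn (newtonKernel : E d → ℝ) (Metric.ball 0 R) := by
  have : Nonempty (Fin d) := ⟨⟨0, by omega⟩⟩
  have : Nontrivial (E d) := inferInstance
  set κ := Real.Gamma ((d : ℝ) / 2) / (2 * Real.pi ^ ((d : ℝ) / 2)) with hκ
  let f : ℝ → ℝ := (Iio R).indicator fun r =>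
    κ * ((if d = 2 then r ^ 2 * Real.log r else r ^ 2 / (2 - (d : ℝ))) / r ^ d)
  have h1 : (Metric.ball (0 : E d) R).indicator newtonKernel = fun x : E d => f ‖x‖ := by
    funext x
    by_cases hx : ‖x‖ < R
    · simp [f, hx, newtonKernel, poissonN, hκ]
    · simp [f, hx]
  rw [← integrable_indicator_iff Metric.isOpen_ball.measurableSet, h1,
    integrable_fun_norm_addHaar volume (f := f)]
  -- The radial density `r^{d-1} k(r)`, which extends continuously to `r = 0` because `r log r`
  -- does.
  let h : ℝ → ℝ := fun r => κ * (if d = 2 then r * Real.log r else r / (2 - (d : ℝ)))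
  have hh : Continuous h := by
    have := Real.continuous_mul_log
    by_cases hd2 : d = 2
    · simp only [h, hd2, if_true]; fun_prop
    · simp only [h, hd2, if_false]; fun_prop
  have h2 : IntegrableOn ((Iio R).indicator h) (Ioi 0) := by
    rw [IntegrableOn, integrable_indicator_iff measurableSet_Iio, IntegrableOn,
      Measure.restrict_restrict measurableSet_Iio]
    exact (hh.integrableOn_Icc (a := 0) (b := R)).mono_set fun r hr => ⟨hr.2.le, hr.1.le⟩
  refine h2.congr_fun (fun r hr => ?_) measurableSet_Ioi
  have hr : 0 < r := hr
  simp only [f, h, finrank_euclideanSpace_fin, smul_eq_mul, indicator]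
  split_ifs with h3 h4
  · subst h4; norm_num; field_simp
  · obtain ⟨e, rfl⟩ : ∃ e, d = e + 1 := ⟨d - 1, by omega⟩
    simp only [Nat.add_sub_cancel]
    have : (2 : ℝ) - ((e + 1 : ℕ) : ℝ) ≠ 0 := by
      intro h5
      apply h4
      have : ((e + 1 : ℕ) : ℝ) = (2 : ℕ) := by push_cast at h5 ⊢; linarith
      exact_mod_cast this
    field_simp
    ring
  · simp

/-- Under these conditions `(2/3)|y| ≤ |y'|`, `|y'|² ≤ 2|y|²` and, for `d = 2`, `log|y'| ≤ 2
log|y|`; hence the constant `4 (3/2)^d`. Starting at distance 3 keeps both logarithms nonnegative.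
-/
theorem newtonKernel_far (hd : 2 ≤ d) : ∃ C : ℝ, 0 ≤ C ∧ ∀ y y' : E d, 3 ≤ ‖y‖ → ‖y' - y‖ ≤ 1 →
    |newtonKernel y'| ≤ C * |newtonKernel y| := by
  refine ⟨4 * (3 / 2) ^ d, by positivity, fun y y' hy hyy' => ?_⟩
  rw [abs_newtonKernel hd, abs_newtonKernel hd, mul_left_comm]
  have hd' : (0 : ℝ) < d := by positivity
  have hG := Real.Gamma_pos_of_pos (s := (d : ℝ) / 2) (by positivity)
  refine mul_le_mul_of_nonneg_left ?_ (by positivity)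
  have h1 : ‖y'‖ ≤ ‖y‖ + 1 := by
    have := norm_add_le y (y' - y); rw [add_sub_cancel] at this; linarith
  have h2 : ‖y‖ - 1 ≤ ‖y'‖ := by
    have := norm_sub_norm_le y y'; rw [norm_sub_rev] at this; linarith
  have h3 : 2 / 3 * ‖y‖ ≤ ‖y'‖ := by linarith
  have hpos : 0 < ‖y‖ := by linarith
  have hpos' : 0 < ‖y'‖ := by linarith
  have h4 : |poissonN y'| ≤ 4 * |poissonN y| := by
    have h5 : ‖y'‖ ^ 2 ≤ 2 * ‖y‖ ^ 2 := by nlinarith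
    unfold poissonN
    split_ifs with h
    · have l1 : 0 ≤ Real.log ‖y‖ := Real.log_nonneg (by linarith)
      have l2 : 0 ≤ Real.log ‖y'‖ := Real.log_nonneg (by linarith)
      have l3 : Real.log ‖y'‖ ≤ 2 * Real.log ‖y‖ := by
        have : Real.log ‖y'‖ ≤ Real.log (‖y‖ ^ 2) := Real.log_le_log hpos' (by nlinarith)
        rwa [Real.log_pow] at this
      rw [abs_of_nonneg (by positivity), abs_of_nonneg (by positivity)]
      calc ‖y'‖ ^ 2 * Real.log ‖y'‖ ≤ (2 * ‖y‖ ^ 2) * (2 * Real.log ‖y‖) :=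
            mul_le_mul h5 l3 l2 (by positivity)
        _ = _ := by ring
    · rw [abs_div, abs_div, abs_of_nonneg (by positivity : 0 ≤ ‖y'‖ ^ 2),
        abs_of_nonneg (by positivity : 0 ≤ ‖y‖ ^ 2), ← mul_div_assoc]
      gcongr
      nlinarith [sq_nonneg ‖y‖]
  have h6 : ‖y‖ ^ d ≤ (3 / 2) ^ d * ‖y'‖ ^ d := by
    rw [← mul_pow]; gcongr; linarith
  rw [mul_div_assoc', div_le_div_iff₀ (by positivity) (by positivity)]
  calc |poissonN y'| * ‖y‖ ^ d ≤ (4 * |poissonN y|) * ((3 / 2) ^ d * ‖y'‖ ^ d) :=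
        mul_le_mul h4 h6 (by positivity) (by positivity)
    _ = _ := by ring

/-! ### Potentials -/

/-- A kernel that is locally integrable, continuous off the origin, and slowly varying at
infinity. -/
structure IsPotentialKernel (K : E d → ℝ) : Prop where
  measurable : Measurable K
  continuousAt : ∀ y, y ≠ 0 → ContinuousAt K y
  integrableOn : ∀ R, IntegrableOn K (Metric.ball 0 R)
  far : ∃ C : ℝ, 0 ≤ C ∧ ∀ y y' : E d, 3 ≤ ‖y‖ → ‖y' - y‖ ≤ 1 → |K y'| ≤ C * |K y|

theorem isPotentialKernel_newtonKernel (hd : 2 ≤ d) :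
    IsPotentialKernel (newtonKernel : E d → ℝ) :=
  ⟨measurable_newtonKernel, fun _ h => continuousAt_newtonKernel h, integrableOn_newtonKernel hd,
    newtonKernel_far hd⟩

theorem IsPotentialKernel.abs {K : E d → ℝ} (h : IsPotentialKernel K) :
    IsPotentialKernel (fun y => |K y|) where
  measurable := h.measurable.norm
  continuousAt y hy := (h.continuousAt y hy).abs
  integrableOn R := (h.integrableOn R).abs
  far := by simpa using h.far

section Potential

variable {Y : Type*} [TopologicalSpace Y] {K : E d → ℝ} {M : Y → E d → ℝ} {G : E d → ℝ}

theorem integrable_potential (hK : IsPotentialKernel K)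
    (hM : Continuous fun p : Y × E d => M p.1 p.2) (hG : ∀ t y, |M t y| ≤ G y)
    (hKG : ∀ x, Integrable (fun y => K y * G (x + y))) (t : Y) (x : E d) :
    Integrable (fun y => K y * M t (x + y)) := by
  have : Continuous (M t) := hM.comp (f := fun y => (t, y)) (by fun_prop)
  refine (hKG x).mono (hK.measurable.aestronglyMeasurable.mul
    (Continuous.aestronglyMeasurable (by fun_prop))) (Eventually.of_forall fun y => ?_)
  rw [norm_mul, norm_mul]
  gcongr
  exact (hG t _).trans (le_abs_self _)

/-- The majorant `K(y) G(x+y)` moves with `x`, and `G` has no regularity, so dominated convergence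
does not apply directly. The integrand is split by a cutoff. Near `x₀` the source is bounded on
compact sets and `K` is locally integrable; far away the translation is moved onto the kernel, which
varies slowly there, so that `C |K(z-x₀) G(z)|` dominates. -/
theorem continuous_potential [CompactSpace Y] [FirstCountableTopology Y]
    (hK : IsPotentialKernel K)
    (hM : Continuous fun p : Y × E d => M p.1 p.2) (hG : ∀ t y, |M t y| ≤ G y)
    (hKG : ∀ x, Integrable (fun y => K y * G (x + y))) :
    Continuous (fun p : Y × E d => ∫ y, K y * M p.1 (p.2 + y)) := by
  rw [continuous_iff_continuousAt]
  rintro ⟨t₀, x₀⟩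
  -- Equal to 1 within distance 3 of `x₀`, where the comparison of kernels fails, and to 0 beyond
  -- distance 4.
  let χ : E d → ℝ := fun z => max 0 (min 1 (4 - ‖z - x₀‖))
  have hχc : Continuous χ := by fun_prop
  have hχ0 : ∀ z, 0 ≤ χ z := fun z => le_max_left _ _
  have hχ1 : ∀ z, χ z ≤ 1 := fun z => max_le zero_le_one (min_le_left _ _)
  have hχin : ∀ z, ‖z - x₀‖ ≤ 3 → χ z = 1 := fun z hz => by
    simp only [χ]; rw [min_eq_left (by linarith), max_eq_right zero_le_one]
  have hχout : ∀ z, 4 ≤ ‖z - x₀‖ → χ z = 0 := fun z hz => by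
    simp only [χ]; rw [max_eq_left ((min_le_right _ _).trans (by linarith))]
  have hG0 : ∀ y, Y → 0 ≤ G y := fun y t => (abs_nonneg _).trans (hG t y)
  have hint : ∀ (ψ : E d → ℝ), Continuous ψ → (∀ z, |ψ z| ≤ 1) → ∀ (t : Y) x,
      Integrable (fun y => K y * (ψ (x + y) * M t (x + y))) := by
    intro ψ hψ hψ1 t x
    refine integrable_potential (M := fun t y => ψ y * M t y) hK (by fun_prop) (fun t y => ?_)
      hKG t x
    rw [abs_mul]
    calc |ψ y| * |M t y| ≤ 1 * G y :=
          mul_le_mul (hψ1 y) (hG t y) (abs_nonneg _) zero_le_one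
      _ = G y := one_mul _
  have hsplit : (fun p : Y × E d => ∫ y, K y * M p.1 (p.2 + y)) = fun p =>
      (∫ y, K y * (χ (p.2 + y) * M p.1 (p.2 + y))) +
        ∫ z, K (z - p.2) * ((1 - χ z) * M p.1 z) := by
    funext p
    have h2 : ∫ z, K (z - p.2) * ((1 - χ z) * M p.1 z) =
        ∫ y, K y * ((1 - χ (p.2 + y)) * M p.1 (p.2 + y)) := by
      rw [← integral_sub_right_eq_self (fun y => K y * ((1 - χ (p.2 + y)) * M p.1 (p.2 + y))) p.2]
      simp
    rw [h2, ← integral_add (hint χ hχc (fun z => by rw [abs_of_nonneg (hχ0 z)]; exact hχ1 z) _ _)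
      (hint (fun z => 1 - χ z) (by fun_prop) (fun z => by
        rw [abs_of_nonneg (by linarith [hχ1 z])]; linarith [hχ0 z]) _ _)]
    congr 1; funext y; ring
  rw [hsplit]
  have hnhds : ∀ᶠ p : Y × E d in 𝓝 (t₀, x₀), ‖p.2 - x₀‖ ≤ 1 := by
    have : ContinuousAt (fun p : Y × E d => ‖p.2 - x₀‖) (t₀, x₀) := by fun_prop
    filter_upwards [this.eventually (Iio_mem_nhds (by simp : ‖(t₀, x₀).2 - x₀‖ < 1))] with p hp
    exact hp.le
  refine ContinuousAt.add ?_ ?_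
  · obtain ⟨B, hB⟩ := (isCompact_univ.prod (isCompact_closedBall x₀ 4)).exists_bound_of_continuousOn
      (hM.continuousOn (s := (univ : Set Y) ×ˢ Metric.closedBall x₀ 4))
    -- If `x` is within 1 of `x₀` and `x + y` within 4 of `x₀`, then `|y| < 5`, so the ball of
    -- radius 6 contains the support.
    refine continuousAt_of_dominated
      (bound := (Metric.ball (0 : E d) 6).indicator fun y => |K y| * |B|) ?_ ?_ ?_ ?_
    · exact Eventually.of_forall fun p => (hint χ hχc (fun z => by
        rw [abs_of_nonneg (hχ0 z)]; exact hχ1 z) _ _).1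
    · filter_upwards [hnhds] with p hp
      refine Eventually.of_forall fun y => ?_
      by_cases hz : ‖p.2 + y - x₀‖ < 4
      · have hy : y ∈ Metric.ball (0 : E d) 6 := by
          rw [mem_ball_zero_iff]
          have : y = (p.2 + y - x₀) - (p.2 - x₀) := by abel
          rw [this]
          exact (norm_sub_le _ _).trans_lt (by linarith)
        rw [indicator_of_mem hy, norm_mul, norm_mul, Real.norm_eq_abs (K y)]
        gcongr
        have h1 := hB (p.1, p.2 + y) ⟨mem_univ _, by
          rw [Metric.mem_closedBall, dist_eq_norm]; exact hz.le⟩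
        calc ‖χ (p.2 + y)‖ * ‖M p.1 (p.2 + y)‖ ≤ 1 * B := by
              refine mul_le_mul ?_ h1 (norm_nonneg _) zero_le_one
              rw [Real.norm_of_nonneg (hχ0 _)]; exact hχ1 _
          _ ≤ |B| := by rw [one_mul]; exact le_abs_self B
      · rw [hχout _ (not_lt.1 hz)]
        simp only [zero_mul, mul_zero, norm_zero]
        exact indicator_nonneg (fun y _ => by positivity) _
    · rw [integrable_indicator_iff Metric.isOpen_ball.measurableSet]
      exact ((hK.integrableOn 6).abs).mul_const _
    · refine Eventually.of_forall fun y => ?_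
      fun_prop
  · obtain ⟨C, hC0, hC⟩ := hK.far
    -- Here the integration variable is `z = x + y`. Where `1 - χ` is nonzero, `z` is at distance
    -- more than 3 from `x₀`, away from the singularity.
    refine continuousAt_of_dominated (bound := fun z => C * |K (z - x₀) * G z|) ?_ ?_ ?_ ?_
    · refine Eventually.of_forall fun p => ?_
      have : Continuous (M p.1) := hM.comp (f := fun y => (p.1, y)) (by fun_prop)
      have hKm := hK.measurable
      exact (Measurable.aestronglyMeasurable (by fun_prop)).mul
        (Continuous.aestronglyMeasurable (by fun_prop))
    · filter_upwards [hnhds] with p hp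
      refine Eventually.of_forall fun z => ?_
      by_cases hz : 3 ≤ ‖z - x₀‖
      · have h1 := hC (z - x₀) (z - p.2) hz (by
          rw [show z - p.2 - (z - x₀) = -(p.2 - x₀) by abel, norm_neg]; exact hp)
        rw [norm_mul, abs_mul, ← mul_assoc]
        refine mul_le_mul h1 ?_ (norm_nonneg _) (by positivity)
        rw [norm_mul, Real.norm_of_nonneg (by linarith [hχ1 z])]
        calc (1 - χ z) * ‖M p.1 z‖ ≤ 1 * G z :=
              mul_le_mul (by linarith [hχ0 z]) (hG p.1 z) (norm_nonneg _) zero_le_one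
          _ ≤ |G z| := by rw [one_mul]; exact le_abs_self _
      · rw [hχin z (by linarith)]
        simp only [sub_self, zero_mul, mul_zero, norm_zero]
        positivity
    · have := (hKG x₀).comp_sub_right x₀
      simp only [add_sub_cancel] at this
      exact this.abs.const_mul C
    · refine Eventually.of_forall fun z => ?_
      by_cases hz : ‖z - x₀‖ < 3
      · rw [hχin z hz.le]; simp only [sub_self, zero_mul, mul_zero]; exact continuousAt_const
      · have hz0 : z - x₀ ≠ 0 := fun h => hz (by rw [h]; simp)
        have h1 : ContinuousAt (fun p : Y × E d => K (z - p.2)) (t₀, x₀) :=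
          ContinuousAt.comp (g := K) (f := fun p : Y × E d => z - p.2) (hK.continuousAt _ hz0)
            (by fun_prop)
        exact h1.mul (by fun_prop)

end Potential

/-- The fundamental theorem of calculus for each fixed `y`, followed by Fubini. Continuity of the
absolute potential makes it integrable on the compact interval; this replaces a pointwise majorant
of `F'` uniform in `s`. -/
theorem integral_kernel_fundamental {K : E d → ℝ} (hK : Measurable K) {a b : ℝ} (hab : a ≤ b)
    {F F' : ℝ → E d → ℝ}
    (hF : ∀ y, ∀ s ∈ Icc a b, HasDerivWithinAt (fun s => F s y) (F' s y) (Icc a b) s)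
    (hF' : ContinuousOn (fun p : ℝ × E d => F' p.1 p.2) (Icc a b ×ˢ univ))
    (hi : ∀ s ∈ Icc a b, Integrable (fun y => K y * F s y))
    (hi' : ∀ s ∈ Icc a b, Integrable (fun y => K y * F' s y))
    (hQ : ContinuousOn (fun s => ∫ y, |K y| * |F' s y|) (Icc a b)) :
    (∫ y, K y * F b y) - (∫ y, K y * F a y) = ∫ s in a..b, ∫ y, K y * F' s y := by
  rw [intervalIntegral.integral_of_le hab, ← integral_sub (hi b ⟨hab, le_rfl⟩) (hi a ⟨le_rfl, hab⟩)]
  have hmeas : AEStronglyMeasurable (fun p : ℝ × E d => K p.2 * F' p.1 p.2)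
      ((volume.restrict (Ioc a b)).prod volume) := by
    refine AEStronglyMeasurable.mul (Measurable.aestronglyMeasurable (by fun_prop)) ?_
    have : (volume.restrict (Ioc a b)).prod (volume : Measure (E d)) =
        (volume.prod volume).restrict (Ioc a b ×ˢ univ) := by
      rw [← Measure.prod_restrict, Measure.restrict_univ]
    rw [this]
    exact (hF'.mono (prod_mono Ioc_subset_Icc_self le_rfl)).aestronglyMeasurable
      (measurableSet_Ioc.prod MeasurableSet.univ)
  have hint : Integrable (fun p : ℝ × E d => K p.2 * F' p.1 p.2)
      ((volume.restrict (Ioc a b)).prod volume) := by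
    rw [integrable_prod_iff hmeas]
    refine ⟨(ae_restrict_iff' measurableSet_Ioc).2 (Eventually.of_forall fun s hs =>
      hi' s (Ioc_subset_Icc_self hs)), ?_⟩
    have : Integrable (fun s => ∫ y, |K y| * |F' s y|) (volume.restrict (Ioc a b)) :=
      (hQ.integrableOn_Icc).mono_set Ioc_subset_Icc_self
    simpa only [norm_mul, Real.norm_eq_abs] using this
  rw [integral_integral_swap (f := fun s (y : E d) => K y * F' s y) hint]
  congr 1
  funext y
  have hc : ContinuousOn (fun s => F' s y) (Icc a b) :=
    hF'.comp (f := fun s => (s, y)) (by fun_prop) fun s hs => ⟨hs, mem_univ _⟩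
  rw [integral_const_mul, ← mul_sub, ← intervalIntegral.integral_of_le hab,
    intervalIntegral.integral_eq_sub_of_hasDerivAt_of_le hab
      (fun s hs => (hF y s hs).continuousWithinAt)
      (fun s hs => (hF y s (Ioo_subset_Icc_self hs)).hasDerivAt (Icc_mem_nhds hs.1 hs.2))
      (hc.intervalIntegrable_of_Icc hab)]

/-- A potential may be differentiated under the integral sign if the differentiated integrand
is continuous and its absolute potential is continuous in the parameter. -/
theorem hasDerivWithinAt_potential {K : E d → ℝ} (hK : Measurable K) {a b : ℝ}
    {F F' : ℝ → E d → ℝ}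
    (hF : ∀ y, ∀ s ∈ Icc a b, HasDerivWithinAt (fun s => F s y) (F' s y) (Icc a b) s)
    (hF' : ContinuousOn (fun p : ℝ × E d => F' p.1 p.2) (Icc a b ×ˢ univ))
    (hi : ∀ s ∈ Icc a b, Integrable (fun y => K y * F s y))
    (hi' : ∀ s ∈ Icc a b, Integrable (fun y => K y * F' s y))
    (hP : ContinuousOn (fun s => ∫ y, K y * F' s y) (Icc a b))
    (hQ : ContinuousOn (fun s => ∫ y, |K y| * |F' s y|) (Icc a b)) {s : ℝ} (hs : s ∈ Icc a b) :
    HasDerivWithinAt (fun s => ∫ y, K y * F s y) (∫ y, K y * F' s y) (Icc a b) s := by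
  have hval : ∀ r ∈ Icc a b, ∫ y, K y * F r y =
      (∫ y, K y * F a y) + ∫ s in a..r, ∫ y, K y * F' s y := by
    intro r hr
    have hsub : Icc a r ⊆ Icc a b := Icc_subset_Icc_right hr.2
    rw [← integral_kernel_fundamental hK hr.1 (fun y s hs => (hF y s (hsub hs)).mono hsub)
      (hF'.mono (prod_mono hsub le_rfl)) (fun s hs => hi s (hsub hs))
      (fun s hs => hi' s (hsub hs)) (hQ.mono hsub)]
    ring
  have : Fact (s ∈ Icc a b) := ⟨hs⟩
  have hab : a ≤ b := hs.1.trans hs.2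
  have h1 : HasDerivWithinAt (fun r => ∫ s in a..r, ∫ y, K y * F' s y) (∫ y, K y * F' s y)
      (Icc a b) s :=
    intervalIntegral.integral_hasDerivWithinAt_right
      ((hP.mono (Icc_subset_Icc_right hs.2)).intervalIntegrable_of_Icc hs.1)
      (hP.stronglyMeasurableAtFilter_nhdsWithin measurableSet_Icc s) (hP s hs)
  exact (h1.const_add _).congr (fun r hr => hval r hr) (hval s hs)

theorem Smooth.smul {g : E m → ℝ} (hg : Smooth g) (c : ℝ) : Smooth (c • g) :=
  contDiff_const.smul hg

theorem Smooth.mul {f g : E m → ℝ} (hf : Smooth f) (hg : Smooth g) : Smooth (f * g) :=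
  ContDiff.mul hf hg

/-! ### Sums over lists -/

theorem sum_map_flatMap {α β M : Type*} [AddCommMonoid M] (L : List α) (f : α → List β)
    (g : β → M) : ((L.flatMap f).map g).sum = (L.map fun a => ((f a).map g).sum).sum := by
  induction L with
  | nil => simp
  | cons a L ih => simp [ih]

theorem sum_map_filter {α M : Type*} [AddCommMonoid M] (L : List α) (p : α → Bool) (g : α → M) :
    ((L.filter p).map g).sum = (L.map fun a => if p a then g a else 0).sum := by
  induction L with
  | nil => simp
  | cons a L ih =>
    by_cases h : p a <;> simp [h, ih]

theorem sum_map_finRange {M : Type*} [AddCommMonoid M] (g : Fin n → M) :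
    ((List.finRange n).map g).sum = ∑ i, g i := Fin.sum_univ_def g |>.symm

theorem sum_map_filter_finRange {M : Type*} [AddCommMonoid M] (p : Fin n → Prop) [DecidablePred p]
    (g : Fin n → M) :
    (((List.finRange n).filter (fun i => decide (p i))).map g).sum = ∑ i with p i, g i := by
  rw [sum_map_filter, sum_map_finRange, Finset.sum_filter]
  simp

theorem prod_flatMap {α M : Type*} [CommMonoid M] (L : List α) (f : α → List M) :
    (L.flatMap f).prod = (L.map fun a => (f a).prod).prod := by
  induction L with
  | nil => simp
  | cons a L ih => simp [ih]

namespace PDESystem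

variable (S : PDESystem d n)

/-! ### Stability of the set of codes -/

/-- The functions that label the codes `g^*`. -/
def IsLabel (g : E n → ℝ) : Prop :=
  ∃ (a : ℝ) (l : Fin n → ℕ) (i : Fin (d + 1)), g = a • mderiv l (S.f i)

variable {S}

theorem mem_codes_star {g : E n → ℝ} : Code.star g ∈ S.codes ↔ S.IsLabel g := Iff.rfl

theorem IsLabel.smooth {g : E n → ℝ} (h : S.IsLabel g) : Smooth g := by
  obtain ⟨a, l, i, rfl⟩ := h
  exact contDiff_const.smul (Smooth.mderiv (S.f_smooth i) l)

theorem isLabel_f (i : Fin (d + 1)) : S.IsLabel (S.f i) := ⟨1, 0, i, by simp⟩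

theorem IsLabel.smul {g : E n → ℝ} (h : S.IsLabel g) (c : ℝ) : S.IsLabel (c • g) := by
  obtain ⟨a, l, i, rfl⟩ := h
  exact ⟨c * a, l, i, by rw [smul_smul]⟩

theorem IsLabel.neg {g : E n → ℝ} (h : S.IsLabel g) : S.IsLabel (-g) := by
  simpa using h.smul (-1)

theorem IsLabel.mderiv {g : E n → ℝ} (h : S.IsLabel g) (κ : Fin n → ℕ) :
    S.IsLabel (mderiv κ g) := by
  obtain ⟨a, l, i, rfl⟩ := h
  exact ⟨a, l + κ, i, by
    rw [mderiv_smul (Smooth.mderiv (S.f_smooth i) l), mderiv_mderiv (S.f_smooth i)]⟩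

theorem mem_codes_of_mem_fdb {A : Finset (Fin n)} {μ : Fin d → ℕ} {g : E n → ℝ}
    {pre : List (Code d n)} (hg : S.IsLabel g) (hpre : ∀ z ∈ pre, z ∈ S.codes)
    {Z : List (Code d n)} (hZ : Z ∈ S.fdb A μ g pre) : ∀ z ∈ Z, z ∈ S.codes := by
  simp only [fdb, List.mem_map] at hZ
  obtain ⟨k, -, rfl⟩ := hZ
  intro z hz
  simp only [fdbTerm, List.mem_append, List.mem_singleton, List.mem_flatMap] at hz
  rcases hz with (hz | rfl) | ⟨p, -, hz⟩
  · exact hpre z hz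
  · exact (hg.mderiv _).smul _
  · rw [List.eq_of_mem_replicate hz]; trivial

/-- The labels `a ∂_λ f_i` are stable under derivatives and scalars, so the recursion of the tree
and the integral system never leave `𝒞`. -/
theorem mem_codes_of_mem_mechanism {c : Code d n} (hc : c ∈ S.codes) {Z : List (Code d n)}
    (hZ : Z ∈ S.mechanism c) : ∀ z ∈ Z, z ∈ S.codes := by
  cases c with
  | ident i =>
    simp only [mechanism, List.mem_singleton] at hZ
    subst hZ
    simpa [mem_codes_star] using isLabel_f i
  | deriv a μ i => exact mem_codes_of_mem_fdb ((isLabel_f i).smul a) (by simp) hZ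
  | star g =>
    have hg : S.IsLabel g := hc
    simp only [mechanism, List.mem_append, List.mem_flatMap, List.mem_map] at hZ
    rcases hZ with (⟨r, -, hZ⟩ | ⟨i, -, j, -, k, -, rfl⟩) | ⟨r, -, rfl⟩
    · exact mem_codes_of_mem_fdb (isLabel_f _)
        (by simpa [mem_codes_star] using hg.mderiv _) hZ
    · intro z hz
      simp only [List.mem_cons, List.not_mem_nil, or_false] at hz
      rcases hz with rfl | rfl | rfl
      · exact (hg.mderiv _).smul _
      · trivial
      · trivial
    · intro z hz
      simp only [List.mem_cons, List.not_mem_nil, or_false] at hz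
      rcases hz with rfl | rfl
      · exact (hg.mderiv _).neg
      · trivial
  | heat μ =>
    simp only [mechanism, List.mem_append, List.mem_flatMap] at hZ
    rcases hZ with ⟨i, -, j, -, k, -, l, -, γ, -, hZ⟩ | ⟨i, -, l, -, Y, hY, hZ⟩
    · refine mem_codes_of_mem_fdb ((isLabel_f 0).mderiv _) ?_ hZ
      intro z hz
      simp only [List.mem_cons, List.not_mem_nil, or_false] at hz
      rcases hz with rfl | rfl <;> trivial
    · exact mem_codes_of_mem_fdb (isLabel_f _)
        (mem_codes_of_mem_fdb (((isLabel_f 0).mderiv _).smul _) (by simp) hY) hZ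

/-! ### The source terms -/

variable (S)

theorem jet_eq (w : Fin (d + 1) → E d → ℝ) :
    S.jet w = assemble fun j => mderiv (S.α j) (w (S.β j)) := rfl

/-- The sum of the products of codes over the mechanism. -/
def source (v : Code d n → ℝ → E d → ℝ) (c : Code d n) (t : ℝ) (x : E d) : ℝ :=
  ((S.mechanism c).map fun Z => codeProd v Z t x).sum

@[simp] theorem codeProd_nil (v : Code d n → ℝ → E d → ℝ) (t : ℝ) (x : E d) :
    codeProd v [] t x = 1 := rfl

@[simp] theorem codeProd_cons (v : Code d n → ℝ → E d → ℝ) (z : Code d n) (Z : List (Code d n))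
    (t : ℝ) (x : E d) : codeProd v (z :: Z) t x = v z t x * codeProd v Z t x := by
  simp [codeProd]

theorem codeProd_append (v : Code d n → ℝ → E d → ℝ) (Z Z' : List (Code d n))
    (t : ℝ) (x : E d) : codeProd v (Z ++ Z') t x = codeProd v Z t x * codeProd v Z' t x := by
  simp [codeProd]

theorem codeProd_fdbTerm (u : Fin (d + 1) → ℝ → E d → ℝ) (μ : Fin d → ℕ) (g : E n → ℝ)
    (pre : List (Code d n)) (k : blocks μ → Fin n → ℕ) (t : ℝ) (x : E d) :
    codeProd (S.evalFamily u) (S.fdbTerm μ g pre k) t x =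
      codeProd (S.evalFamily u) pre t x * (fdbCoeff μ k *
        (mderiv (fun i => ∑ l, k l i) g (S.jet (fun k => u k t) x) *
        ∏ l : blocks μ, ∏ i, mderiv ((l : Fin d → ℕ) + S.α i) (u (S.β i) t) x ^ k l i)) := by
  rw [fdbTerm, codeProd_append, codeProd_append, mul_assoc]
  congr 1
  rw [codeProd_cons, codeProd_nil, mul_one, ← mul_assoc]
  congr 1
  rw [codeProd, List.map_flatMap, prod_flatMap, Finset.prod_map_toList, Fintype.prod_prod_type]
  simp [evalFamily, eval]

/-- The Faà di Bruno formula read backwards: the families `fdb` are enumerations of the terms of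
`∂_μ(g^*(u))`. -/
theorem sum_codeProd_fdb {u : Fin (d + 1) → ℝ → E d → ℝ} {t : ℝ} (hu : ∀ i, Smooth (u i t))
    {A : Finset (Fin n)} {g : E n → ℝ} (hg : Smooth g) (hA : DependsOnlyOn A g) (μ : Fin d → ℕ)
    (pre : List (Code d n)) (x : E d) :
    ((S.fdb A μ g pre).map fun Z => codeProd (S.evalFamily u) Z t x).sum =
      codeProd (S.evalFamily u) pre t x *
        mderiv μ (fun y => g (S.jet (fun k => u k t) y)) x := by
  rw [fdb, List.map_map]
  have h1 : (fun Z => codeProd (S.evalFamily u) Z t x) ∘ S.fdbTerm μ g pre = fun k =>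
      codeProd (S.evalFamily u) pre t x * (fdbCoeff μ k *
        (mderiv (fun i => ∑ l, k l i) g (S.jet (fun k => u k t) x) *
        ∏ l : blocks μ, ∏ i, mderiv ((l : Fin d → ℕ) + S.α i) (u (S.β i) t) x ^ k l i)) :=
    funext fun k => S.codeProd_fdbTerm u μ g pre k t x
  rw [h1, Finset.sum_map_toList, ← Finset.mul_sum]
  congr 1
  rw [jet_eq, mderiv_comp hg hA (fun j => (hu _).mderiv _)]
  refine Finset.sum_congr rfl fun k _ => ?_
  simp_rw [mderiv_mderiv (hu _), add_comm]

theorem dependsOnlyOn_univ (g : E n → ℝ) : DependsOnlyOn Finset.univ g := by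
  intro z z' h
  congr 1
  ext j
  exact h j (Finset.mem_univ j)

theorem dependsOnlyOn_args (i : Fin (d + 1)) : DependsOnlyOn (S.args i) (S.f i) := by
  unfold args
  split_ifs with h
  · subst h
    intro z z' hz
    exact S.f_zero_indep z z' fun j hj => hz j (by simp [hj])
  · exact dependsOnlyOn_univ _

theorem DependsOnlyOn.smul {A : Finset (Fin n)} {g : E n → ℝ} (h : DependsOnlyOn A g) (c : ℝ) :
    DependsOnlyOn A (c • g) := fun z z' hz => by
  simp [h z z' hz]

theorem source_ident (u : Fin (d + 1) → ℝ → E d → ℝ) (i : Fin (d + 1)) (t : ℝ) (x : E d) :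
    S.source (S.evalFamily u) (.ident i) t x = S.f i (S.jet (fun k => u k t) x) := by
  simp [source, mechanism, evalFamily, eval]

theorem source_deriv {u : Fin (d + 1) → ℝ → E d → ℝ} {t : ℝ} (hu : ∀ i, Smooth (u i t))
    (a : ℝ) (μ : Fin d → ℕ) (i : Fin (d + 1)) (x : E d) :
    S.source (S.evalFamily u) (.deriv a μ i) t x =
      a * mderiv μ (fun y => S.f i (S.jet (fun k => u k t) y)) x := by
  have h1 : Smooth (fun y => S.f i (S.jet (fun k => u k t) y)) :=
    Smooth.comp_assemble (S.f_smooth i) fun j => (hu _).mderiv _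
  rw [source, mechanism, S.sum_codeProd_fdb hu (Smooth.smul (S.f_smooth i) a)
    (DependsOnlyOn.smul (S.dependsOnlyOn_args i) a), codeProd_nil, one_mul]
  have : (fun y => (a • S.f i) (S.jet (fun k => u k t) y)) =
      a • fun y => S.f i (S.jet (fun k => u k t) y) := rfl
  rw [this, mderiv_smul h1]; rfl

/-- The right-hand side is `-(∂_t + νΔ) g^*(u)` once the parabolic equations have been inserted.
Only the algebra of the mechanism is used here; the evolution equation enters in
`hasDerivWithinAt_star`. -/
theorem source_star {u : Fin (d + 1) → ℝ → E d → ℝ} {t : ℝ} (hu : ∀ i, Smooth (u i t))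
    {g : E n → ℝ} (hg : Smooth g) (x : E d) :
    S.source (S.evalFamily u) (.star g) t x =
      ∑ r with S.β r ≠ 0, pd r g (S.jet (fun k => u k t) x) *
        mderiv (S.α r) (fun y => S.f (S.β r) (S.jet (fun k => u k t) y)) x -
      S.ν * ∑ i, ∑ j, ∑ k, pd j (pd i g) (S.jet (fun k => u k t) x) *
        (pd k (mderiv (S.α i) (u (S.β i) t)) x * pd k (mderiv (S.α j) (u (S.β j) t)) x) -
      ∑ r with S.β r = 0, pd r g (S.jet (fun k => u k t) x) *
        mderiv (S.α r) (heatOp S.ν S.T (u 0) t) x := by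
  rw [source, mechanism, List.map_append, List.map_append, List.sum_append, List.sum_append,
    sum_map_flatMap, sum_map_flatMap, sum_map_filter_finRange, List.map_map,
    sum_map_filter_finRange, sum_map_finRange]
  simp_rw [sum_map_flatMap, List.map_map, sum_map_finRange]
  rw [sub_eq_add_neg, sub_eq_add_neg, ← Finset.sum_neg_distrib, Finset.mul_sum,
    ← Finset.sum_neg_distrib]
  congr 1
  congr 1
  · refine Finset.sum_congr rfl fun r _ => ?_
    rw [S.sum_codeProd_fdb hu (S.f_smooth _) (dependsOnlyOn_univ _)]
    simp [evalFamily, eval, mderiv_unit hg]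
  · refine Finset.sum_congr rfl fun i _ => ?_
    rw [Finset.mul_sum, ← Finset.sum_neg_distrib]
    refine Finset.sum_congr rfl fun j _ => ?_
    rw [Finset.mul_sum, ← Finset.sum_neg_distrib]
    refine Finset.sum_congr rfl fun k _ => ?_
    simp only [Function.comp_apply, codeProd_cons, codeProd_nil, evalFamily, eval, Pi.smul_apply,
      smul_eq_mul, mderiv_add_unit hg, mderiv_add_unit (hu _), mderiv_unit hg]
    ring
  · refine Finset.sum_congr rfl fun r _ => ?_
    simp [evalFamily, eval, mderiv_unit hg]

/-- `(∂_t + ν Δ) f_0^*(u)`, expressed through the parabolic equations. -/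
def poissonSource (u : Fin (d + 1) → ℝ → E d → ℝ) (t : ℝ) : E d → ℝ :=
  (∑ i with S.β i ≠ 0, ∑ j with S.β j ≠ 0, ∑ k, S.ν •
    ((pd k (mderiv (S.α i) (u (S.β i) t))) * ((pd k (mderiv (S.α j) (u (S.β j) t))) *
      fun y => pd j (pd i (S.f 0)) (S.jet (fun k => u k t) y)))) +
  ∑ i with S.β i ≠ 0, (-1 : ℝ) •
    ((mderiv (S.α i) fun y => S.f (S.β i) (S.jet (fun k => u k t) y)) *
      fun y => pd i (S.f 0) (S.jet (fun k => u k t) y))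

variable {S}

theorem smooth_star {u : Fin (d + 1) → ℝ → E d → ℝ} {t : ℝ} (hu : ∀ i, Smooth (u i t))
    {g : E n → ℝ} (hg : Smooth g) : Smooth (fun y => g (S.jet (fun k => u k t) y)) :=
  hg.comp_assemble fun _ => (hu _).mderiv _

theorem smooth_poissonSource_left {u : Fin (d + 1) → ℝ → E d → ℝ} {t : ℝ}
    (hu : ∀ i, Smooth (u i t)) (i j : Fin n) (k : Fin d) :
    Smooth ((pd k (mderiv (S.α i) (u (S.β i) t))) * ((pd k (mderiv (S.α j) (u (S.β j) t))) *
      fun y => pd j (pd i (S.f 0)) (S.jet (fun k => u k t) y))) :=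
  ContDiff.mul (((hu _).mderiv _).pd k) (ContDiff.mul (((hu _).mderiv _).pd k)
    (smooth_star hu ((Smooth.pd (S.f_smooth 0) i).pd j)))

theorem smooth_poissonSource_right {u : Fin (d + 1) → ℝ → E d → ℝ} {t : ℝ}
    (hu : ∀ i, Smooth (u i t)) (i : Fin n) :
    Smooth ((mderiv (S.α i) fun y => S.f (S.β i) (S.jet (fun k => u k t) y)) *
      fun y => pd i (S.f 0) (S.jet (fun k => u k t) y)) :=
  ContDiff.mul ((smooth_star hu (S.f_smooth _)).mderiv _)
    (smooth_star hu (Smooth.pd (S.f_smooth 0) i))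

theorem smooth_poissonSource {u : Fin (d + 1) → ℝ → E d → ℝ} {t : ℝ} (hu : ∀ i, Smooth (u i t)) :
    Smooth (S.poissonSource u t) :=
  ContDiff.add
    (Smooth.sum _ fun i _ => Smooth.sum _ fun j _ => Smooth.sum _ fun k _ =>
      contDiff_const.smul (smooth_poissonSource_left hu i j k))
    (Smooth.sum _ fun i _ => contDiff_const.smul (smooth_poissonSource_right hu i))

theorem mderiv_poissonSource {u : Fin (d + 1) → ℝ → E d → ℝ} {t : ℝ} (hu : ∀ i, Smooth (u i t))
    (μ : Fin d → ℕ) : mderiv μ (S.poissonSource u t) =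
      (∑ i with S.β i ≠ 0, ∑ j with S.β j ≠ 0, ∑ k, S.ν • mderiv μ
        ((pd k (mderiv (S.α i) (u (S.β i) t))) * ((pd k (mderiv (S.α j) (u (S.β j) t))) *
        fun y => pd j (pd i (S.f 0)) (S.jet (fun k => u k t) y)))) +
      ∑ i with S.β i ≠ 0, (-1 : ℝ) • mderiv μ
        ((mderiv (S.α i) fun y => S.f (S.β i) (S.jet (fun k => u k t) y)) *
        fun y => pd i (S.f 0) (S.jet (fun k => u k t) y)) := by
  have s1 := smooth_poissonSource_left (S := S) hu
  have s2 := smooth_poissonSource_right (S := S) hu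
  have s1' : ∀ i j k, Smooth (S.ν •
      ((pd k (mderiv (S.α i) (u (S.β i) t))) * ((pd k (mderiv (S.α j) (u (S.β j) t))) *
        fun y => pd j (pd i (S.f 0)) (S.jet (fun k => u k t) y)))) := fun i j k =>
    (s1 i j k).smul _
  have s2' : ∀ i, Smooth ((-1 : ℝ) •
      ((mderiv (S.α i) fun y => S.f (S.β i) (S.jet (fun k => u k t) y)) *
        fun y => pd i (S.f 0) (S.jet (fun k => u k t) y))) := fun i =>
    (s2 i).smul _
  rw [poissonSource, mderiv_add (Smooth.sum _ fun i _ => Smooth.sum _ fun j _ =>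
    Smooth.sum _ fun k _ => s1' i j k) (Smooth.sum _ fun i _ => s2' i),
    mderiv_sum _ fun i _ => s2' i, mderiv_sum _ fun i _ => Smooth.sum _ fun j _ =>
    Smooth.sum _ fun k _ => s1' i j k]
  congr 1
  · refine Finset.sum_congr rfl fun i _ => ?_
    rw [mderiv_sum _ fun _ _ => Smooth.sum _ fun k _ => s1' i _ k]
    refine Finset.sum_congr rfl fun j _ => ?_
    rw [mderiv_sum _ fun k _ => s1' i j k]
    exact Finset.sum_congr rfl fun k _ => mderiv_smul (s1 i j k) _ _
  · exact Finset.sum_congr rfl fun i _ => mderiv_smul (s2 i) _ _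

/-- The binomial factors of the mechanism come from applying the Leibniz rule twice to a triple
product (index `l`, then `γ`) and once to a double product; Faà di Bruno expands the remaining
derivatives of `g^*(u)`. -/
theorem source_heat {u : Fin (d + 1) → ℝ → E d → ℝ} {t : ℝ} (hu : ∀ i, Smooth (u i t))
    (μ : Fin d → ℕ) (x : E d) :
    S.source (S.evalFamily u) (.heat μ) t x = mderiv μ (S.poissonSource u t) x := by
  have hf0 : Smooth (S.f 0) := S.f_smooth 0
  rw [mderiv_poissonSource hu, source, mechanism, List.map_append, List.sum_append,
    sum_map_flatMap, sum_map_flatMap, sum_map_filter_finRange, sum_map_filter_finRange,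
    Pi.add_apply, Finset.sum_apply, Finset.sum_apply]
  simp_rw [Finset.sum_apply]
  congr 1
  · refine Finset.sum_congr rfl fun i _ => ?_
    rw [sum_map_flatMap, sum_map_filter_finRange]
    refine Finset.sum_congr rfl fun j _ => ?_
    rw [sum_map_flatMap, sum_map_finRange]
    refine Finset.sum_congr rfl fun k _ => ?_
    have hA : DependsOnlyOn (S.args 0) (mderiv (unitIdx i + unitIdx j) (S.f 0)) :=
      (S.dependsOnlyOn_args 0).mderiv hf0 _
    have hij : mderiv (unitIdx i + unitIdx j) (S.f 0) = pd j (pd i (S.f 0)) := by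
      rw [mderiv_add_unit hf0, mderiv_unit hf0]
    have hsm : Smooth (fun y => pd j (pd i (S.f 0)) (S.jet (fun k => u k t) y)) :=
      smooth_star hu ((hf0.pd i).pd j)
    rw [sum_map_flatMap, Finset.sum_map_toList, mderiv_mul (((hu _).mderiv _).pd k)
      ((((hu _).mderiv _).pd k).mul hsm), Pi.smul_apply, Finset.sum_apply,
      smul_eq_mul, Finset.mul_sum]
    refine Finset.sum_congr rfl fun l _ => ?_
    rw [sum_map_flatMap, Finset.sum_map_toList, mderiv_mul (((hu _).mderiv _).pd k) hsm,
      Pi.smul_apply, Pi.mul_apply, Finset.sum_apply, smul_eq_mul, Finset.mul_sum, Finset.mul_sum,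
      Finset.mul_sum]
    refine Finset.sum_congr rfl fun γ _ => ?_
    rw [S.sum_codeProd_fdb hu (hf0.mderiv _) hA, hij]
    have e1 : mderiv (μ - l) (pd k (mderiv (S.α i) (u (S.β i) t))) =
        mderiv (μ - l + S.α i + unitIdx k) (u (S.β i) t) := by
      rw [mderiv_pd ((hu _).mderiv _), mderiv_mderiv (hu _), mderiv_add_unit (hu _), add_comm]
    have e2 : mderiv (l - γ) (pd k (mderiv (S.α j) (u (S.β j) t))) =
        mderiv (l - γ + S.α j + unitIdx k) (u (S.β j) t) := by
      rw [mderiv_pd ((hu _).mderiv _), mderiv_mderiv (hu _), mderiv_add_unit (hu _), add_comm]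
    rw [e1, e2]
    simp only [codeProd_cons, codeProd_nil, evalFamily, eval, Pi.smul_apply, Pi.mul_apply,
      smul_eq_mul, mchoose, Finset.prod_mul_distrib]
    ring
  · refine Finset.sum_congr rfl fun i _ => ?_
    have hsm : Smooth (fun y => pd i (S.f 0) (S.jet (fun k => u k t) y)) :=
      smooth_star hu (hf0.pd i)
    have hst : ∀ i, Smooth (fun y => S.f i (S.jet (fun k => u k t) y)) := fun i =>
      smooth_star hu (S.f_smooth i)
    rw [sum_map_flatMap, Finset.sum_map_toList, mderiv_mul ((hst _).mderiv _) hsm, Pi.smul_apply,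
      Finset.sum_apply, smul_eq_mul, Finset.mul_sum]
    refine Finset.sum_congr rfl fun l _ => ?_
    rw [sum_map_flatMap]
    simp_rw [S.sum_codeProd_fdb hu (S.f_smooth _) (dependsOnlyOn_univ _)]
    rw [List.sum_map_mul_right, S.sum_codeProd_fdb hu ((hf0.mderiv _).smul _)
      (DependsOnlyOn.smul ((S.dependsOnlyOn_args 0).mderiv hf0 _) _), codeProd_nil, one_mul]
    have : (fun y => ((-∏ r, ((μ r).choose (l r) : ℝ)) • mderiv (unitIdx i) (S.f 0))
        (S.jet (fun k => u k t) y)) = (-mchoose μ l) •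
          fun y => pd i (S.f 0) (S.jet (fun k => u k t) y) := by
      rw [mderiv_unit hf0]; rfl
    rw [this, mderiv_smul hsm, mderiv_mderiv (hst _), add_comm (S.α i)]
    simp only [Pi.smul_apply, Pi.mul_apply, smul_eq_mul]
    ring

end PDESystem

/-! ### Exchanging time and space derivatives -/

theorem continuousOn_time {T : ℝ} {w : ℝ → E d → ℝ}
    (hc : ContinuousOn (fun p : ℝ × E d => w p.1 p.2) (Icc 0 T ×ˢ univ)) (x : E d) :
    ContinuousOn (fun s => w s x) (Icc 0 T) :=
  hc.comp (f := fun s => (s, x)) (by fun_prop) fun _ hs => ⟨hs, mem_univ _⟩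

theorem eq_add_integral_of_hasDerivWithinAt {T : ℝ} {f f' : ℝ → ℝ}
    (hder : ∀ t ∈ Icc 0 T, HasDerivWithinAt f (f' t) (Icc 0 T) t)
    (hc : ContinuousOn f' (Icc 0 T)) {r : ℝ} (hr : r ∈ Icc 0 T) :
    f r = f 0 + ∫ s in (0 : ℝ)..r, f' s := by
  have hsub : Icc 0 r ⊆ Icc 0 T := Icc_subset_Icc_right hr.2
  rw [intervalIntegral.integral_eq_sub_of_hasDerivAt_of_le hr.1
    (fun s hs => ((hder s (hsub hs)).continuousWithinAt).mono hsub)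
    (fun s hs => (hder s (hsub (Ioo_subset_Icc_self hs))).hasDerivAt
      (Icc_mem_nhds hs.1 (hs.2.trans_le hr.2)))
    ((hc.mono hsub).intervalIntegrable_of_Icc hr.1)]
  ring

theorem hasDerivWithinAt_integral_Icc {T : ℝ} {f : ℝ → ℝ} (hc : ContinuousOn f (Icc 0 T)) {t : ℝ}
    (ht : t ∈ Icc 0 T) :
    HasDerivWithinAt (fun r => ∫ s in (0 : ℝ)..r, f s) (f t) (Icc 0 T) t := by
  have : Fact (t ∈ Icc 0 T) := ⟨ht⟩
  exact intervalIntegral.integral_hasDerivWithinAt_right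
    ((hc.mono (Icc_subset_Icc_right ht.2)).intervalIntegrable_of_Icc ht.1)
    (hc.stronglyMeasurableAtFilter_nhdsWithin measurableSet_Icc t) (hc t ht)

/-- Interchange of `∂_t` and `∂_i` up to the end points in time: write `w` as its initial value plus
the time integral of `w'`, differentiate in space under that integral (a compact segment gives the
bound), then differentiate the result in time. -/
theorem hasDerivWithinAt_pd {T : ℝ} {w w' : ℝ → E d → ℝ} (i : Fin d)
    (hw : ∀ t ∈ Icc 0 T, Smooth (w t)) (hw' : ∀ t ∈ Icc 0 T, Smooth (w' t))
    (hder : ∀ t ∈ Icc 0 T, ∀ x, HasDerivWithinAt (fun s => w s x) (w' t x) (Icc 0 T) t)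
    (hc : ContinuousOn (fun p : ℝ × E d => w' p.1 p.2) (Icc 0 T ×ˢ univ))
    (hcp : ContinuousOn (fun p : ℝ × E d => pd i (w' p.1) p.2) (Icc 0 T ×ˢ univ))
    {t : ℝ} (ht : t ∈ Icc 0 T) (x : E d) :
    HasDerivWithinAt (fun s => pd i (w s) x) (pd i (w' t) x) (Icc 0 T) t := by
  have hT : 0 ≤ T := ht.1.trans ht.2
  set e : E d := EuclideanSpace.single i 1 with he
  have hval : ∀ r ∈ Icc 0 T, pd i (w r) x = pd i (w 0) x + ∫ s in (0 : ℝ)..r, pd i (w' s) x := by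
    intro r hr
    have hsub : Icc 0 r ⊆ Icc 0 T := Icc_subset_Icc_right hr.2
    have hIoc : uIoc 0 r ⊆ Icc 0 T := by
      rw [uIoc_of_le hr.1]; exact Ioc_subset_Icc_self.trans hsub
    have h1 : HasDerivAt (fun τ : ℝ => w r (x + τ • e)) (pd i (w r) x) 0 :=
      (hw r hr).hasLineDerivAt i x
    have h2 : HasDerivAt (fun τ : ℝ => w 0 (x + τ • e)) (pd i (w 0) x) 0 :=
      (hw 0 ⟨le_rfl, hT⟩).hasLineDerivAt i x
    have hK : IsCompact (Icc 0 T ×ˢ ((fun τ : ℝ => x + τ • e) '' Icc (-1) 1)) :=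
      isCompact_Icc.prod (isCompact_Icc.image (by fun_prop))
    obtain ⟨B, hB⟩ := hK.exists_bound_of_continuousOn (hcp.mono (prod_mono le_rfl (subset_univ _)))
    have hline : ∀ z : E d, ∀ s ∈ Icc 0 T, ∀ τ : ℝ,
        HasDerivAt (fun τ : ℝ => w' s (z + τ • e)) (pd i (w' s) (z + τ • e)) τ := by
      intro z s hs τ
      have h := (hw' s hs).hasLineDerivAt i (z + τ • e)
      have h' : HasDerivAt (fun a : ℝ => w' s (z + τ • e + a • e)) (pd i (w' s) (z + τ • e))
          (τ - τ) := by rw [sub_self]; exact h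
      have := h'.comp_sub_const τ τ
      convert! this using 1
      funext a
      congr 1
      rw [add_assoc, ← add_smul]; congr 2; ring
    have h3 := (intervalIntegral.hasDerivAt_integral_of_dominated_loc_of_deriv_le (μ := volume)
      (a := 0) (b := r) (bound := fun _ => B) (F := fun (τ : ℝ) s => w' s (x + τ • e))
      (F' := fun τ s => pd i (w' s) (x + τ • e)) (x₀ := 0) (Icc_mem_nhds (by norm_num :
        (-1 : ℝ) < 0) one_pos)
      (Eventually.of_forall fun τ => ((continuousOn_time hc _).mono hIoc).aestronglyMeasurable
        measurableSet_uIoc)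
      (((continuousOn_time hc _).mono hsub).intervalIntegrable_of_Icc hr.1)
      (((continuousOn_time hcp _).mono hIoc).aestronglyMeasurable measurableSet_uIoc)
      (Eventually.of_forall fun s hs τ hτ =>
        hB (s, x + τ • e) ⟨hIoc hs, mem_image_of_mem _ hτ⟩)
      intervalIntegrable_const
      (Eventually.of_forall fun s hs τ _ => hline x s (hIoc hs) τ)).2
    have h4 := h2.add h3
    simp only [zero_smul, add_zero] at h4
    refine h1.unique (h4.congr_of_eventuallyEq (Eventually.of_forall fun τ => ?_))
    exact eq_add_integral_of_hasDerivWithinAt (fun t ht => hder t ht _)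
      (continuousOn_time hc _) hr
  exact ((hasDerivWithinAt_integral_Icc (continuousOn_time hcp x) ht).const_add _).congr hval
    (hval t ht)

theorem IsC1Infty.hasDerivWithinAt {T : ℝ} {w : ℝ → E d → ℝ} (h : IsC1Infty T w) {t : ℝ}
    (ht : t ∈ Icc 0 T) (x : E d) :
    HasDerivWithinAt (fun s => w s x) (timeDeriv T w t x) (Icc 0 T) t :=
  (h.2.1 x t ht).hasDerivWithinAt

theorem IsC1Infty.hasDerivWithinAt_mderiv {T : ℝ} {w : ℝ → E d → ℝ} (h : IsC1Infty T w)
    (μ : Fin d → ℕ) : ∀ t ∈ Icc 0 T, ∀ x,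
    HasDerivWithinAt (fun s => mderiv μ (w s) x) (mderiv μ (timeDeriv T w t) x) (Icc 0 T) t := by
  have hs : ∀ t ∈ Icc 0 T, Smooth (w t) := h.1.1
  have hs' : ∀ t ∈ Icc 0 T, Smooth (timeDeriv T w t) := h.2.2.1
  induction μ using multiIndex_induction with
  | h0 => intro t ht x; simpa using h.hasDerivWithinAt ht x
  | hs μ j ih =>
    intro t ht x
    have h1 := hasDerivWithinAt_pd j (fun t ht => (hs t ht).mderiv μ)
      (fun t ht => (hs' t ht).mderiv μ) ih (h.2.2.2 μ) ((h.2.2.2 (μ + unitIdx j)).congr fun p hp => by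
        simp only; rw [mderiv_add_unit (hs' p.1 hp.1)]) ht x
    rw [mderiv_add_unit (hs' t ht)]
    exact h1.congr (fun s hs1 => by rw [mderiv_add_unit (hs s hs1)])
      (by rw [mderiv_add_unit (hs t ht)])

theorem pd_sum {ι : Type*} (s : Finset ι) {f : ι → E m → ℝ} (hf : ∀ i ∈ s, Smooth (f i))
    (k : Fin m) : pd k (∑ i ∈ s, f i) = ∑ i ∈ s, pd k (f i) := by
  rw [← mderiv_unit (Smooth.sum s hf), mderiv_sum s hf]
  exact Finset.sum_congr rfl fun i hi => mderiv_unit (hf i hi) k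

/-- The second derivatives of a composition. -/
theorem pd_pd_comp {g : E n → ℝ} (hg : Smooth g) {v : Fin n → E d → ℝ} (hv : ∀ i, Smooth (v i))
    (k : Fin d) (x : E d) : pd k (pd k (fun y => g (assemble v y))) x =
      ∑ i, ∑ j, pd j (pd i g) (assemble v x) * (pd k (v i) x * pd k (v j) x) +
      ∑ i, pd i g (assemble v x) * pd k (pd k (v i)) x := by
  have h1 : pd k (fun y => g (assemble v y)) =
      ∑ i, (fun y => pd i g (assemble v y)) * pd k (v i) := by
    funext y
    rw [pd_comp hg hv, Finset.sum_apply]; rfl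
  rw [h1, pd_sum _ fun i _ => ((hg.pd i).comp_assemble hv).mul ((hv i).pd k), Finset.sum_apply,
    ← Finset.sum_add_distrib]
  refine Finset.sum_congr rfl fun i _ => ?_
  rw [pd_mul ((hg.pd i).comp_assemble hv) ((hv i).pd k), Pi.add_apply, Pi.mul_apply, Pi.mul_apply,
    pd_comp (hg.pd i) hv, add_comm, Finset.mul_sum]
  congr 1
  exact Finset.sum_congr rfl fun j _ => by ring

theorem hasDerivWithinAt_comp_assemble {g : E n → ℝ} (hg : Smooth g) {v : Fin n → ℝ → ℝ}
    {v' : Fin n → ℝ} {I : Set ℝ} {t : ℝ} (hv : ∀ i, HasDerivWithinAt (v i) (v' i) I t) :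
    HasDerivWithinAt (fun s => g (WithLp.toLp 2 fun i => v i s))
      (∑ i, v' i * pd i g (WithLp.toLp 2 fun i => v i t)) I t := by
  have h1 : HasDerivWithinAt (fun s i => v i s) v' I t := hasDerivWithinAt_pi.2 hv
  have h2 := ((EuclideanSpace.equiv (Fin n) ℝ).symm.hasFDerivAt).comp_hasDerivWithinAt t h1
  have h3 := (hg.differentiable (WithLp.toLp 2 fun i => v i t)).hasFDerivAt.comp_hasDerivWithinAt t h2
  rw [hg.fderiv_eq_sum] at h3
  exact h3

/-! ### Evolution equations and growth of the codes along a classical solution. -/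

namespace PDESystem

variable {S : PDESystem d n} {u : Fin (d + 1) → ℝ → E d → ℝ}

namespace IsClassicalSolution

theorem smooth_space (hu : S.IsClassicalSolution u) {t : ℝ} (ht : t ∈ Icc 0 S.T)
    (i : Fin (d + 1)) : Smooth (u i t) := (hu.smooth i).1.1 t ht

theorem smooth_timeDeriv (hu : S.IsClassicalSolution u) {t : ℝ} (ht : t ∈ Icc 0 S.T)
    (i : Fin (d + 1)) : Smooth (timeDeriv S.T (u i) t) := (hu.smooth i).2.2.1 t ht

theorem heatOp_eq (hu : S.IsClassicalSolution u) {t : ℝ} (ht : t ∈ Icc 0 S.T)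
    (i : Fin (d + 1)) : heatOp S.ν S.T (u i) t =
      timeDeriv S.T (u i) t + S.ν • ∑ k, pd k (pd k (u i t)) := by
  funext x
  simp [heatOp, laplacian_eq_sum_pd (hu.smooth_space ht i), Finset.sum_apply]

theorem smooth_laplacian (hu : S.IsClassicalSolution u) {t : ℝ} (ht : t ∈ Icc 0 S.T)
    (i : Fin (d + 1)) : Smooth (∑ k, pd k (pd k (u i t))) :=
  Smooth.sum _ fun k _ => ((hu.smooth_space ht i).pd k).pd k

theorem smooth_heatOp (hu : S.IsClassicalSolution u) {t : ℝ} (ht : t ∈ Icc 0 S.T)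
    (i : Fin (d + 1)) : Smooth (heatOp S.ν S.T (u i) t) := by
  rw [hu.heatOp_eq ht]
  exact ContDiff.add (hu.smooth_timeDeriv ht i) ((hu.smooth_laplacian ht i).smul _)

theorem mderiv_heatOp (hu : S.IsClassicalSolution u) {t : ℝ} (ht : t ∈ Icc 0 S.T)
    (i : Fin (d + 1)) (μ : Fin d → ℕ) : mderiv μ (heatOp S.ν S.T (u i) t) =
      mderiv μ (timeDeriv S.T (u i) t) + S.ν • ∑ k, pd k (pd k (mderiv μ (u i t))) := by
  have hs := hu.smooth_space ht i
  rw [hu.heatOp_eq ht, mderiv_add (hu.smooth_timeDeriv ht i) ((hu.smooth_laplacian ht i).smul _),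
    mderiv_smul (hu.smooth_laplacian ht i), mderiv_sum _ fun k _ => (hs.pd k).pd k]
  congr 2
  exact Finset.sum_congr rfl fun k _ => by rw [mderiv_pd (hs.pd k), mderiv_pd hs]

theorem heatOp_eq_neg (hu : S.IsClassicalSolution u) {t : ℝ} (ht : t ∈ Icc 0 S.T)
    {i : Fin (d + 1)} (hi : i ≠ 0) : heatOp S.ν S.T (u i) t =
      (-1 : ℝ) • fun x => S.f i (S.jet (fun k => u k t) x) := by
  obtain ⟨j, rfl⟩ := Fin.exists_succ_eq.2 hi
  funext x
  have := hu.parabolic j t ht x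
  simp only [Pi.smul_apply, smul_eq_mul]
  linarith

theorem mderiv_timeDeriv (hu : S.IsClassicalSolution u) {t : ℝ} (ht : t ∈ Icc 0 S.T)
    {i : Fin (d + 1)} (hi : i ≠ 0) (μ : Fin d → ℕ) (x : E d) :
    mderiv μ (timeDeriv S.T (u i) t) x = -(S.ν * ∑ k, pd k (pd k (mderiv μ (u i t))) x) -
      mderiv μ (fun x => S.f i (S.jet (fun k => u k t) x)) x := by
  have h1 := congrFun (hu.mderiv_heatOp ht i μ) x
  rw [hu.heatOp_eq_neg ht hi, mderiv_smul (smooth_star (hu.smooth_space ht) (S.f_smooth i))] at h1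
  simp only [Pi.smul_apply, Pi.add_apply, Finset.sum_apply, smul_eq_mul] at h1
  linarith

/-- The evolution of a code `(a ∂_μ, i)`, `i ≠ 0`. -/
theorem hasDerivWithinAt_deriv (hu : S.IsClassicalSolution u) (a : ℝ) (μ : Fin d → ℕ)
    {i : Fin (d + 1)} (hi : i ≠ 0) {t : ℝ} (ht : t ∈ Icc 0 S.T) (x : E d) :
    HasDerivWithinAt (fun s => S.eval (.deriv a μ i) u s x)
      (-(S.ν * ∑ k, pd k (pd k (S.eval (.deriv a μ i) u t)) x) -
        S.source (S.evalFamily u) (.deriv a μ i) t x) (Icc 0 S.T) t := by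
  have hs := (hu.smooth_space ht i).mderiv μ
  have h1 := ((hu.smooth i).hasDerivWithinAt_mderiv μ t ht x).const_mul a
  convert! h1 using 1
  have h2 : S.eval (.deriv a μ i) u t = a • mderiv μ (u i t) := rfl
  have h3 : ∀ k, pd k (pd k (a • mderiv μ (u i t))) x = a * pd k (pd k (mderiv μ (u i t))) x :=
    fun k => by rw [pd_smul hs, pd_smul (hs.pd k)]; rfl
  rw [h2, S.source_deriv (hu.smooth_space ht), hu.mderiv_timeDeriv ht hi]
  simp_rw [h3, ← Finset.mul_sum]
  ring

/-- The evolution of a code `g^*`. -/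
theorem hasDerivWithinAt_star (hu : S.IsClassicalSolution u) {g : E n → ℝ} (hg : Smooth g)
    {t : ℝ} (ht : t ∈ Icc 0 S.T) (x : E d) :
    HasDerivWithinAt (fun s => S.eval (.star g) u s x)
      (-(S.ν * ∑ k, pd k (pd k (S.eval (.star g) u t)) x) -
        S.source (S.evalFamily u) (.star g) t x) (Icc 0 S.T) t := by
  have hs := hu.smooth_space ht
  have h1 := hasDerivWithinAt_comp_assemble hg (fun r =>
    (hu.smooth (S.β r)).hasDerivWithinAt_mderiv (S.α r) t ht x)
  convert! h1 using 1
  have h2 : S.eval (.star g) u t =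
    fun y => g (assemble (fun j => mderiv (S.α j) (u (S.β j) t)) y) := rfl
  rw [h2, S.source_star hs hg]
  simp_rw [pd_pd_comp hg (fun j => (hs (S.β j)).mderiv (S.α j))]
  -- For `β_r ≠ 0` the parabolic equation is available. For `β_r = 0` the expression `(∂_t + νΔ)u_0`
  -- stays and becomes the code `(∂_{α^r}, -1)`.
  have h3 : ∀ r, mderiv (S.α r) (timeDeriv S.T (u (S.β r)) t) x =
      (if S.β r = 0 then mderiv (S.α r) (heatOp S.ν S.T (u 0) t) x
        else - mderiv (S.α r) (fun y => S.f (S.β r) (S.jet (fun k => u k t) y)) x) -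
      S.ν * ∑ k, pd k (pd k (mderiv (S.α r) (u (S.β r) t))) x := by
    intro r
    split_ifs with h
    · rw [h, hu.mderiv_heatOp ht]
      simp [Finset.sum_apply]
    · rw [hu.mderiv_timeDeriv ht h]; ring
  have h4 : (WithLp.toLp 2 fun r => mderiv (S.α r) (u (S.β r) t) x) =
    S.jet (fun k => u k t) x := rfl
  rw [h4]
  change -(S.ν * ∑ k, (∑ i, ∑ j, pd j (pd i g) (S.jet (fun k => u k t) x) *
      (pd k (mderiv (S.α i) (u (S.β i) t)) x * pd k (mderiv (S.α j) (u (S.β j) t)) x) +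
      ∑ i, pd i g (S.jet (fun k => u k t) x) * pd k (pd k (mderiv (S.α i) (u (S.β i) t))) x)) - _ = _
  simp_rw [h3, sub_mul]
  rw [Finset.sum_sub_distrib, Finset.sum_add_distrib, mul_add]
  have e1 : ∑ k, ∑ i, ∑ j, pd j (pd i g) (S.jet (fun k => u k t) x) *
      (pd k (mderiv (S.α i) (u (S.β i) t)) x * pd k (mderiv (S.α j) (u (S.β j) t)) x) =
      ∑ i, ∑ j, ∑ k, pd j (pd i g) (S.jet (fun k => u k t) x) *
      (pd k (mderiv (S.α i) (u (S.β i) t)) x * pd k (mderiv (S.α j) (u (S.β j) t)) x) := by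
    rw [Finset.sum_comm]
    exact Finset.sum_congr rfl fun i _ => Finset.sum_comm
  have e2 : S.ν * ∑ k, ∑ i, pd i g (S.jet (fun k => u k t) x) *
      pd k (pd k (mderiv (S.α i) (u (S.β i) t))) x =
      ∑ i, S.ν * (∑ k, pd k (pd k (mderiv (S.α i) (u (S.β i) t))) x) *
        pd i g (S.jet (fun k => u k t) x) := by
    rw [Finset.sum_comm, Finset.mul_sum]
    refine Finset.sum_congr rfl fun i _ => ?_
    rw [← Finset.mul_sum]; ring
  have e3 : ∑ r, (if S.β r = 0 then mderiv (S.α r) (heatOp S.ν S.T (u 0) t) x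
        else - mderiv (S.α r) (fun y => S.f (S.β r) (S.jet (fun k => u k t) y)) x) *
          pd r g (S.jet (fun k => u k t) x) =
      ∑ r with S.β r = 0, pd r g (S.jet (fun k => u k t) x) *
        mderiv (S.α r) (heatOp S.ν S.T (u 0) t) x -
      ∑ r with S.β r ≠ 0, pd r g (S.jet (fun k => u k t) x) *
        mderiv (S.α r) (fun y => S.f (S.β r) (S.jet (fun k => u k t) y)) x := by
    rw [← Finset.sum_filter_add_sum_filter_not _ (fun r => S.β r = 0), sub_eq_add_neg,
      ← Finset.sum_neg_distrib]
    congr 1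
    · refine Finset.sum_congr rfl fun r hr => ?_
      rw [if_pos (Finset.mem_filter.1 hr).2, mul_comm]
    · refine Finset.sum_congr rfl fun r hr => ?_
      rw [if_neg (Finset.mem_filter.1 hr).2]; ring
  rw [e1, e2, e3]
  ring

/-- The evolution of the codes that are not governed by a Poisson equation. -/
theorem hasDerivWithinAt_eval (hu : S.IsClassicalSolution u) {c : Code d n} (hc : c ∈ S.codes)
    (hP : ¬ c.IsPoisson) {t : ℝ} (ht : t ∈ Icc 0 S.T) (x : E d) :
    HasDerivWithinAt (fun s => S.eval c u s x)
      (-(S.ν * ∑ k, pd k (pd k (S.eval c u t)) x) -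
        S.source (S.evalFamily u) c t x) (Icc 0 S.T) t := by
  cases c with
  | ident i =>
    -- `Id_i` acts like `(∂_0, i)`, and the two codes have the same source.
    have h := hu.hasDerivWithinAt_deriv 1 0 (i := i) hP ht x
    have h1 : ∀ t, S.eval (.deriv 1 0 i) u t = S.eval (.ident i) u t := fun t => by
      funext x; simp [eval]
    simp_rw [h1] at h
    rw [S.source_deriv (hu.smooth_space ht)] at h
    rw [S.source_ident]
    simpa using h
  | deriv a μ i => exact hu.hasDerivWithinAt_deriv a μ hP ht x
  | star g => exact hu.hasDerivWithinAt_star (IsLabel.smooth hc) ht x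
  | heat μ => exact absurd trivial hP

/-! ### Growth of the codes -/

theorem smooth_eval (hu : S.IsClassicalSolution u) {c : Code d n} (hc : c ∈ S.codes)
    {t : ℝ} (ht : t ∈ Icc 0 S.T) : Smooth (S.eval c u t) := by
  cases c with
  | ident i => exact hu.smooth_space ht i
  | deriv a μ i => exact ((hu.smooth_space ht i).mderiv μ).smul a
  | star g => exact smooth_star (hu.smooth_space ht) (IsLabel.smooth hc)
  | heat μ => exact (hu.smooth_heatOp ht 0).mderiv μ

theorem continuousOn_mderiv (hu : S.IsClassicalSolution u) (i : Fin (d + 1)) (μ : Fin d → ℕ) :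
    ContinuousOn (fun p : ℝ × E d => mderiv μ (u i p.1) p.2) (Icc 0 S.T ×ˢ univ) :=
  (hu.smooth i).1.2 μ

theorem subGaussian_eval (hu : S.IsClassicalSolution u) (hint : S.IntegrabilityConditions u)
    {c : Code d n} (hc : c ∈ S.codes) : SubGaussian S.T (S.eval c u) where
  growth := hint.growth c hc
  continuousOn := by
    cases c with
    | ident i => simpa [eval] using hu.continuousOn_mderiv i 0
    | deriv a μ i => exact continuousOn_const.mul (hu.continuousOn_mderiv i μ)
    | star g =>
      have h1 : ContinuousOn (fun p : ℝ × E d => S.jet (fun k => u k p.1) p.2)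
          (Icc 0 S.T ×ˢ univ) :=
        (PiLp.continuous_toLp 2 _).comp_continuousOn
          (continuousOn_pi.2 fun j => hu.continuousOn_mderiv (S.β j) (S.α j))
      exact (IsLabel.smooth hc).continuous.comp_continuousOn h1
    | heat μ =>
      have h1 : ContinuousOn (fun p : ℝ × E d => mderiv μ (timeDeriv S.T (u 0) p.1) p.2 +
          S.ν * ∑ k, mderiv (μ + unitIdx k + unitIdx k) (u 0 p.1) p.2) (Icc 0 S.T ×ˢ univ) :=
        ((hu.smooth 0).2.2.2 μ).add (continuousOn_const.mul
          (continuousOn_finsetSum _ fun k _ => hu.continuousOn_mderiv 0 _))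
      refine h1.congr fun p hp => ?_
      have hs := hu.smooth_space hp.1 0
      simp only [eval, hu.mderiv_heatOp hp.1, Pi.add_apply, Pi.smul_apply, Finset.sum_apply,
        smul_eq_mul, mderiv_add_unit hs]

theorem subGaussian_codeProd (hu : S.IsClassicalSolution u) (hint : S.IntegrabilityConditions u)
    {Z : List (Code d n)} (hZ : ∀ z ∈ Z, z ∈ S.codes) :
    SubGaussian S.T (codeProd (S.evalFamily u) Z) :=
  SubGaussian.listProd Z fun _ hz => hu.subGaussian_eval hint (hZ _ hz)

theorem subGaussian_source (hu : S.IsClassicalSolution u) (hint : S.IntegrabilityConditions u)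
    {c : Code d n} (hc : c ∈ S.codes) : SubGaussian S.T (S.source (S.evalFamily u) c) :=
  SubGaussian.listSum _ fun _ hZ => hu.subGaussian_codeProd hint (mem_codes_of_mem_mechanism hc hZ)

/-- Spatial derivatives of a code are again codes, or for `g^*` sums of products of codes by Faà di
Bruno. Hence the growth condition on codes also controls the gradients and second derivatives in the
Duhamel formula. -/
theorem subGaussian_mderiv_eval (hu : S.IsClassicalSolution u)
    (hint : S.IntegrabilityConditions u) {c : Code d n} (hc : c ∈ S.codes)
    (μ : Fin d → ℕ) : SubGaussian S.T (fun t => mderiv μ (S.eval c u t)) := by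
  cases c with
  | ident i =>
    exact (hu.subGaussian_eval hint (c := .deriv 1 μ i) trivial).congr fun t _ x => by
      simp only [eval, one_mul]; rfl
  | deriv a κ i =>
    refine (hu.subGaussian_eval hint (c := .deriv a (κ + μ) i) trivial).congr fun t ht x => ?_
    have hs := hu.smooth_space ht i
    have : S.eval (.deriv a κ i) u t = a • mderiv κ (u i t) := rfl
    rw [this, mderiv_smul (hs.mderiv κ), mderiv_mderiv hs]; rfl
  | star g =>
    have h1 : SubGaussian S.T (fun t x => ((S.fdb Finset.univ μ g []).map fun Z =>
        codeProd (S.evalFamily u) Z t x).sum) :=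
      SubGaussian.listSum _ fun Z hZ => hu.subGaussian_codeProd hint
        (mem_codes_of_mem_fdb hc (by simp) hZ)
    refine h1.congr fun t ht x => ?_
    rw [S.sum_codeProd_fdb (hu.smooth_space ht) (IsLabel.smooth hc) (dependsOnlyOn_univ g)]
    simp only [codeProd_nil, one_mul]; rfl
  | heat κ =>
    refine (hu.subGaussian_eval hint (c := .heat (κ + μ)) trivial).congr fun t ht x => ?_
    have : S.eval (.heat κ) u t = mderiv κ (heatOp S.ν S.T (u 0) t) := rfl
    rw [this, mderiv_mderiv (hu.smooth_heatOp ht 0)]; rfl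

end IsClassicalSolution

end PDESystem

/-! ### Sources of potentials -/

theorem integrable_listSum {ι Ω : Type*} [MeasurableSpace Ω] {μ : Measure Ω} (L : List ι)
    {f : ι → Ω → ℝ} (hf : ∀ i ∈ L, Integrable (f i) μ) :
    Integrable (fun ω => (L.map fun i => f i ω).sum) μ := by
  induction L with
  | nil => simp
  | cons a L ih =>
    simp only [List.map_cons, List.sum_cons]
    exact (hf a List.mem_cons_self).add (ih fun i hi => hf i (List.mem_cons_of_mem _ hi))

theorem integral_listSum {ι Ω : Type*} [MeasurableSpace Ω] {μ : Measure Ω} (L : List ι)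
    {f : ι → Ω → ℝ} (hf : ∀ i ∈ L, Integrable (f i) μ) :
    ∫ ω, (L.map fun i => f i ω).sum ∂μ = (L.map fun i => ∫ ω, f i ω ∂μ).sum := by
  induction L with
  | nil => simp
  | cons a L ih =>
    simp only [List.map_cons, List.sum_cons]
    have h := fun i hi => hf i (List.mem_cons_of_mem a hi)
    rw [integral_add (hf a List.mem_cons_self) (integrable_listSum L h), ih h]

/-- A continuous function of time and space that is dominated, uniformly in time, by a function
with an absolutely convergent Newtonian potential. -/
structure PotentialSource (T : ℝ) (w : ℝ → E d → ℝ) : Prop where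
  continuousOn : ContinuousOn (fun p : ℝ × E d => w p.1 p.2) (Icc 0 T ×ˢ univ)
  dominated : ∃ G : E d → ℝ, (∀ x, Integrable (fun y : E d => newtonKernel y * G (x + y))) ∧
    ∀ t ∈ Icc 0 T, ∀ y, |w t y| ≤ G y

namespace PotentialSource

variable {T : ℝ} {w w' : ℝ → E d → ℝ}

theorem add (h : PotentialSource T w) (h' : PotentialSource T w') :
    PotentialSource T (fun t x => w t x + w' t x) where
  continuousOn := h.1.add h'.1
  dominated := by
    obtain ⟨G, hG, hw⟩ := h.2
    obtain ⟨G', hG', hw'⟩ := h'.2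
    refine ⟨fun y => G y + G' y, fun x => ?_, fun t ht y =>
      (abs_add_le _ _).trans (add_le_add (hw t ht y) (hw' t ht y))⟩
    simp only [mul_add]
    exact (hG x).add (hG' x)

theorem const_mul (h : PotentialSource T w) (c : ℝ) :
    PotentialSource T (fun t x => c * w t x) where
  continuousOn := continuousOn_const.mul h.1
  dominated := by
    obtain ⟨G, hG, hw⟩ := h.2
    refine ⟨fun y => |c| * G y, fun x => ?_, fun t ht y => ?_⟩
    · simpa only [mul_left_comm] using (hG x).const_mul |c|
    · rw [abs_mul]; exact mul_le_mul_of_nonneg_left (hw t ht y) (abs_nonneg c)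

theorem zero : PotentialSource T (fun (_ : ℝ) (_ : E d) => (0 : ℝ)) :=
  ⟨continuousOn_const, fun _ => 0, by simp, by simp⟩

theorem sum {ι : Type*} (s : Finset ι) {w : ι → ℝ → E d → ℝ}
    (h : ∀ i ∈ s, PotentialSource T (w i)) : PotentialSource T (fun t x => ∑ i ∈ s, w i t x) := by
  induction s using Finset.cons_induction with
  | empty => simpa using zero
  | cons a s ha ih =>
    simp only [Finset.sum_cons]
    exact (h a (Finset.mem_cons_self a s)).add (ih fun i hi => h i (Finset.mem_cons_of_mem hi))

theorem listSum {ι : Type*} (L : List ι) {w : ι → ℝ → E d → ℝ}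
    (h : ∀ i ∈ L, PotentialSource T (w i)) :
    PotentialSource T (fun t x => (L.map fun i => w i t x).sum) := by
  induction L with
  | nil => simpa using zero
  | cons a L ih =>
    simp only [List.map_cons, List.sum_cons]
    exact (h a List.mem_cons_self).add (ih fun i hi => h i (List.mem_cons_of_mem _ hi))

theorem congr (h : PotentialSource T w) (hw : ∀ t ∈ Icc 0 T, ∀ x, w t x = w' t x) :
    PotentialSource T w' where
  continuousOn := h.1.congr fun p hp => (hw p.1 hp.1 p.2).symm
  dominated := by
    obtain ⟨G, hG, h⟩ := h.2
    exact ⟨G, hG, fun t ht x => hw t ht x ▸ h t ht x⟩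

theorem continuous_restrict (h : PotentialSource T w) :
    Continuous (fun p : Icc 0 T × E d => w p.1 p.2) :=
  h.1.comp_continuous (f := fun p : Icc 0 T × E d => ((p.1 : ℝ), p.2)) (by fun_prop)
    fun p => ⟨p.1.2, mem_univ _⟩

theorem integrable (hd : 2 ≤ d) (h : PotentialSource T w) {t : ℝ} (ht : t ∈ Icc 0 T) (x : E d) :
    Integrable (fun y => newtonKernel y * w t (x + y)) := by
  obtain ⟨G, hG, hw⟩ := h.2
  exact integrable_potential (M := fun (t : Icc 0 T) y => w t y)
    (isPotentialKernel_newtonKernel hd) h.continuous_restrict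
    (fun t y => hw t t.2 y) hG ⟨t, ht⟩ x

theorem continuousOn_of_restrict {f : ℝ × E d → ℝ}
    (h : Continuous fun p : Icc 0 T × E d => f (p.1, p.2)) : ContinuousOn f (Icc 0 T ×ˢ univ) := by
  rw [continuousOn_iff_continuous_domRestrict]
  have h1 : Continuous fun p : (Icc 0 T ×ˢ (univ : Set (E d)) : Set (ℝ × E d)) =>
      ((⟨p.1.1, p.2.1⟩, p.1.2) : Icc 0 T × E d) := by fun_prop
  exact h.comp h1

theorem continuousOn_potential (hd : 2 ≤ d) (h : PotentialSource T w) :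
    ContinuousOn (fun p : ℝ × E d => ∫ y, newtonKernel y * w p.1 (p.2 + y))
      (Icc 0 T ×ˢ univ) := by
  obtain ⟨G, hG, hw⟩ := h.2
  exact continuousOn_of_restrict (continuous_potential (M := fun (t : Icc 0 T) y => w t y)
    (isPotentialKernel_newtonKernel hd) h.continuous_restrict (fun t y => hw t t.2 y) hG)

theorem continuousOn_abs_potential (hd : 2 ≤ d) (h : PotentialSource T w) :
    ContinuousOn (fun p : ℝ × E d => ∫ y, |newtonKernel y| * |w p.1 (p.2 + y)|)
      (Icc 0 T ×ˢ univ) := by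
  obtain ⟨G, hG, hw⟩ := h.2
  refine continuousOn_of_restrict (continuous_potential (G := fun y => |G y|)
    (M := fun (t : Icc 0 T) y => |w t y|) (isPotentialKernel_newtonKernel hd).abs
    h.continuous_restrict.abs (fun t y => ?_) fun x => ?_)
  · rw [abs_abs]; exact (hw t t.2 y).trans (le_abs_self _)
  · simpa only [abs_mul] using (hG x).abs

/-- Differentiation of a potential in a space variable. -/
theorem pd_potential (hd : 2 ≤ d) (h : PotentialSource T w) (j : Fin d)
    (hj : PotentialSource T fun t => pd j (w t)) {t : ℝ} (ht : t ∈ Icc 0 T) (hw : Smooth (w t))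
    {v : E d → ℝ} (hv : Smooth v) (hvw : ∀ x, v x = ∫ y, newtonKernel y * w t (x + y)) (x : E d) :
    pd j v x = ∫ y, newtonKernel y * pd j (w t) (x + y) := by
  set e : E d := EuclideanSpace.single j 1 with he
  have hline : ∀ z : E d, ∀ s : ℝ,
      HasDerivAt (fun s : ℝ => w t (z + s • e)) (pd j (w t) (z + s • e)) s := by
    intro z s
    have h := hw.hasLineDerivAt j (z + s • e)
    have h' : HasDerivAt (fun a : ℝ => w t (z + s • e + a • e)) (pd j (w t) (z + s • e))
        (s - s) := by rw [sub_self]; exact h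
    have := h'.comp_sub_const s s
    convert! this using 1
    funext a
    congr 1
    rw [add_assoc, ← add_smul]; congr 2; ring
  have hpath : ContinuousOn (fun s : ℝ => (t, x + s • e)) (Icc 0 1) := by fun_prop
  have hmem : MapsTo (fun s : ℝ => (t, x + s • e)) (Icc 0 1) (Icc 0 T ×ˢ univ) :=
    fun s _ => ⟨ht, mem_univ _⟩
  -- The potential is differentiated along the segment `x + s e`, `0 ≤ s ≤ 1`, at its end point. The
  -- one-sided derivative suffices because `v` is already known to be smooth.
  have h1 := hasDerivWithinAt_potential (K := newtonKernel) (a := 0) (b := 1)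
    (F := fun s y => w t (x + s • e + y)) (F' := fun s y => pd j (w t) (x + s • e + y))
    measurable_newtonKernel (fun y s _ => by
      have := (hline (x + y) s).hasDerivWithinAt (s := Icc 0 1)
      simpa only [add_right_comm] using this)
    (by have := (hw.pd j).continuous; fun_prop)
    (fun s _ => h.integrable hd ht _) (fun s _ => hj.integrable hd ht _)
    ((hj.continuousOn_potential hd).comp hpath hmem)
    ((hj.continuousOn_abs_potential hd).comp hpath hmem) (s := 0) ⟨le_rfl, zero_le_one⟩
  simp only [← hvw, zero_smul, add_zero] at h1
  have h2 : HasDerivAt (fun s : ℝ => v (x + s • e)) (pd j v x) 0 := hv.hasLineDerivAt j x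
  exact (uniqueDiffOn_Icc zero_lt_one 0 ⟨le_rfl, zero_le_one⟩).eq_deriv _
    h2.hasDerivWithinAt h1

/-- Differentiation of a potential in the time variable. -/
theorem hasDerivWithinAt_time (hd : 2 ≤ d) (h : PotentialSource T w) (h' : PotentialSource T w')
    (hder : ∀ y, ∀ t ∈ Icc 0 T, HasDerivWithinAt (fun s => w s y) (w' t y) (Icc 0 T) t)
    {t : ℝ} (ht : t ∈ Icc 0 T) (x : E d) :
    HasDerivWithinAt (fun s => ∫ y, newtonKernel y * w s (x + y))
      (∫ y, newtonKernel y * w' t (x + y)) (Icc 0 T) t := by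
  have hpath : ContinuousOn (fun s : ℝ => (s, x)) (Icc 0 T) := by fun_prop
  have hmem : MapsTo (fun s : ℝ => (s, x)) (Icc 0 T) (Icc 0 T ×ˢ univ) :=
    fun s hs => ⟨hs, mem_univ _⟩
  exact hasDerivWithinAt_potential (F := fun s y => w s (x + y)) (F' := fun s y => w' s (x + y))
    measurable_newtonKernel (fun y s hs => hder _ s hs)
    (h'.1.comp (f := fun p : ℝ × E d => (p.1, x + p.2)) (by fun_prop)
      fun p hp => ⟨hp.1, mem_univ _⟩)
    (fun s hs => h.integrable hd hs _) (fun s hs => h'.integrable hd hs _)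
    ((h'.continuousOn_potential hd).comp hpath hmem)
    ((h'.continuousOn_abs_potential hd).comp hpath hmem) ht

end PotentialSource

theorem pd_zero (j : Fin m) : pd j (0 : E m → ℝ) = 0 := by
  funext x
  simp [pd, lineDeriv]

/-! ### Poisson codes as Newtonian potentials, and the integral system for `(c(u))_c`. -/

namespace PDESystem

variable {S : PDESystem d n} {u : Fin (d + 1) → ℝ → E d → ℝ}

/-- Both sources encode `(∂_t + νΔ) f_0^*(u)`, with opposite signs. Since `f_0` does not depend on
the variables with `β_j = 0`, the terms with `(∂_α, -1)` vanish and the double sum reduces to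
indices with `β ≠ 0`. -/
theorem source_star_zero {t : ℝ} (hu : ∀ i, Smooth (u i t)) (x : E d) :
    S.source (S.evalFamily u) (.star (S.f 0)) t x =
      -S.source (S.evalFamily u) (.heat 0) t x := by
  have hf : Smooth (S.f 0) := S.f_smooth 0
  have hA := S.dependsOnlyOn_args 0
  have hr : ∀ r, S.β r = 0 → pd r (S.f 0) = 0 := fun r h =>
    hA.pd_eq_zero (by simp [args, h])
  have hr' : ∀ i r, S.β r = 0 → pd r (pd i (S.f 0)) = 0 := fun i r h =>
    (hA.pd i).pd_eq_zero (by simp [args, h])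
  rw [source_star S hu hf, source_heat hu, mderiv_zero, poissonSource, Pi.add_apply]
  simp_rw [Finset.sum_apply, Pi.smul_apply, Pi.mul_apply, smul_eq_mul]
  have h3 : ∑ r with S.β r = 0, pd r (S.f 0) (S.jet (fun k => u k t) x) *
      mderiv (S.α r) (heatOp S.ν S.T (u 0) t) x = 0 := Finset.sum_eq_zero fun r h => by
    rw [hr r (Finset.mem_filter.1 h).2, Pi.zero_apply, zero_mul]
  have h2 : ∀ F : Fin n → Fin n → ℝ, (∀ i j, S.β i = 0 ∨ S.β j = 0 → F i j = 0) →
      ∑ i, ∑ j, F i j = ∑ i with S.β i ≠ 0, ∑ j with S.β j ≠ 0, F i j := by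
    intro F hF
    rw [Finset.sum_filter]
    refine Finset.sum_congr rfl fun i _ => ?_
    split_ifs with hi
    · rw [Finset.sum_filter]
      refine Finset.sum_congr rfl fun j _ => ?_
      split_ifs with hj
      · rfl
      · exact hF i j (Or.inr (not_not.1 hj))
    · exact Finset.sum_eq_zero fun j _ => hF i j (Or.inl (not_not.1 hi))
  rw [h3, sub_zero, h2 _ ?_]
  · simp_rw [Finset.mul_sum]
    rw [neg_add, sub_eq_add_neg, add_comm, ← Finset.sum_neg_distrib, ← Finset.sum_neg_distrib,
      ← Finset.sum_neg_distrib]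
    congr 1
    · refine Finset.sum_congr rfl fun i _ => ?_
      rw [← Finset.sum_neg_distrib, ← Finset.sum_neg_distrib]
      refine Finset.sum_congr rfl fun j _ => ?_
      rw [← Finset.sum_neg_distrib, ← Finset.sum_neg_distrib]
      exact Finset.sum_congr rfl fun k _ => by ring
    · exact Finset.sum_congr rfl fun i _ => by ring
  · rintro i j (h | h)
    · refine Finset.sum_eq_zero fun k _ => ?_
      rw [hr i h, pd_zero]; simp
    · refine Finset.sum_eq_zero fun k _ => ?_
      rw [hr' i j h]; simp

namespace IsClassicalSolution

/-- The placeholder for the component 0 in `phiZero` is harmless, because `f_0` does not see the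
derivatives of `u_0`. -/
theorem phiAll_eq (hu : S.IsClassicalSolution u) : S.phiAll = fun i => u i S.T := by
  have hT : S.T ∈ Icc 0 S.T := ⟨S.T_pos.le, le_rfl⟩
  funext i x
  refine Fin.cases ?_ (fun j => ?_) i
  · rw [phiAll, Fin.cons_zero, phiZero, hu.potential _ hT]
    congr 1
    funext y
    congr 1
    refine S.f_zero_indep _ _ fun j hj => ?_
    obtain ⟨k, hk⟩ := Fin.exists_succ_eq.2 hj
    simp only [jet, ← hk, Fin.cons_succ, hu.terminal]
  · rw [phiAll, Fin.cons_succ, hu.terminal]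

theorem terminalValue_eq (hu : S.IsClassicalSolution u) {c : Code d n} (hP : ¬ c.IsPoisson)
    (x : E d) : S.terminalValue c x = S.eval c u S.T x := by
  cases c with
  | heat μ => exact absurd trivial hP
  | _ => simp only [terminalValue, eval, hu.phiAll_eq]

theorem potentialSource_codeProd (hu : S.IsClassicalSolution u)
    (hint : S.IntegrabilityConditions u) {c : Code d n} (hc : c ∈ S.codes) (hP : c.IsPoisson)
    {Z : List (Code d n)} (hZ : Z ∈ S.mechanism c) :
    PotentialSource S.T (codeProd (S.evalFamily u) Z) :=
  ⟨(hu.subGaussian_codeProd hint (mem_codes_of_mem_mechanism hc hZ)).1, hint.newton c hc hP Z hZ⟩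

theorem potentialSource_source (hu : S.IsClassicalSolution u)
    (hint : S.IntegrabilityConditions u) {c : Code d n} (hc : c ∈ S.codes) (hP : c.IsPoisson) :
    PotentialSource S.T (S.source (S.evalFamily u) c) :=
  PotentialSource.listSum _ fun _ hZ => hu.potentialSource_codeProd hint hc hP hZ

/-- The codes governed by a Poisson equation are the potentials of their sources. -/
def IsRepresented (S : PDESystem d n) (u : Fin (d + 1) → ℝ → E d → ℝ) (c : Code d n) : Prop :=
  ∀ t ∈ Icc 0 S.T, ∀ x, S.eval c u t x =
    ∫ y, newtonKernel y * S.source (S.evalFamily u) c t (x + y)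

/-- Starting from the potential formula for `u_0`, each spatial derivative passes under the
integral. The domination hypothesis for the code of the next higher order is what permits it. -/
theorem isRepresented_deriv_one (hd : 2 ≤ d) (hu : S.IsClassicalSolution u)
    (hint : S.IntegrabilityConditions u) (μ : Fin d → ℕ) : IsRepresented S u (.deriv 1 μ 0) := by
  have hsrc : ∀ t ∈ Icc 0 S.T, ∀ μ, S.source (S.evalFamily u) (.deriv 1 μ 0) t =
      mderiv μ (fun y => S.f 0 (S.jet (fun k => u k t) y)) := fun t ht μ => by
    funext x
    rw [S.source_deriv (hu.smooth_space ht), one_mul]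
  have hev : ∀ t μ, S.eval (.deriv 1 μ 0) u t = mderiv μ (u 0 t) := fun t μ => by
    funext x; simp only [eval, one_mul]
  have hps := fun μ => hu.potentialSource_source hint (c := .deriv 1 μ 0) trivial rfl
  induction μ using multiIndex_induction with
  | h0 =>
    intro t ht x
    rw [hev, hsrc t ht, mderiv_zero, mderiv_zero, hu.potential t ht]
  | hs μ j ih =>
    intro t ht x
    have hsm := smooth_star (S := S) (hu.smooth_space ht) (S.f_smooth 0)
    have h1 : PotentialSource S.T fun t => pd j (S.source (S.evalFamily u) (.deriv 1 μ 0) t) :=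
      (hps (μ + unitIdx j)).congr fun t ht x => by
        rw [hsrc t ht, hsrc t ht,
          mderiv_add_unit (smooth_star (hu.smooth_space ht) (S.f_smooth 0))]
    have h2 := (hps μ).pd_potential hd j h1 ht (by rw [hsrc t ht]; exact hsm.mderiv μ)
      (v := S.eval (.deriv 1 μ 0) u t)
      (hu.smooth_eval (c := .deriv 1 μ 0) trivial ht) (ih t ht) x
    rw [hev, mderiv_add_unit (hu.smooth_space ht 0), ← hev, h2, hsrc t ht, hsrc t ht,
      mderiv_add_unit hsm]

/-- For `μ = 0`, `∂_t u_0` is the potential of `∂_t f_0^*(u)` and `νΔu_0` that of `νΔ f_0^*(u)`;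
together they are the potential of `(∂_t + νΔ) f_0^*(u)`. Higher `μ` follow by differentiation in
space. -/
theorem isRepresented_heat (hd : 2 ≤ d) (hu : S.IsClassicalSolution u)
    (hint : S.IntegrabilityConditions u) (μ : Fin d → ℕ) : IsRepresented S u (.heat μ) := by
  have hsrc : ∀ t ∈ Icc 0 S.T, ∀ μ, S.source (S.evalFamily u) (.heat μ) t =
      mderiv μ (S.poissonSource u t) := fun t ht μ => by
    funext x
    rw [S.source_heat (hu.smooth_space ht)]
  have hps := fun μ => hu.potentialSource_source hint (c := .heat μ) trivial trivial
  induction μ using multiIndex_induction with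
  | h0 =>
    intro t ht x
    set e : Fin d → Fin d → ℕ := fun k => unitIdx k + unitIdx k
    have hpd := fun μ => hu.potentialSource_source hint (c := .deriv 1 μ 0) trivial rfl
    have hsum := PotentialSource.sum Finset.univ fun k _ => hpd (e k)
    -- `∂_t f_0^*(u)` is not itself a source of a code. Its domination follows by writing it as the
    -- source of `(∂_0, -1)` minus `ν` times the sources of the second derivatives of `u_0`.
    have hF' := (hps 0).add (hsum.const_mul (-S.ν))
    have hF : PotentialSource S.T (S.eval (.star (S.f 0)) u) :=
      (hu.potentialSource_source hint (c := .ident 0) trivial rfl).congr fun t ht x =>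
        S.source_ident u 0 t x
    have hder := hF.hasDerivWithinAt_time hd hF' (fun y t ht => by
      have h := hu.hasDerivWithinAt_star (S.f_smooth 0) ht y
      convert! h using 1
      rw [source_star_zero (hu.smooth_space ht), sub_neg_eq_add, add_comm, neg_mul]
      congr 3
      refine Finset.sum_congr rfl fun k _ => ?_
      have hsm := smooth_star (S := S) (hu.smooth_space ht) (S.f_smooth 0)
      rw [S.source_deriv (hu.smooth_space ht), one_mul, mderiv_add_unit hsm, mderiv_unit hsm]
      rfl) ht x
    have h1 : timeDeriv S.T (u 0) t x = _ := (hder.congr (fun s hs => hu.potential s hs x)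
      (hu.potential t ht x)).derivWithin (uniqueDiffOn_Icc S.T_pos t ht)
    have hs := hu.smooth_space ht 0
    have h2 : ∀ k, pd k (pd k (u 0 t)) x =
        ∫ y, newtonKernel y * S.source (S.evalFamily u) (.deriv 1 (e k) 0) t (x + y) := fun k => by
      rw [← isRepresented_deriv_one hd hu hint (e k) t ht x]
      simp only [eval, one_mul, e]
      rw [mderiv_add_unit hs, mderiv_unit hs]
    have h3 : S.eval (.heat 0) u t x = timeDeriv S.T (u 0) t x +
        S.ν * ∑ k, pd k (pd k (u 0 t)) x := by
      simp only [eval, mderiv_zero, hu.heatOp_eq ht, Pi.add_apply, Pi.smul_apply, Finset.sum_apply,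
        smul_eq_mul]
    have h4 : ∀ k, Integrable fun y =>
        newtonKernel y * S.source (S.evalFamily u) (.deriv 1 (e k) 0) t (x + y) := fun k =>
      (hpd (e k)).integrable hd ht x
    rw [h3, h1]
    simp_rw [h2, mul_add]
    rw [integral_add ((hps 0).integrable hd ht x) ((hsum.const_mul (-S.ν)).integrable hd ht x)]
    simp_rw [mul_left_comm _ (-S.ν)]
    rw [integral_const_mul]
    simp_rw [Finset.mul_sum]
    rw [integral_finsetSum _ fun k _ => h4 k, ← Finset.mul_sum]
    ring
  | hs μ j ih =>
    intro t ht x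
    have hsm := smooth_poissonSource (S := S) (hu.smooth_space ht)
    have h1 : PotentialSource S.T fun t => pd j (S.source (S.evalFamily u) (.heat μ) t) :=
      (hps (μ + unitIdx j)).congr fun t ht x => by
        rw [hsrc t ht, hsrc t ht, mderiv_add_unit (smooth_poissonSource (hu.smooth_space ht))]
    have h2 := (hps μ).pd_potential hd j h1 ht (by rw [hsrc t ht]; exact hsm.mderiv μ)
      (v := S.eval (.heat μ) u t) (hu.smooth_eval (c := .heat μ) trivial ht) (ih t ht) x
    have hev : ∀ μ, S.eval (.heat μ) u t = mderiv μ (heatOp S.ν S.T (u 0) t) := fun μ => rfl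
    rw [hev, mderiv_add_unit (hu.smooth_heatOp ht 0), ← hev, h2, hsrc t ht, hsrc t ht,
      mderiv_add_unit hsm]

theorem isRepresented (hd : 2 ≤ d) (hu : S.IsClassicalSolution u)
    (hint : S.IntegrabilityConditions u) {c : Code d n} (hP : c.IsPoisson) :
    IsRepresented S u c := by
  cases c with
  | star g => exact hP.elim
  | heat μ => exact isRepresented_heat hd hu hint μ
  | ident i =>
    have hP : i = 0 := hP
    subst hP
    intro t ht x
    simp_rw [S.source_ident]
    exact hu.potential t ht x
  | deriv a μ i =>
    have hP : i = 0 := hP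
    subst hP
    intro t ht x
    have h := isRepresented_deriv_one hd hu hint μ t ht x
    simp_rw [S.source_deriv (hu.smooth_space ht), one_mul] at h ⊢
    simp_rw [mul_left_comm _ a]
    rw [integral_const_mul, ← h]
    simp only [eval, one_mul]

/-- The family of the codes of a classical solution solves the integral system. -/
theorem isIntegralSolution (hd : 2 ≤ d) (hu : S.IsClassicalSolution u)
    (hint : S.IntegrabilityConditions u) : S.IsIntegralSolution (S.evalFamily u) where
  poisson_integrable c hc hP t ht x Z hZ := by
    have h := (hu.potentialSource_codeProd hint hc hP hZ).integrable hd ht x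
    have hs := hu.subGaussian_codeProd hint (mem_codes_of_mem_mechanism hc hZ)
    exact integrable_heat_poisson hd (g := fun y => codeProd (S.evalFamily u) Z t (x + y))
      (by have := hs.continuous_space ht; exact Continuous.aestronglyMeasurable (by fun_prop)) h
  poisson_eq c hc hP t ht x := by
    have h := fun Z hZ => (hu.potentialSource_codeProd hint hc hP (Z := Z) hZ).integrable hd ht x
    have h1 : S.evalFamily u c t x = _ := hu.isRepresented hd hint hP t ht x
    simp_rw [h1, source, ← List.sum_map_mul_left]
    rw [integral_listSum _ h]
    congr 1
    refine List.map_congr_left fun Z hZ => ?_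
    have hs := hu.subGaussian_codeProd hint (mem_codes_of_mem_mechanism hc hZ)
    exact (integral_heat_poisson hd (g := fun y => codeProd (S.evalFamily u) Z t (x + y))
      (by have := hs.continuous_space ht; exact Continuous.aestronglyMeasurable (by fun_prop))
      (h Z hZ)).symm
  terminal_integrable c hc hP t ht x := by
    have hpos : 0 < 2 * S.ν * (S.T - t) := mul_pos (by linarith [S.ν_pos]) (sub_pos.2 ht.2)
    rw [← integrable_gaussian_shift_iff hpos]
    simp_rw [hu.terminalValue_eq hP]
    exact (hu.subGaussian_eval hint hc).integrable_shift ⟨S.T_pos.le, le_rfl⟩ x _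
  source_integrable c hc hP t ht x Z hZ :=
    (hu.subGaussian_codeProd hint (mem_codes_of_mem_mechanism hc hZ)).integrable_heat S.ν_pos ht x
  parabolic_eq c hc hP t ht x := by
    have hpd : ∀ k, SubGaussian S.T fun t => pd k (S.eval c u t) := fun k =>
      (hu.subGaussian_mderiv_eval hint hc (unitIdx k)).congr fun t ht x => by
        rw [mderiv_unit (hu.smooth_eval hc ht)]
    have hpd2 : ∀ k, SubGaussian S.T fun t => pd k (pd k (S.eval c u t)) := fun k =>
      (hu.subGaussian_mderiv_eval hint hc (unitIdx k + unitIdx k)).congr fun t ht x => by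
        rw [mderiv_add_unit (hu.smooth_eval hc ht), mderiv_unit (hu.smooth_eval hc ht)]
    have h := duhamel S.ν_pos (fun t ht => hu.smooth_eval hc ht) (hu.subGaussian_eval hint hc)
      hpd hpd2 (hu.subGaussian_source hint hc)
      (fun t ht x => hu.hasDerivWithinAt_eval hc hP ht x) ht x
    have hpos : ∀ s ∈ Ioc t S.T, 0 < 2 * S.ν * (s - t) := fun s hs =>
      mul_pos (by linarith [S.ν_pos]) (sub_pos.2 hs.1)
    have hint' := fun Z hZ => (hu.subGaussian_codeProd hint
      (mem_codes_of_mem_mechanism hc (Z := Z) hZ)).integrable_heat S.ν_pos ht x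
    have h1 : S.evalFamily u c t x = _ := h
    rw [h1, integral_gaussian_shift (hpos S.T ⟨ht.2, le_rfl⟩)]
    simp_rw [hu.terminalValue_eq hP]
    congr 1
    -- The iterated integral is rewritten over space-time so that the sum over the mechanism can be
    -- taken out using the joint integrability of each term.
    rw [setIntegral_congr_fun measurableSet_Ioc fun s hs => integral_gaussian_shift (hpos s hs) x
      (S.source (S.evalFamily u) c s)]
    rw [← integral_prod (fun p : ℝ × E d => heatKernel (2 * S.ν) (p.1 - t) (p.2 - x) *
      S.source (S.evalFamily u) c p.1 p.2)
      ((hu.subGaussian_source hint hc).integrable_heat S.ν_pos ht x)]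
    simp_rw [source, ← List.sum_map_mul_left]
    rw [integral_listSum _ hint']
    congr 1
    exact List.map_congr_left fun Z hZ => integral_prod _ (hint' Z hZ)
  terminal_eq c hc hP x := (hu.terminalValue_eq hP x).symm

end IsClassicalSolution

end PDESystem

/-! ### The random tree -/

instance sFinite_densityLaw (ρ : ℝ → ℝ) : SFinite (densityLaw ρ) := by
  unfold densityLaw; infer_instance

theorem isProbabilityMeasure_densityLaw {ρ : ℝ → ℝ} (hρ : IsPositiveDensity ρ) :
    IsProbabilityMeasure (densityLaw ρ) :=
  ⟨by rw [densityLaw, withDensity_apply _ MeasurableSet.univ, setLIntegral_univ,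
    hρ.lintegral_eq_one]⟩

theorem isProbabilityMeasure_uniform : IsProbabilityMeasure (volume.restrict (Icc (0 : ℝ) 1)) :=
  ⟨by simp⟩

theorem isProbabilityMeasure_drawLaw {ρ ρ' : ℝ → ℝ} (hρ : IsPositiveDensity ρ)
    (hρ' : IsPositiveDensity ρ') : IsProbabilityMeasure (drawLaw d ρ ρ') := by
  have := isProbabilityMeasure_densityLaw hρ
  have := isProbabilityMeasure_densityLaw hρ'
  have := isProbabilityMeasure_uniform
  unfold drawLaw
  infer_instance

theorem measurable_tail {ρ : ℝ → ℝ} (hρ : IsPositiveDensity ρ) : Measurable (tail ρ) := by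
  have := isProbabilityMeasure_densityLaw hρ
  exact Antitone.measurable fun a b hab => measureReal_mono (Ioi_subset_Ioi hab)

namespace PDESystem

variable (S : PDESystem d n) (ρ ρ' : ℝ → ℝ)

/-- The element of the mechanism chosen by a call. -/
def choice (c : Code d n) (U : ℝ) : List (Code d n) :=
  (S.mechanism c).getD ⌊(S.mechanism c).length * U⌋₊ []

open Classical in
/-- The output of a call whose `j`-th child is replaced by `w j`. -/
def step (D : ℝ × ℝ × E d × ℝ) (t : ℝ) (x : E d) (c : Code d n)
    (w : ℕ → Code d n → ℝ → E d → ℝ) : ℝ :=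
  let Z := S.choice c D.2.2.2
  if c.IsPoisson then
    poissonN (√D.2.1 • D.2.2.1) * (S.mechanism c).length / (2 * D.2.1 * ρ' D.2.1) *
      ∏ j : Fin Z.length, w j Z[j] t (x + √D.2.1 • D.2.2.1)
  else if S.T < t + D.1 then
    S.terminalValue c (x + √(2 * S.ν * (S.T - t)) • D.2.2.1) / tail ρ (S.T - t)
  else
    (S.mechanism c).length / ρ D.1 *
      ∏ j : Fin Z.length, w j Z[j] (t + D.1) (x + √(2 * S.ν * D.1) • D.2.2.1)

/-- The draws of the subtree that starts at the `j`-th child of the root. -/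
def subtree (m : List ℕ → ℝ × ℝ × E d × ℝ) (j : ℕ) : List ℕ → ℝ × ℝ × E d × ℝ :=
  fun l => m (l ++ [j])

theorem prod_mapIdx {α : Type*} (Z : List α) (f : ℕ → α → ℝ) :
    (Z.mapIdx f).prod = ∏ j : Fin Z.length, f j Z[j] := by
  rw [List.mapIdx_eq_ofFn, List.prod_ofFn]; rfl

theorem treeProd_succ_label (m : List ℕ → ℝ × ℝ × E d × ℝ) (k : ℕ) (l : List ℕ) (t : ℝ) (x : E d)
    (c : Code d n) : S.treeProd ρ ρ' m (k + 1) l t x c =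
      S.step ρ ρ' (m l) t x c fun j c t x => S.treeProd ρ ρ' m k (j :: l) t x c := by
  simp only [treeProd, step, choice, prod_mapIdx, Draw.ofTuple]
  rfl

/-- A call uses only the draws at labels that extend its own. Since children are prepended, this is
a shift of the labels by a common suffix. -/
theorem treeProd_append (k : ℕ) : ∀ (m : List ℕ → ℝ × ℝ × E d × ℝ) (l l' : List ℕ) (t : ℝ)
    (x : E d) (c : Code d n), S.treeProd ρ ρ' m k (l ++ l') t x c =
      S.treeProd ρ ρ' (fun w => m (w ++ l')) k l t x c := by
  induction k with
  | zero => intros; rfl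
  | succ k ih =>
    intro m l l' t x c
    rw [treeProd_succ_label, treeProd_succ_label]
    congr 1
    funext j c t x
    exact ih m (j :: l) l' t x c

theorem treeProd_succ (m : List ℕ → ℝ × ℝ × E d × ℝ) (k : ℕ) (t : ℝ) (x : E d) (c : Code d n) :
    S.treeProd ρ ρ' m (k + 1) [] t x c =
      S.step ρ ρ' (m []) t x c fun j c t x => S.treeProd ρ ρ' (subtree m j) k [] t x c := by
  rw [treeProd_succ_label]
  congr 1
  funext j c t x
  exact S.treeProd_append ρ ρ' k m [] [j] t x c

theorem step_congr_of_ne_zero {D : ℝ × ℝ × E d × ℝ} {t : ℝ} {x : E d} {c : Code d n}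
    {w w' : ℕ → Code d n → ℝ → E d → ℝ} (hw : ∀ j c t x, w j c t x ≠ 0 → w' j c t x = w j c t x)
    (h : S.step ρ ρ' D t x c w ≠ 0) : S.step ρ ρ' D t x c w' = S.step ρ ρ' D t x c w := by
  unfold step at h ⊢
  simp only at h ⊢
  split_ifs with h1 h2
  · rw [if_pos h1] at h
    congr 1
    exact Finset.prod_congr rfl fun j hj => hw _ _ _ _
      ((Finset.prod_ne_zero_iff.1 (right_ne_zero_of_mul h)) j hj)
  · rfl
  · rw [if_neg h1, if_neg h2] at h
    congr 1
    exact Finset.prod_congr rfl fun j hj => hw _ _ _ _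
      ((Finset.prod_ne_zero_iff.1 (right_ne_zero_of_mul h)) j hj)

/-- A nonzero truncated output means that every factor of the product is nonzero, so by induction no
child changes when one more generation is allowed. -/
theorem treeProd_stable (k : ℕ) : ∀ (m : List ℕ → ℝ × ℝ × E d × ℝ) (t : ℝ) (x : E d)
    (c : Code d n), S.treeProd ρ ρ' m k [] t x c ≠ 0 →
      S.treeProd ρ ρ' m (k + 1) [] t x c = S.treeProd ρ ρ' m k [] t x c := by
  induction k with
  | zero => intro m t x c h; exact absurd rfl h
  | succ k ih =>
    intro m t x c h
    rw [treeProd_succ] at h ⊢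
    rw [S.treeProd_succ ρ ρ' m k]
    exact S.step_congr_of_ne_zero ρ ρ' (fun j c t x => ih (subtree m j) t x c) h

/-- The truncated outputs are either zero for all `k` or eventually constant, so the limit defining
the functional exists for every choice of draws, including those for which the tree is infinite. -/
theorem tendsto_treeProd (m : List ℕ → ℝ × ℝ × E d × ℝ) (t : ℝ) (x : E d) (c : Code d n) :
    Tendsto (fun k => S.treeProd ρ ρ' m k [] t x c) atTop
      (𝓝 (S.treeFunctional ρ ρ' m t x c)) := by
  refine tendsto_nhds_limUnder ?_
  by_cases h : ∃ k, S.treeProd ρ ρ' m k [] t x c ≠ 0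
  · obtain ⟨k, hk⟩ := h
    refine ⟨S.treeProd ρ ρ' m k [] t x c, tendsto_const_nhds.congr' ?_⟩
    filter_upwards [eventually_ge_atTop k] with k' hk'
    induction k', hk' using Nat.le_induction with
    | base => rfl
    | succ k' _ ih => rw [S.treeProd_stable ρ ρ' k' m t x c (ih ▸ hk), ← ih]
  · push Not at h
    exact ⟨0, tendsto_const_nhds.congr fun k => (h k).symm⟩

theorem tendsto_step {D : ℝ × ℝ × E d × ℝ} {t : ℝ} {x : E d} {c : Code d n}
    {w : ℕ → ℕ → Code d n → ℝ → E d → ℝ} {w' : ℕ → Code d n → ℝ → E d → ℝ}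
    (hw : ∀ j c t x, Tendsto (fun k => w k j c t x) atTop (𝓝 (w' j c t x))) :
    Tendsto (fun k => S.step ρ ρ' D t x c (w k)) atTop (𝓝 (S.step ρ ρ' D t x c w')) := by
  unfold step
  simp only
  split_ifs
  · exact (tendsto_finsetProd _ fun j _ => hw _ _ _ _).const_mul _
  · exact tendsto_const_nhds
  · exact (tendsto_finsetProd _ fun j _ => hw _ _ _ _).const_mul _

/-- Self-similarity of the tree, pathwise: the recursion for the truncations passes to the limit
because a call involves only a finite product. -/
theorem treeFunctional_eq_step (m : List ℕ → ℝ × ℝ × E d × ℝ) (t : ℝ) (x : E d) (c : Code d n) :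
    S.treeFunctional ρ ρ' m t x c = S.step ρ ρ' (m []) t x c fun j c t x =>
      S.treeFunctional ρ ρ' (subtree m j) t x c := by
  refine tendsto_nhds_unique ((S.tendsto_treeProd ρ ρ' m t x c).comp (tendsto_add_atTop_nat 1)) ?_
  simp only [Function.comp_def, treeProd_succ]
  exact S.tendsto_step ρ ρ' fun j c t x => S.tendsto_treeProd ρ ρ' (subtree m j) t x c

variable {S ρ ρ'}

theorem choice_subset {c : Code d n} (hc : c ∈ S.codes) (q : ℕ) :
    ∀ z ∈ (S.mechanism c).getD q [], z ∈ S.codes := by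
  by_cases hq : q < (S.mechanism c).length
  · rw [List.getD_eq_getElem _ _ hq]
    exact mem_codes_of_mem_mechanism hc (List.getElem_mem hq)
  · rw [List.getD_eq_default _ _ (not_lt.1 hq)]
    simp

/-- The number and the codes of the children depend on the draw, but only through the integer `⌊r
U⌋`. For each fixed value the product is over a fixed list, and countably many values preserve
measurability. -/
theorem measurable_step {α : Type*} [MeasurableSpace α] (hρ : IsPositiveDensity ρ)
    (hρ' : IsPositiveDensity ρ') {c : Code d n} (hc : c ∈ S.codes)
    (hterm : ¬ c.IsPoisson → Measurable (S.terminalValue c))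
    {D : α → ℝ × ℝ × E d × ℝ} (hD : Measurable D) {t : α → ℝ} (ht : Measurable t) {x : α → E d}
    (hx : Measurable x) {w : α → ℕ → Code d n → ℝ → E d → ℝ}
    (hw : ∀ j, ∀ z ∈ S.codes, Measurable fun p : α × ℝ × E d => w p.1 j z p.2.1 p.2.2) :
    Measurable fun a => S.step ρ ρ' (D a) (t a) (x a) c (w a) := by
  have hρm := hρ.measurable
  have hρm' := hρ'.measurable
  have hprod : ∀ {s : α → ℝ} {y : α → E d}, Measurable s → Measurable y → Measurable fun a =>
      ∏ j : Fin (S.choice c (D a).2.2.2).length,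
        w a j (S.choice c (D a).2.2.2)[j] (s a) (y a) := by
    intro s y hs hy
    have h1 : Measurable fun p : ℕ × α =>
        ∏ j : Fin ((S.mechanism c).getD p.1 []).length,
          w p.2 j ((S.mechanism c).getD p.1 [])[j] (s p.2) (y p.2) := by
      refine measurable_from_prod_countable_right fun q => ?_
      have h0 : ∀ j : Fin ((S.mechanism c).getD q []).length, Measurable fun a =>
          w a j ((S.mechanism c).getD q [])[j] (s a) (y a) := fun j =>
        (hw j _ (choice_subset hc q _ (List.getElem_mem _))).comp
          (measurable_id.prodMk (hs.prodMk hy))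
      exact Finset.measurable_prod Finset.univ fun j _ => h0 j
    have h2 : Measurable fun a => (⌊((S.mechanism c).length : ℝ) * (D a).2.2.2⌋₊, a) :=
      (Nat.measurable_floor.comp (hD.snd.snd.snd.const_mul _)).prodMk measurable_id
    exact h1.comp h2
  unfold step
  simp only
  split_ifs with hP
  · have h1 := measurable_poissonN (d := d)
    have h2 : Measurable fun a => poissonN (√(D a).2.1 • (D a).2.2.1) *
        ((S.mechanism c).length : ℝ) / (2 * (D a).2.1 * ρ' (D a).2.1) := by fun_prop
    exact h2.mul (hprod ht (by fun_prop))
  · have h1 := hterm hP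
    have h2 := measurable_tail hρ
    have h3 : Measurable fun a => ((S.mechanism c).length : ℝ) / ρ (D a).1 := by fun_prop
    exact Measurable.ite (measurableSet_lt measurable_const (ht.add hD.fst)) (by fun_prop)
      (h3.mul (hprod (ht.add hD.fst) (by fun_prop)))

theorem measurable_treeProd (hρ : IsPositiveDensity ρ) (hρ' : IsPositiveDensity ρ')
    (hterm : ∀ c ∈ S.codes, ¬ c.IsPoisson → Measurable (S.terminalValue c)) (k : ℕ) :
    ∀ (l : List ℕ), ∀ c ∈ S.codes, Measurable fun p : (List ℕ → ℝ × ℝ × E d × ℝ) × ℝ × E d =>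
      S.treeProd ρ ρ' p.1 k l p.2.1 p.2.2 c := by
  induction k with
  | zero => intro l c _; exact measurable_const
  | succ k ih =>
    intro l c hc
    simp only [treeProd_succ_label]
    refine measurable_step hρ hρ' hc (hterm c hc) (by fun_prop) (by fun_prop) (by fun_prop)
      fun j z hz => ?_
    exact (ih (j :: l) z hz).comp ((measurable_fst.comp measurable_fst).prodMk measurable_snd)

theorem measurable_treeFunctional (hρ : IsPositiveDensity ρ) (hρ' : IsPositiveDensity ρ')
    (hterm : ∀ c ∈ S.codes, ¬ c.IsPoisson → Measurable (S.terminalValue c)) {c : Code d n}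
    (hc : c ∈ S.codes) : Measurable fun p : (List ℕ → ℝ × ℝ × E d × ℝ) × ℝ × E d =>
      S.treeFunctional ρ ρ' p.1 p.2.1 p.2.2 c :=
  measurable_of_tendsto_metrizable (fun k => measurable_treeProd hρ hρ' hterm k [] c hc)
    (tendsto_pi_nhds.2 fun p => S.tendsto_treeProd ρ ρ' p.1 p.2.1 p.2.2 c)

end PDESystem

/-! ### The law of the subtrees -/

section Graft

variable {X : Type*}

/-- The labelled family with the value `p.1` at the root and the families `p.2 j` below. -/
def graft (p : X × (ℕ × List ℕ → X)) (l : List ℕ) : X :=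
  if h : l = [] then p.1 else p.2 (l.getLast h, l.dropLast)

@[simp] theorem graft_nil (p : X × (ℕ × List ℕ → X)) : graft p [] = p.1 := by simp [graft]

@[simp] theorem graft_concat (p : X × (ℕ × List ℕ → X)) (l : List ℕ) (j : ℕ) :
    graft p (l ++ [j]) = p.2 (j, l) := by simp [graft]

variable [MeasurableSpace X]

theorem measurable_graft : Measurable (graft (X := X)) := by
  refine measurable_pi_lambda _ fun l => ?_
  unfold graft
  split_ifs <;> fun_prop

/-- A nonempty word is determined by its last letter, which names a child of the root, and by the
remaining prefix. A cylinder set over words is thus a condition at the root times a cylinder over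
the children, and both laws give it the same product of probabilities. -/
theorem map_graft (μ : Measure X) [IsProbabilityMeasure μ] :
    (μ.prod (Measure.infinitePi fun _ : ℕ × List ℕ => μ)).map graft =
      Measure.infinitePi fun _ : List ℕ => μ := by
  refine Measure.eq_infinitePi _ fun s t ht => ?_
  set ι : ℕ × List ℕ → List ℕ := fun p => p.2 ++ [p.1] with hι
  have hinj : Function.Injective ι := fun p q h => by
    have h1 := List.append_inj' h rfl
    exact Prod.ext (by simpa using h1.2) h1.1
  set s' : Finset (ℕ × List ℕ) := s.preimage ι hinj.injOn
  have hpre : graft ⁻¹' (Set.pi s t) =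
      (if [] ∈ s then t [] else univ) ×ˢ (Set.pi s' fun p => t (ι p)) := by
    ext p
    simp only [mem_preimage, Set.mem_pi, Finset.mem_coe, mem_prod, s', Finset.mem_preimage]
    constructor
    · intro h
      refine ⟨?_, fun q hq => by simpa [ι] using h _ hq⟩
      split_ifs with h0
      · simpa using h _ h0
      · trivial
    · rintro ⟨h0, h⟩ l hl
      rcases List.eq_nil_or_concat l with rfl | ⟨l, j, rfl⟩
      · rw [if_pos hl] at h0; simpa using h0
      · rw [List.concat_eq_append] at hl ⊢
        rw [graft_concat]
        exact h (j, l) hl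
  rw [Measure.map_apply measurable_graft (.pi s.countable_toSet fun _ _ => ht _), hpre,
    Measure.prod_prod, Measure.infinitePi_pi _ fun p _ => ht _]
  have h1 : ∏ p ∈ s', μ (t (ι p)) = ∏ l ∈ s.erase [], μ (t l) := by
    rw [← Finset.prod_preimage ι (s.erase []) hinj.injOn (fun l => μ (t l)) fun l hl hl' => ?_]
    · refine Finset.prod_congr ?_ fun _ _ => rfl
      ext p
      simp [s', ι]
    · rcases List.eq_nil_or_concat l with rfl | ⟨l, j, rfl⟩
      · simp at hl
      · exact absurd ⟨(j, l), by simp [ι]⟩ hl'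
  rw [h1]
  split_ifs with h0
  · exact Finset.mul_prod_erase s (fun l => μ (t l)) h0
  · rw [measure_univ, one_mul, Finset.erase_eq_of_notMem h0]

theorem map_graft_curry (μ : Measure X) [IsProbabilityMeasure μ] :
    (μ.prod (Measure.infinitePi fun _ : ℕ => Measure.infinitePi fun _ : List ℕ => μ)).map
      (fun p => graft (p.1, Function.uncurry p.2)) = Measure.infinitePi fun _ : List ℕ => μ := by
  have h := map_graft μ
  have e : μ.prod ((Measure.infinitePi fun _ : ℕ => Measure.infinitePi fun _ : List ℕ => μ).map
      (MeasurableEquiv.curry ℕ (List ℕ) X).symm) =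
      (μ.prod (Measure.infinitePi fun _ : ℕ => Measure.infinitePi fun _ : List ℕ => μ)).map
        (Prod.map id (MeasurableEquiv.curry ℕ (List ℕ) X).symm) := by
    rw [← Measure.map_prod_map _ _ measurable_id (MeasurableEquiv.measurable _), Measure.map_id]
  rw [← Measure.infinitePi_map_curry_symm fun (_ : ℕ) (_ : List ℕ) => μ, e,
    Measure.map_map measurable_graft (measurable_id.prodMap (MeasurableEquiv.measurable _))] at h
  exact h

/-- Independence of the subtrees of siblings. No integrability of the individual factors is
required, as the product formula for Bochner integrals holds without it. -/
theorem integral_prod_infinitePi {μ : Measure X} [IsProbabilityMeasure μ] {N : ℕ}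
    {h : Fin N → X → ℝ} (hh : ∀ j, Measurable (h j)) :
    ∫ F, ∏ j, h j (F j) ∂(Measure.infinitePi fun _ : ℕ => μ) = ∏ j, ∫ y, h j y ∂μ := by
  have h1 : (Measure.infinitePi fun _ : ℕ => μ).map (fun F (j : Fin N) => F j) =
      Measure.pi fun _ => μ := by
    rw [Measure.map_infinitePi_infinitePi_of_inj (P := fun _ : ℕ => μ) Fin.val_injective,
      Measure.infinitePi_eq_pi]
  have h2 : Measurable fun (F : ℕ → X) (j : Fin N) => F j :=
    measurable_pi_lambda _ fun j => measurable_pi_apply (j : ℕ)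
  rw [← integral_fintype_prod_eq_prod, ← h1, integral_map h2.aemeasurable]
  exact Measurable.aestronglyMeasurable
    (Finset.measurable_prod _ fun j _ => (hh j).comp (measurable_pi_apply j))

end Graft

/-! ### First-step analysis: the expectation is a fixed point of the averaged call. -/

namespace PDESystem

variable {S : PDESystem d n} {ρ ρ' : ℝ → ℝ}

/-- The expectation of the functional of the random tree. -/
def treeMean (S : PDESystem d n) (ρ ρ' : ℝ → ℝ) (Q : Measure (List ℕ → ℝ × ℝ × E d × ℝ))
    (c : Code d n) (t : ℝ) (x : E d) : ℝ :=
  ∫ m, S.treeFunctional ρ ρ' m t x c ∂Q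

theorem measurable_treeFunctional_draws (hρ : IsPositiveDensity ρ) (hρ' : IsPositiveDensity ρ')
    (hterm : ∀ c ∈ S.codes, ¬ c.IsPoisson → Measurable (S.terminalValue c)) {c : Code d n}
    (hc : c ∈ S.codes) (t : ℝ) (x : E d) :
    Measurable fun m : List ℕ → ℝ × ℝ × E d × ℝ => S.treeFunctional ρ ρ' m t x c := by
  have h1 : Measurable fun m : List ℕ → ℝ × ℝ × E d × ℝ => (m, t, x) :=
    measurable_id.prodMk measurable_const
  have h2 := (measurable_treeFunctional hρ hρ' hterm hc).comp h1
  exact h2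

theorem integral_step (hρ : IsPositiveDensity ρ) (hρ' : IsPositiveDensity ρ')
    (hterm : ∀ c ∈ S.codes, ¬ c.IsPoisson → Measurable (S.terminalValue c))
    (Q : Measure (List ℕ → ℝ × ℝ × E d × ℝ)) [IsProbabilityMeasure Q] {c : Code d n}
    (hc : c ∈ S.codes) (D : ℝ × ℝ × E d × ℝ) (t : ℝ) (x : E d) :
    ∫ F, S.step ρ ρ' D t x c (fun j c t x => S.treeFunctional ρ ρ' (F j) t x c)
      ∂(Measure.infinitePi fun _ : ℕ => Q) =
    S.step ρ ρ' D t x c fun _ => S.treeMean ρ ρ' Q := by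
  have hm : ∀ t x, ∀ z ∈ S.codes,
      Measurable fun m : List ℕ → ℝ × ℝ × E d × ℝ => S.treeFunctional ρ ρ' m t x z :=
    fun t x z hz => measurable_treeFunctional_draws hρ hρ' hterm hz t x
  have hZ : ∀ j : Fin (S.choice c D.2.2.2).length, (S.choice c D.2.2.2)[j] ∈ S.codes :=
    fun j => choice_subset hc _ _ (List.getElem_mem _)
  unfold step
  simp only
  split_ifs
  · rw [integral_const_mul, integral_prod_infinitePi fun j => hm _ _ _ (hZ j)]; rfl
  · simp
  · rw [integral_const_mul, integral_prod_infinitePi fun j => hm _ _ _ (hZ j)]; rfl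

/-- The draws are regrouped as the root draw and independent families for the children. Fubini
integrates out the children first, replacing each subtree by its mean; it also gives integrability
of the remaining function of the root draw. -/
theorem treeMean_eq (hρ : IsPositiveDensity ρ) (hρ' : IsPositiveDensity ρ')
    (hterm : ∀ c ∈ S.codes, ¬ c.IsPoisson → Measurable (S.terminalValue c))
    {Q : Measure (List ℕ → ℝ × ℝ × E d × ℝ)}
    (hQ : Q = Measure.infinitePi fun _ => drawLaw d ρ ρ') {c : Code d n} (hc : c ∈ S.codes)
    {t : ℝ} {x : E d} (hi : Integrable (fun m => S.treeFunctional ρ ρ' m t x c) Q) :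
    Integrable (fun D => S.step ρ ρ' D t x c fun _ => S.treeMean ρ ρ' Q) (drawLaw d ρ ρ') ∧
    S.treeMean ρ ρ' Q c t x =
      ∫ D, S.step ρ ρ' D t x c (fun _ => S.treeMean ρ ρ' Q) ∂(drawLaw d ρ ρ') := by
  have := isProbabilityMeasure_drawLaw (d := d) hρ hρ'
  have hQp : IsProbabilityMeasure Q := by rw [hQ]; infer_instance
  have hm := measurable_treeFunctional_draws hρ hρ' hterm hc t x
  have hmap : ((drawLaw d ρ ρ').prod (Measure.infinitePi fun _ : ℕ => Q)).map
      (fun p => graft (p.1, Function.uncurry p.2)) = Q := by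
    subst hQ; exact map_graft_curry _
  have hΨ : Measurable fun p : (ℝ × ℝ × E d × ℝ) × (ℕ → List ℕ → ℝ × ℝ × E d × ℝ) =>
      graft (p.1, Function.uncurry p.2) := by
    refine measurable_graft.comp (measurable_fst.prodMk (measurable_pi_lambda _ fun q => ?_))
    exact (measurable_pi_apply q.2).comp ((measurable_pi_apply q.1).comp measurable_snd)
  have hstep : ∀ p : (ℝ × ℝ × E d × ℝ) × (ℕ → List ℕ → ℝ × ℝ × E d × ℝ),
      S.treeFunctional ρ ρ' (graft (p.1, Function.uncurry p.2)) t x c =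
      S.step ρ ρ' p.1 t x c fun j c t x => S.treeFunctional ρ ρ' (p.2 j) t x c := by
    intro p
    rw [treeFunctional_eq_step, graft_nil]
    congr 1
    funext j c t x
    congr 1
    funext l
    simp [subtree, Function.uncurry]
  rw [← hmap, integrable_map_measure hm.aestronglyMeasurable hΨ.aemeasurable] at hi
  simp only [Function.comp_def, hstep] at hi
  have h1 := hi.integral_prod_left
  simp only [integral_step hρ hρ' hterm Q hc] at h1
  refine ⟨h1, ?_⟩
  rw [treeMean]
  conv_lhs => rw [← hmap]
  rw [integral_map hΨ.aemeasurable hm.aestronglyMeasurable]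
  simp only [hstep]
  rw [integral_prod _ hi]
  simp only [integral_step hρ hρ' hterm Q hc]

end PDESystem

/-! ### Integration of the draws of one call -/

theorem floor_mul_eq {r q : ℕ} {y : ℝ} (hr : 0 < r)
    (hy : y ∈ Ioo ((q : ℝ) / r) (((q + 1 : ℕ) : ℝ) / r)) : ⌊(r : ℝ) * y⌋₊ = q := by
  have hr' : (0 : ℝ) < r := Nat.cast_pos.2 hr
  have h1 := (div_lt_iff₀ hr').1 hy.1
  have h2 := (lt_div_iff₀ hr').1 hy.2
  push_cast at h2
  rw [Nat.floor_eq_iff (by nlinarith [Nat.cast_nonneg (α := ℝ) q])]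
  constructor <;> linarith

theorem cell_lt {r : ℕ} (hr : 0 < r) (q : ℕ) : (q : ℝ) / r < ((q + 1 : ℕ) : ℝ) / r := by
  have hr' : (0 : ℝ) < r := Nat.cast_pos.2 hr
  gcongr
  exact Nat.lt_succ_self q

theorem cell_subset {r q : ℕ} (hq : q < r) :
    Ioo ((q : ℝ) / r) (((q + 1 : ℕ) : ℝ) / r) ⊆ Icc 0 1 := by
  have hr' : (0 : ℝ) < r := Nat.cast_pos.2 (by omega)
  refine Ioo_subset_Icc_self.trans (Icc_subset_Icc (by positivity) ?_)
  rw [div_le_one hr']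
  exact_mod_cast hq

theorem integral_floor {r : ℕ} (hr : 0 < r) (g : ℕ → ℝ) :
    ∫ y in Icc (0 : ℝ) 1, g ⌊(r : ℝ) * y⌋₊ = ∑ q ∈ Finset.range r, (r : ℝ)⁻¹ * g q := by
  have hr' : (0 : ℝ) < r := Nat.cast_pos.2 hr
  have h1 := intervalIntegral.sum_integral_adjacent_intervals (μ := volume) (n := r)
    (f := fun y => g ⌊(r : ℝ) * y⌋₊) (a := fun q : ℕ => (q : ℝ) / r) fun q _ => by
      rw [intervalIntegrable_iff_integrableOn_Ioo_of_le (cell_lt hr q).le]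
      exact (integrableOn_const (C := g q) (by simp)).congr_fun
        (fun y hy => by rw [floor_mul_eq hr hy]) measurableSet_Ioo
  simp only [Nat.cast_zero, zero_div, div_self hr'.ne'] at h1
  rw [integral_Icc_eq_integral_Ioc, ← intervalIntegral.integral_of_le zero_le_one, ← h1]
  refine Finset.sum_congr rfl fun q _ => ?_
  rw [intervalIntegral.integral_of_le (cell_lt hr q).le, integral_Ioc_eq_integral_Ioo,
    setIntegral_congr_fun measurableSet_Ioo fun y hy => by rw [floor_mul_eq hr hy],
    setIntegral_const, Real.volume_real_Ioo_of_le (cell_lt hr q).le, smul_eq_mul]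
  push_cast
  congr 1
  field_simp
  ring

/-- Integration of a uniform choice among `r` possibilities. -/
theorem uniform_choice {α : Type*} [MeasurableSpace α] {μ : Measure α} [SFinite μ]
    {f : α → ℕ → ℝ} {r : ℕ} (hr : 0 < r)
    (h : Integrable (fun p : α × ℝ => f p.1 ⌊(r : ℝ) * p.2⌋₊)
      (μ.prod (volume.restrict (Icc (0 : ℝ) 1)))) :
    (∀ q < r, Integrable (fun a => f a q) μ) ∧
    ∫ p, f p.1 ⌊(r : ℝ) * p.2⌋₊ ∂(μ.prod (volume.restrict (Icc (0 : ℝ) 1))) =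
      ∑ q ∈ Finset.range r, (r : ℝ)⁻¹ * ∫ a, f a q ∂μ := by
  refine ⟨fun q hq => ?_, ?_⟩
  · have h1 := h.prod_left_ae
    have h2 : ∀ᵐ y ∂(volume.restrict (Ioo ((q : ℝ) / r) (((q + 1 : ℕ) : ℝ) / r))),
        Integrable (fun a => f a ⌊(r : ℝ) * y⌋₊) μ :=
      ae_mono (Measure.restrict_mono (cell_subset hq) le_rfl) h1
    -- The cell on which the choice equals `q` has positive length, so it contains a point at which
    -- the slice is integrable.
    have h3 : (ae (volume.restrict (Ioo ((q : ℝ) / r) (((q + 1 : ℕ) : ℝ) / r)))).NeBot := by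
      rw [ae_restrict_neBot, Real.volume_Ioo]
      simpa using cell_lt hr q
    obtain ⟨y, hy1, hy2⟩ := (h2.and (ae_restrict_mem measurableSet_Ioo)).exists
    simpa only [floor_mul_eq hr hy2] using hy1
  · rw [integral_prod_symm _ h]
    exact integral_floor hr fun q => ∫ a, f a q ∂μ

theorem measurable_uniform_choice {α : Type*} [MeasurableSpace α] {f : α → ℕ → ℝ}
    (hf : ∀ q, Measurable fun a => f a q) (r : ℕ) :
    Measurable fun p : α × ℝ => f p.1 ⌊(r : ℝ) * p.2⌋₊ := by
  have h1 : Measurable fun p : ℕ × α => f p.2 p.1 := measurable_from_prod_countable_right hf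
  have h2 : Measurable fun p : α × ℝ => (⌊(r : ℝ) * p.2⌋₊, p.1) :=
    (Nat.measurable_floor.comp (measurable_snd.const_mul _)).prodMk measurable_fst
  exact h1.comp h2

/-- Importance weights cancel the density, because under this measure almost every time is positive
and `ρ` is positive there. -/
theorem density_cancel {α : Type*} [MeasurableSpace α] {γ : Measure α} [SFinite γ] {ρ : ℝ → ℝ}
    (hρ : IsPositiveDensity ρ) (A : Set ℝ) (F : ℝ × α → ℝ) :
    (fun p : ℝ × α => (ENNReal.ofReal (ρ p.1)).toReal •
      (A.indicator (fun s => (ρ s)⁻¹) p.1 * F p)) =ᵐ[(volume.restrict (Ioi 0)).prod γ]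
      (A ×ˢ univ).indicator F := by
  have h : ∀ᵐ p : ℝ × α ∂((volume.restrict (Ioi (0 : ℝ))).prod γ), 0 < p.1 :=
    Measure.quasiMeasurePreserving_fst.ae (p := fun s : ℝ => 0 < s)
      (ae_restrict_mem measurableSet_Ioi)
  filter_upwards [h] with p hp
  have hpos := hρ.pos p.1 hp
  by_cases hA : p.1 ∈ A
  · rw [indicator_of_mem hA, indicator_of_mem (by exact ⟨hA, mem_univ _⟩),
      ENNReal.toReal_ofReal hpos.le, smul_eq_mul]
    field_simp
  · rw [indicator_of_notMem hA, indicator_of_notMem fun h => hA h.1]; simp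

theorem densityLaw_prod {α : Type*} [MeasurableSpace α] {γ : Measure α} [SFinite γ] {ρ : ℝ → ℝ}
    (hρ : IsPositiveDensity ρ) : (densityLaw ρ).prod γ =
      ((volume.restrict (Ioi 0)).prod γ).withDensity fun p => ENNReal.ofReal (ρ p.1) := by
  rw [densityLaw, prod_withDensity_left hρ.measurable.ennreal_ofReal]

theorem restrict_prod_indicator {α : Type*} [MeasurableSpace α] (γ : Measure α) [SFinite γ]
    {A : Set ℝ} (hA : MeasurableSet A) :
    ((volume.restrict (Ioi 0)).prod γ).restrict (A ×ˢ univ) =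
      (volume.restrict (A ∩ Ioi 0)).prod γ := by
  rw [← Measure.prod_restrict, Measure.restrict_univ, Measure.restrict_restrict hA]

theorem integrable_densityLaw_iff {α : Type*} [MeasurableSpace α] {γ : Measure α} [SFinite γ]
    {ρ : ℝ → ℝ} (hρ : IsPositiveDensity ρ) {A : Set ℝ} (hA : MeasurableSet A) {F : ℝ × α → ℝ} :
    Integrable (fun p => A.indicator (fun s => (ρ s)⁻¹) p.1 * F p) ((densityLaw ρ).prod γ) ↔
      Integrable F ((volume.restrict (A ∩ Ioi 0)).prod γ) := by
  have hρm := hρ.measurable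
  rw [densityLaw_prod hρ, integrable_withDensity_iff_integrable_smul' (by fun_prop)
    (Eventually.of_forall fun _ => ENNReal.ofReal_lt_top), integrable_congr (density_cancel hρ A F),
    integrable_indicator_iff (hA.prod MeasurableSet.univ), IntegrableOn,
    restrict_prod_indicator γ hA]

theorem integral_densityLaw {α : Type*} [MeasurableSpace α] {γ : Measure α} [SFinite γ]
    {ρ : ℝ → ℝ} (hρ : IsPositiveDensity ρ) {A : Set ℝ} (hA : MeasurableSet A) (F : ℝ × α → ℝ) :
    ∫ p, A.indicator (fun s => (ρ s)⁻¹) p.1 * F p ∂((densityLaw ρ).prod γ) =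
      ∫ p, F p ∂((volume.restrict (A ∩ Ioi 0)).prod γ) := by
  have hρm := hρ.measurable
  rw [densityLaw_prod hρ, integral_withDensity_eq_integral_toReal_smul (by fun_prop)
    (Eventually.of_forall fun _ => ENNReal.ofReal_lt_top), integral_congr_ae (density_cancel hρ A F),
    integral_indicator (hA.prod MeasurableSet.univ), restrict_prod_indicator γ hA]

theorem integrable_gaussian_prod {s2 : ℝ} (hs2 : 0 < s2) {I : Set ℝ} (hI : MeasurableSet I)
    (hI0 : I ⊆ Ioi 0) (x : E d) {F : ℝ × E d → ℝ} (hF : Measurable F)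
    (h : Integrable (fun p : ℝ × E d => F (p.1, x + √(s2 * p.1) • p.2))
      ((volume.restrict I).prod (stdGaussian (E d)))) :
    Integrable (fun p : ℝ × E d => heatKernel s2 p.1 (p.2 - x) * F p)
      ((volume.restrict I).prod volume) := by
  have hm : AEStronglyMeasurable (fun p : ℝ × E d => heatKernel s2 p.1 (p.2 - x) * F p)
      ((volume.restrict I).prod volume) := by
    unfold heatKernel
    exact Measurable.aestronglyMeasurable (by fun_prop)
  have hpos : ∀ s ∈ I, 0 < s2 * s := fun s hs => mul_pos hs2 (hI0 hs)
  rw [integrable_prod_iff hm]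
  have h1 := h.prod_right_ae
  have h2 := h.norm.integral_prod_left
  constructor
  · filter_upwards [h1, ae_restrict_mem hI] with s hs hsI
    exact (integrable_gaussian_shift_iff (hpos s hsI) x).1 hs
  · refine h2.congr ?_
    filter_upwards [ae_restrict_mem hI] with s hsI
    rw [integral_gaussian_shift (hpos s hsI) x fun y => ‖F (s, y)‖]
    congr 1
    funext y
    rw [norm_mul, Real.norm_of_nonneg (heatKernel_nonneg (hpos s hsI).le _)]

theorem integral_gaussian_prod {s2 : ℝ} (hs2 : 0 < s2) {I : Set ℝ} (hI : MeasurableSet I)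
    (hI0 : I ⊆ Ioi 0) (x : E d) {F : ℝ × E d → ℝ}
    (h : Integrable (fun p : ℝ × E d => F (p.1, x + √(s2 * p.1) • p.2))
      ((volume.restrict I).prod (stdGaussian (E d)))) :
    ∫ p, F (p.1, x + √(s2 * p.1) • p.2) ∂((volume.restrict I).prod (stdGaussian (E d))) =
      ∫ s in I, ∫ y, heatKernel s2 s (y - x) * F (s, y) := by
  rw [integral_prod _ h]
  exact setIntegral_congr_fun hI fun s hs =>
    integral_gaussian_shift (mul_pos hs2 (hI0 hs)) x fun y => F (s, y)

theorem measurePreserving_poissonDraw {ρ ρ' : ℝ → ℝ} (hρ : IsPositiveDensity ρ) :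
    MeasurePreserving (fun D : ℝ × ℝ × E d × ℝ => ((D.2.1, D.2.2.1), D.2.2.2)) (drawLaw d ρ ρ')
      (((densityLaw ρ').prod (stdGaussian (E d))).prod (volume.restrict (Icc (0 : ℝ) 1))) := by
  have := isProbabilityMeasure_densityLaw hρ
  exact (measurePreserving_prodAssoc _ _ _).symm.comp measurePreserving_snd

theorem measurePreserving_heatDraw {ρ ρ' : ℝ → ℝ} (hρ' : IsPositiveDensity ρ') :
    MeasurePreserving (fun D : ℝ × ℝ × E d × ℝ => ((D.1, D.2.2.1), D.2.2.2)) (drawLaw d ρ ρ')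
      (((densityLaw ρ).prod (stdGaussian (E d))).prod (volume.restrict (Icc (0 : ℝ) 1))) := by
  have := isProbabilityMeasure_densityLaw hρ'
  have h1 : MeasurePreserving (Prod.map id Prod.snd : ℝ × ℝ × E d × ℝ → ℝ × E d × ℝ)
      (drawLaw d ρ ρ') ((densityLaw ρ).prod
        ((stdGaussian (E d)).prod (volume.restrict (Icc (0 : ℝ) 1)))) :=
    (MeasurePreserving.id _).prod measurePreserving_snd
  exact (measurePreserving_prodAssoc _ _ _).symm.comp h1

theorem densityLaw_Ioi_pos {ρ : ℝ → ℝ} (hρ : IsPositiveDensity ρ) {s : ℝ} (hs : 0 ≤ s) :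
    0 < tail ρ s := by
  have := isProbabilityMeasure_densityLaw hρ
  rw [tail, measureReal_def, ENNReal.toReal_pos_iff]
  refine ⟨pos_iff_ne_zero.2 fun h => ?_, measure_lt_top _ _⟩
  rw [densityLaw, withDensity_apply_eq_zero hρ.measurable.ennreal_ofReal] at h
  have h1 : {x | ENNReal.ofReal (ρ x) ≠ 0} ∩ Ioi s = Ioi s := by
    refine inter_eq_right.2 fun y hy => ?_
    simpa using hρ.pos y (hs.trans_lt hy)
  rw [h1, Measure.restrict_apply measurableSet_Ioi, inter_eq_left.2 (Ioi_subset_Ioi hs)] at h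
  simp at h

theorem tail_zero {ρ : ℝ → ℝ} (hρ : IsPositiveDensity ρ) : tail ρ 0 = 1 := by
  rw [tail, measureReal_def, densityLaw, withDensity_apply _ measurableSet_Ioi,
    Measure.restrict_restrict measurableSet_Ioi, inter_self, hρ.lintegral_eq_one,
    ENNReal.toReal_one]

theorem ae_pos_densityLaw (ρ : ℝ → ℝ) : ∀ᵐ s ∂(densityLaw ρ), 0 < s :=
  (withDensity_absolutelyContinuous _ _).ae_le (ae_restrict_mem measurableSet_Ioi)

theorem integral_comp_measurePreserving {α β : Type*} [MeasurableSpace α] [MeasurableSpace β]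
    {μ : Measure α} {κ : Measure β} {f : α → β} (hf : MeasurePreserving f μ κ) {g : β → ℝ}
    (hg : AEStronglyMeasurable g κ) : ∫ a, (g ∘ f) a ∂μ = ∫ b, g b ∂κ := by
  rw [← hf.map_eq, integral_map hf.aemeasurable (by rwa [hf.map_eq])]
  rfl

/-! ### The mean of one call of the algorithm is one step of the integral system. -/

namespace PDESystem

variable {S : PDESystem d n} {ρ ρ' : ℝ → ℝ} {v : Code d n → ℝ → E d → ℝ}

theorem prod_choice (v : Code d n → ℝ → E d → ℝ) (Z : List (Code d n)) (t : ℝ) (x : E d) :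
    ∏ j : Fin Z.length, v Z[j] t x = codeProd v Z t x :=
  Fin.prod_univ_fun_getElem Z fun z => v z t x

/-- The weight `1/ρ'` is isolated, with a trivial indicator, to match the form in which the density
cancels. -/
theorem step_poisson {c : Code d n} (hP : c.IsPoisson) (D : ℝ × ℝ × E d × ℝ) (t : ℝ) (x : E d) :
    S.step ρ ρ' D t x c (fun _ => v) =
      univ.indicator (fun s => (ρ' s)⁻¹) D.2.1 *
        (poissonN (√D.2.1 • D.2.2.1) * (S.mechanism c).length / (2 * D.2.1) *
          codeProd v (S.choice c D.2.2.2) t (x + √D.2.1 • D.2.2.1)) := by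
  simp only [step, if_pos hP, prod_choice, indicator_univ]
  rw [← div_div, div_eq_mul_inv _ (ρ' _)]
  ring

theorem step_heat {c : Code d n} (hP : ¬ c.IsPoisson) (D : ℝ × ℝ × E d × ℝ) (t : ℝ) (x : E d) :
    S.step ρ ρ' D t x c (fun _ => v) =
      (Ioi (S.T - t)).indicator (fun _ => (tail ρ (S.T - t))⁻¹) D.1 *
        S.terminalValue c (x + √(2 * S.ν * (S.T - t)) • D.2.2.1) +
      (Iic (S.T - t)).indicator (fun s => (ρ s)⁻¹) D.1 * ((S.mechanism c).length *
        codeProd v (S.choice c D.2.2.2) (t + D.1) (x + √(2 * S.ν * D.1) • D.2.2.1)) := by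
  simp only [step, if_neg hP, prod_choice]
  by_cases h : S.T < t + D.1
  · have h1 : S.T - t < D.1 := by linarith
    rw [if_pos h, indicator_of_mem (mem_Ioi.2 h1),
      indicator_of_notMem (show D.1 ∉ Iic (S.T - t) from not_le.2 h1)]
    ring
  · have h1 : D.1 ≤ S.T - t := by linarith [not_lt.1 h]
    rw [if_neg h, indicator_of_notMem (show D.1 ∉ Ioi (S.T - t) from not_lt.2 h1),
      indicator_of_mem (mem_Iic.2 h1)]
    ring

theorem sum_mechanism (L : List (List (Code d n))) (g : List (Code d n) → ℝ) :
    ∑ q ∈ Finset.range L.length, g (L.getD q []) = (L.map g).sum := by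
  rw [Finset.sum_range, ← Fin.sum_univ_fun_getElem L g]
  exact Finset.sum_congr rfl fun q _ => by rw [List.getD_eq_getElem _ _ q.2]

theorem measurable_codeProd (hv : ∀ z ∈ S.codes, Measurable fun p : ℝ × E d => v z p.1 p.2)
    {Z : List (Code d n)} (hZ : ∀ z ∈ Z, z ∈ S.codes) :
    Measurable fun p : ℝ × E d => codeProd v Z p.1 p.2 := by
  induction Z with
  | nil => exact measurable_const
  | cons z Z ih =>
    simp only [codeProd_cons]
    exact (hv z (hZ z List.mem_cons_self)).mul (ih fun z hz => hZ z (List.mem_cons_of_mem _ hz))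

/-- Unwrapping the mean of one call for a code governed by a Poisson equation. -/
theorem poisson_of_step (hρ : IsPositiveDensity ρ) (hρ' : IsPositiveDensity ρ')
    (hv : ∀ z ∈ S.codes, Measurable fun p : ℝ × E d => v z p.1 p.2) {c : Code d n}
    (hc : c ∈ S.codes) (hP : c.IsPoisson) {t : ℝ} {x : E d}
    (hi : Integrable (fun D => S.step ρ ρ' D t x c fun _ => v) (drawLaw d ρ ρ')) :
    (∀ Z ∈ S.mechanism c,
      Integrable (fun p : ℝ × E d => heatKernel 1 p.1 p.2 * (poissonN p.2 / (2 * p.1)) *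
        codeProd v Z t (x + p.2)) ((volume.restrict (Ioi 0)).prod volume)) ∧
    ∫ D, S.step ρ ρ' D t x c (fun _ => v) ∂(drawLaw d ρ ρ') =
      ((S.mechanism c).map fun Z => ∫ s in Ioi (0 : ℝ), ∫ y : E d,
        heatKernel 1 s y * (poissonN y / (2 * s)) * codeProd v Z t (x + y)).sum := by
  set r := (S.mechanism c).length with hr
  -- With an empty mechanism the factor `r` makes the call vanish, in agreement with the empty sum;
  -- below, `1/r` is meaningful.
  rcases Nat.eq_zero_or_pos r with h0 | h0
  · have hnil : S.mechanism c = [] := List.length_eq_zero_iff.1 h0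
    simp [step_poisson hP, hnil]
  have hr0 : (r : ℝ) ≠ 0 := Nat.cast_ne_zero.2 h0.ne'
  -- `F` is written in the displacement `W = √τ' ξ` itself, not in its end point: the weight `N(W)`
  -- depends on it. The Gaussian substitution is therefore used with centre 0 and `s2 = 1`.
  set F : ℕ → ℝ × E d → ℝ := fun q p => poissonN p.2 * r / (2 * p.1) *
    codeProd v ((S.mechanism c).getD q []) t (x + p.2) with hF
  have hcp : ∀ q, Measurable fun p : ℝ × E d => codeProd v ((S.mechanism c).getD q []) p.1 p.2 :=
    fun q => measurable_codeProd hv (choice_subset hc q)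
  have hFm : ∀ q, Measurable (F q) := fun q => by
    have h1 : Measurable fun p : ℝ × E d => (t, x + p.2) := by fun_prop
    have h2 := (hcp q).comp h1
    have h3 := measurable_poissonN (d := d)
    have h4 : Measurable fun p : ℝ × E d => poissonN p.2 * (r : ℝ) / (2 * p.1) := by fun_prop
    exact h4.mul h2
  set f : ℝ × E d → ℕ → ℝ := fun p q => univ.indicator (fun s => (ρ' s)⁻¹) p.1 *
    F q (p.1, 0 + √(1 * p.1) • p.2) with hf
  have hρm := hρ'.measurable
  have hfm : ∀ q, Measurable fun p => f p q := fun q => by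
    have h1 : Measurable fun p : ℝ × E d => (p.1, 0 + √(1 * p.1) • p.2) := by fun_prop
    simp only [hf, indicator_univ]
    exact Measurable.mul (by fun_prop) ((hFm q).comp h1)
  have hmp := measurePreserving_poissonDraw (d := d) (ρ' := ρ') hρ
  have hstep : (fun D => S.step ρ ρ' D t x c fun _ => v) =
      (fun p : (ℝ × E d) × ℝ => f p.1 ⌊(r : ℝ) * p.2⌋₊) ∘ fun D => ((D.2.1, D.2.2.1), D.2.2.2) := by
    funext D
    rw [step_poisson hP]
    simp only [hf, hF, Function.comp_apply, zero_add, one_mul]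
    rfl
  have hgm := (measurable_uniform_choice hfm r).aestronglyMeasurable
    (μ := ((densityLaw ρ').prod (stdGaussian (E d))).prod (volume.restrict (Icc (0 : ℝ) 1)))
  rw [hstep, hmp.integrable_comp hgm] at hi
  obtain ⟨h1, h2⟩ := uniform_choice h0 hi
  simp only [hf] at h1 h2
  have h3 : ∀ q < r, Integrable (fun p : ℝ × E d => F q (p.1, 0 + √(1 * p.1) • p.2))
      ((volume.restrict (Ioi 0)).prod (stdGaussian (E d))) := fun q hq => by
    have := (integrable_densityLaw_iff hρ' MeasurableSet.univ).1 (h1 q hq)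
    rwa [univ_inter] at this
  have hFe : ∀ q (s : ℝ) (y : E d), heatKernel 1 s (y - 0) * F q (s, y) =
      r * (heatKernel 1 s y * (poissonN y / (2 * s)) *
        codeProd v ((S.mechanism c).getD q []) t (x + y)) := fun q s y => by
    simp only [hF, sub_zero]
    ring
  constructor
  · intro Z hZ
    obtain ⟨q, hq, rfl⟩ := List.getElem_of_mem hZ
    have h4 := integrable_gaussian_prod one_pos measurableSet_Ioi le_rfl 0 (hFm q) (h3 q hq)
    have h5 : ∀ p : ℝ × E d, heatKernel 1 p.1 (p.2 - 0) * F q p = _ := fun p => hFe q p.1 p.2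
    simp only [h5] at h4
    have h6 := h4.const_mul (r : ℝ)⁻¹
    simp only [inv_mul_cancel_left₀ hr0] at h6
    rwa [List.getD_eq_getElem _ _ hq] at h6
  · rw [hstep, integral_comp_measurePreserving hmp hgm, h2, ← sum_mechanism]
    refine Finset.sum_congr rfl fun q hq => ?_
    rw [integral_densityLaw hρ' MeasurableSet.univ, univ_inter,
      integral_gaussian_prod one_pos measurableSet_Ioi le_rfl 0 (h3 q (Finset.mem_range.1 hq))]
    simp only [hFe, integral_const_mul]
    rw [inv_mul_cancel_left₀ hr0]

theorem measurePreserving_sub_Ioc (t T : ℝ) : MeasurePreserving (fun s => s - t)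
    (volume.restrict (Ioc t T)) (volume.restrict (Ioc 0 (T - t))) := by
  have h := (measurePreserving_sub_right volume t).restrict_preimage
    (measurableSet_Ioc (a := 0) (b := T - t))
  simpa using h

/-- The part of a call in which the horizon is reached. -/
theorem terminal_part (hρ : IsPositiveDensity ρ) {t : ℝ}
    (htT : t ≤ S.T) {g : E d → ℝ} (hg : Integrable g (stdGaussian (E d))) :
    Integrable (fun p : (ℝ × E d) × ℝ =>
      (Ioi (S.T - t)).indicator (fun _ => (tail ρ (S.T - t))⁻¹) p.1.1 * g p.1.2)
      (((densityLaw ρ).prod (stdGaussian (E d))).prod (volume.restrict (Icc (0 : ℝ) 1))) ∧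
    ∫ p : (ℝ × E d) × ℝ,
      (Ioi (S.T - t)).indicator (fun _ => (tail ρ (S.T - t))⁻¹) p.1.1 * g p.1.2
      ∂(((densityLaw ρ).prod (stdGaussian (E d))).prod (volume.restrict (Icc (0 : ℝ) 1))) =
      ∫ ξ, g ξ ∂(stdGaussian (E d)) := by
  have := isProbabilityMeasure_densityLaw hρ
  have := isProbabilityMeasure_uniform
  have hpos := densityLaw_Ioi_pos hρ (sub_nonneg.2 htT)
  have h1 : Integrable ((Ioi (S.T - t)).indicator (fun _ => (tail ρ (S.T - t))⁻¹))
      (densityLaw ρ) := (integrable_const _).indicator measurableSet_Ioi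
  refine ⟨(h1.mul_prod hg).comp_fst _, ?_⟩
  rw [integral_fun_fst (μ := (densityLaw ρ).prod (stdGaussian (E d))) (fun q : ℝ × E d =>
      (Ioi (S.T - t)).indicator (fun _ => (tail ρ (S.T - t))⁻¹) q.1 * g q.2),
    integral_prod_mul, integral_indicator_const _ measurableSet_Ioi]
  have h2 : (densityLaw ρ).real (Ioi (S.T - t)) = tail ρ (S.T - t) := rfl
  simp only [smul_eq_mul]
  rw [h2, mul_inv_cancel₀ hpos.ne']
  simp

/-- Unwrapping the mean of one call for a code that is not governed by a Poisson equation. -/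
theorem heat_of_step (hρ : IsPositiveDensity ρ) (hρ' : IsPositiveDensity ρ')
    (hv : ∀ z ∈ S.codes, Measurable fun p : ℝ × E d => v z p.1 p.2) {c : Code d n}
    (hc : c ∈ S.codes) (hP : ¬ c.IsPoisson) {t : ℝ} (ht : t ∈ Ico 0 S.T) {x : E d}
    (htermi : Integrable (fun ξ => S.terminalValue c (x + √(2 * S.ν * (S.T - t)) • ξ))
      (stdGaussian (E d)))
    (hi : Integrable (fun D => S.step ρ ρ' D t x c fun _ => v) (drawLaw d ρ ρ')) :
    (∀ Z ∈ S.mechanism c,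
      Integrable (fun p : ℝ × E d => heatKernel (2 * S.ν) (p.1 - t) (p.2 - x) *
        codeProd v Z p.1 p.2) ((volume.restrict (Ioc t S.T)).prod volume)) ∧
    ∫ D, S.step ρ ρ' D t x c (fun _ => v) ∂(drawLaw d ρ ρ') =
      (∫ y : E d, heatKernel (2 * S.ν) (S.T - t) (y - x) * S.terminalValue c y) +
      ((S.mechanism c).map fun Z => ∫ s in Ioc t S.T, ∫ y : E d,
        heatKernel (2 * S.ν) (s - t) (y - x) * codeProd v Z s y).sum := by
  set r := (S.mechanism c).length with hr
  have hν : 0 < 2 * S.ν := by linarith [S.ν_pos]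
  have hpos : 0 < 2 * S.ν * (S.T - t) := mul_pos hν (sub_pos.2 ht.2)
  have hρm := hρ.measurable
  set I : Set ℝ := Iic (S.T - t) ∩ Ioi 0 with hI
  have hIe : I = Ioc 0 (S.T - t) := by rw [hI, inter_comm]; rfl
  have hIm : MeasurableSet I := measurableSet_Iic.inter measurableSet_Ioi
  set μ := ((densityLaw ρ).prod (stdGaussian (E d))).prod (volume.restrict (Icc (0 : ℝ) 1)) with hμ
  -- The time variable is the elapsed time `τ`, in `(0, T - t]`; it is shifted to the absolute time
  -- `s = t + τ` at the end.
  set F : ℕ → ℝ × E d → ℝ := fun q p => r *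
    codeProd v ((S.mechanism c).getD q []) (t + p.1) p.2 with hF
  have hFm : ∀ q, Measurable (F q) := fun q => by
    have h1 : Measurable fun p : ℝ × E d => (t + p.1, p.2) := by fun_prop
    exact ((measurable_codeProd hv (choice_subset hc q)).comp h1).const_mul _
  set f : ℝ × E d → ℕ → ℝ := fun p q => (Iic (S.T - t)).indicator (fun s => (ρ s)⁻¹) p.1 *
    F q (p.1, x + √(2 * S.ν * p.1) • p.2) with hf
  have hfm : ∀ q, Measurable fun p => f p q := fun q => by
    have h1 : Measurable fun p : ℝ × E d => (p.1, x + √(2 * S.ν * p.1) • p.2) := by fun_prop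
    exact Measurable.mul ((hρm.inv.indicator measurableSet_Iic).comp measurable_fst)
      ((hFm q).comp h1)
  set g : (ℝ × E d) × ℝ → ℝ := fun p =>
    (Ioi (S.T - t)).indicator (fun _ => (tail ρ (S.T - t))⁻¹) p.1.1 *
      S.terminalValue c (x + √(2 * S.ν * (S.T - t)) • p.1.2) with hg
  obtain ⟨hg1, hg2⟩ := terminal_part (S := S) hρ ht.2.le htermi
  have hmp := measurePreserving_heatDraw (d := d) (ρ := ρ) hρ'
  have hstep : (fun D => S.step ρ ρ' D t x c fun _ => v) =
      (fun p : (ℝ × E d) × ℝ => g p + f p.1 ⌊(r : ℝ) * p.2⌋₊) ∘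
        fun D => ((D.1, D.2.2.1), D.2.2.2) := by
    funext D
    rw [step_heat hP]
    rfl
  have hcm := (measurable_uniform_choice hfm r).aestronglyMeasurable (μ := μ)
  have hgm : AEStronglyMeasurable (fun p : (ℝ × E d) × ℝ => g p + f p.1 ⌊(r : ℝ) * p.2⌋₊) μ :=
    hg1.1.add hcm
  rw [hstep, hmp.integrable_comp hgm] at hi
  -- The call is integrable as a whole and its horizon part separately, hence so is the branching
  -- part.
  have hfi : Integrable (fun p : (ℝ × E d) × ℝ => f p.1 ⌊(r : ℝ) * p.2⌋₊) μ := by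
    have := hi.sub hg1
    refine this.congr (Eventually.of_forall fun p => ?_)
    simp [hg]
  have hint : ∫ D, S.step ρ ρ' D t x c (fun _ => v) ∂(drawLaw d ρ ρ') =
      (∫ y : E d, heatKernel (2 * S.ν) (S.T - t) (y - x) * S.terminalValue c y) +
        ∫ p, f p.1 ⌊(r : ℝ) * p.2⌋₊ ∂μ := by
    rw [hstep, integral_comp_measurePreserving hmp hgm, ← integral_gaussian_shift hpos x, ← hg2,
      ← integral_add hg1 hfi]
  rw [hint]
  rcases Nat.eq_zero_or_pos r with h0 | h0
  · have hnil : S.mechanism c = [] := List.length_eq_zero_iff.1 h0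
    have : ∀ p q, f p q = 0 := fun p q => by simp [hf, hF, h0]
    simp [hnil, this]
  have hr0 : (r : ℝ) ≠ 0 := Nat.cast_ne_zero.2 h0.ne'
  obtain ⟨h1, h2⟩ := uniform_choice h0 hfi
  simp only [hf] at h1 h2
  have hI0 : I ⊆ Ioi 0 := inter_subset_right
  have h3 : ∀ q < r, Integrable (fun p : ℝ × E d => F q (p.1, x + √(2 * S.ν * p.1) • p.2))
      ((volume.restrict I).prod (stdGaussian (E d))) := fun q hq =>
    (integrable_densityLaw_iff hρ measurableSet_Iic).1 (h1 q hq)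
  have hFe : ∀ q (s : ℝ) (y : E d), heatKernel (2 * S.ν) s (y - x) * F q (s, y) =
      r * (heatKernel (2 * S.ν) s (y - x) *
        codeProd v ((S.mechanism c).getD q []) (t + s) y) := fun q s y => by
    simp only [hF]
    ring
  constructor
  · intro Z hZ
    obtain ⟨q, hq, rfl⟩ := List.getElem_of_mem hZ
    have h4 := integrable_gaussian_prod hν hIm hI0 x (hFm q) (h3 q hq)
    have h5 : ∀ p : ℝ × E d, heatKernel (2 * S.ν) p.1 (p.2 - x) * F q p = _ :=
      fun p => hFe q p.1 p.2
    simp only [h5] at h4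
    have h6 := h4.const_mul (r : ℝ)⁻¹
    simp only [inv_mul_cancel_left₀ hr0] at h6
    rw [List.getD_eq_getElem _ _ hq, hIe] at h6
    have h7 := ((measurePreserving_sub_Ioc t S.T).prod
      (MeasurePreserving.id (volume : Measure (E d)))).integrable_comp_of_integrable h6
    simpa only [Function.comp_def, Prod.map, id, add_sub_cancel] using h7
  · rw [h2, ← sum_mechanism]
    congr 1
    refine Finset.sum_congr rfl fun q hq => ?_
    rw [integral_densityLaw hρ measurableSet_Iic,
      integral_gaussian_prod hν hIm hI0 x (h3 q (Finset.mem_range.1 hq))]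
    simp only [hFe, integral_const_mul]
    rw [inv_mul_cancel_left₀ hr0, hIe, ← intervalIntegral.integral_of_le (sub_nonneg.2 ht.2.le),
      ← intervalIntegral.integral_of_le ht.2.le]
    have h8 := intervalIntegral.integral_comp_sub_right (a := t) (b := S.T) (fun s =>
      ∫ y, heatKernel (2 * S.ν) s (y - x) *
        codeProd v ((S.mechanism c).getD q []) (t + s) y) t
    rw [sub_self] at h8
    rw [← h8]
    simp only [add_sub_cancel]

/-- At `t = T` the lifetime is almost surely positive, so the call stops at once, with zero
displacement and normalisation `tail ρ 0 = 1`. -/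
theorem terminal_of_step (hρ : IsPositiveDensity ρ) (hρ' : IsPositiveDensity ρ')
    {c : Code d n} (hP : ¬ c.IsPoisson) (x : E d) :
    ∫ D, S.step ρ ρ' D S.T x c (fun _ => v) ∂(drawLaw d ρ ρ') = S.terminalValue c x := by
  have := isProbabilityMeasure_drawLaw (d := d) hρ hρ'
  have h : ∀ᵐ D ∂(drawLaw d ρ ρ'), S.step ρ ρ' D S.T x c (fun _ => v) = S.terminalValue c x := by
    have h1 : ∀ᵐ D ∂(drawLaw d ρ ρ'), 0 < D.1 :=
      Measure.quasiMeasurePreserving_fst.ae (p := fun s : ℝ => 0 < s) (ae_pos_densityLaw ρ)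
    filter_upwards [h1] with D hD
    rw [step_heat hP, sub_self, indicator_of_mem (mem_Ioi.2 hD),
      indicator_of_notMem (show D.1 ∉ Iic 0 from not_le.2 hD), tail_zero hρ]
    simp
  rw [integral_congr_ae h]
  simp

/-- A family that equals the mean of one call of the algorithm solves the integral system. -/
theorem isIntegralSolution_of_step (hρ : IsPositiveDensity ρ) (hρ' : IsPositiveDensity ρ')
    (hv : ∀ z ∈ S.codes, Measurable fun p : ℝ × E d => v z p.1 p.2)
    (htermi : ∀ c ∈ S.codes, ¬ c.IsPoisson → ∀ (x : E d) (a : ℝ),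
      Integrable (fun ξ => S.terminalValue c (x + a • ξ)) (stdGaussian (E d)))
    (hi : ∀ c ∈ S.codes, ∀ t ∈ Icc 0 S.T, ∀ x,
      Integrable (fun D => S.step ρ ρ' D t x c fun _ => v) (drawLaw d ρ ρ'))
    (he : ∀ c ∈ S.codes, ∀ t ∈ Icc 0 S.T, ∀ x,
      v c t x = ∫ D, S.step ρ ρ' D t x c (fun _ => v) ∂(drawLaw d ρ ρ')) :
    S.IsIntegralSolution v where
  poisson_integrable c hc hP t ht x := (poisson_of_step hρ hρ' hv hc hP (hi c hc t ht x)).1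
  poisson_eq c hc hP t ht x := by
    rw [he c hc t ht x, (poisson_of_step hρ hρ' hv hc hP (hi c hc t ht x)).2]
  terminal_integrable c hc hP t ht x :=
    (integrable_gaussian_shift_iff (mul_pos (by linarith [S.ν_pos]) (sub_pos.2 ht.2)) x).1
      (htermi c hc hP x _)
  source_integrable c hc hP t ht x :=
    (heat_of_step hρ hρ' hv hc hP ht (htermi c hc hP x _)
      (hi c hc t (Ico_subset_Icc_self ht) x)).1
  parabolic_eq c hc hP t ht x := by
    rw [he c hc t (Ico_subset_Icc_self ht) x]
    exact (heat_of_step hρ hρ' hv hc hP ht (htermi c hc hP x _)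
      (hi c hc t (Ico_subset_Icc_self ht) x)).2
  terminal_eq c hc hP x := by
    rw [he c hc S.T ⟨S.T_pos.le, le_rfl⟩ x, terminal_of_step hρ hρ' hP]

end PDESystem

/-! ### The expectations of the random tree solve the integral system. -/

namespace PDESystem

variable {S : PDESystem d n} {ρ ρ' : ℝ → ℝ}

namespace IsClassicalSolution

variable {u : Fin (d + 1) → ℝ → E d → ℝ}

theorem continuous_terminalValue (hu : S.IsClassicalSolution u)
    (hint : S.IntegrabilityConditions u) {c : Code d n} (hc : c ∈ S.codes) (hP : ¬ c.IsPoisson) :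
    Continuous (S.terminalValue c) := by
  have h : S.terminalValue c = S.eval c u S.T := funext fun x => hu.terminalValue_eq hP x
  rw [h]
  exact (hu.subGaussian_eval hint hc).continuous_space ⟨S.T_pos.le, le_rfl⟩

theorem integrable_terminalValue (hu : S.IsClassicalSolution u)
    (hint : S.IntegrabilityConditions u) {c : Code d n} (hc : c ∈ S.codes) (hP : ¬ c.IsPoisson)
    (x : E d) (a : ℝ) :
    Integrable (fun ξ => S.terminalValue c (x + a • ξ)) (stdGaussian (E d)) := by
  simp only [hu.terminalValue_eq hP]
  exact (hu.subGaussian_eval hint hc).integrable_shift ⟨S.T_pos.le, le_rfl⟩ x a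

end IsClassicalSolution

/-- A call with a code in `𝒞` consults only codes in `𝒞`. This matters because measurability of the
functional is known only for such codes. -/
theorem step_congr_codes {v w : Code d n → ℝ → E d → ℝ} (h : ∀ z ∈ S.codes, v z = w z)
    {c : Code d n} (hc : c ∈ S.codes) (D : ℝ × ℝ × E d × ℝ) (t : ℝ) (x : E d) :
    S.step ρ ρ' D t x c (fun _ => v) = S.step ρ ρ' D t x c (fun _ => w) := by
  have hZ : ∀ j : Fin (S.choice c D.2.2.2).length,
      v (S.choice c D.2.2.2)[j] = w (S.choice c D.2.2.2)[j] :=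
    fun j => h _ (choice_subset hc _ _ (List.getElem_mem _))
  unfold step
  simp only [hZ]

/-- The means of the functionals of the random tree solve the integral system. -/
theorem isIntegralSolution_tree (hρ : IsPositiveDensity ρ) (hρ' : IsPositiveDensity ρ')
    (hterm : ∀ c ∈ S.codes, ¬ c.IsPoisson → Measurable (S.terminalValue c))
    (htermi : ∀ c ∈ S.codes, ¬ c.IsPoisson → ∀ (x : E d) (a : ℝ),
      Integrable (fun ξ => S.terminalValue c (x + a • ξ)) (stdGaussian (E d)))
    {Ω : Type*} [MeasurableSpace Ω] {P : Measure Ω} {X : List ℕ → Ω → ℝ × ℝ × E d × ℝ}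
    (hlaw : ∀ l, HasLaw (X l) (drawLaw d ρ ρ') P) (hindep : iIndepFun X P)
    (hH : ∀ c ∈ S.codes, ∀ t ∈ Icc 0 S.T, ∀ x,
      Integrable (fun ω => S.treeFunctional ρ ρ' (fun l => X l ω) t x c) P) :
    S.IsIntegralSolution fun c t x =>
      ∫ ω, S.treeFunctional ρ ρ' (fun l => X l ω) t x c ∂P := by
  have := isProbabilityMeasure_drawLaw (d := d) hρ hρ'
  -- The integrals over `Ω` are transferred to the canonical product space of draws, where the
  -- grafting argument applies.
  set Q : Measure (List ℕ → ℝ × ℝ × E d × ℝ) := Measure.infinitePi fun _ => drawLaw d ρ ρ' with hQ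
  have hX : AEMeasurable (fun ω l => X l ω) P :=
    aemeasurable_pi_lambda _ fun l => (hlaw l).aemeasurable
  have hmap : P.map (fun ω l => X l ω) = Q := (hindep.hasLaw_infinitePi hlaw hX).map_eq
  have hm : ∀ c ∈ S.codes, ∀ (t : ℝ) (x : E d), AEStronglyMeasurable
      (fun m : List ℕ → ℝ × ℝ × E d × ℝ => S.treeFunctional ρ ρ' m t x c)
      (P.map fun ω l => X l ω) := fun c hc t x =>
    (measurable_treeFunctional_draws hρ hρ' hterm hc t x).aestronglyMeasurable
  have hmean : ∀ c ∈ S.codes, (fun t x => ∫ ω, S.treeFunctional ρ ρ' (fun l => X l ω) t x c ∂P) =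
      S.treeMean ρ ρ' Q c := fun c hc => by
    funext t x
    rw [treeMean, ← hmap, integral_map hX (hm c hc t x)]
  have hi : ∀ c ∈ S.codes, ∀ t ∈ Icc 0 S.T, ∀ x,
      Integrable (fun m => S.treeFunctional ρ ρ' m t x c) Q := fun c hc t ht x => by
    rw [← hmap]
    exact (integrable_map_measure (hm c hc t x) hX).2 (hH c hc t ht x)
  have hstep := fun c hc D t x => step_congr_codes (ρ := ρ) (ρ' := ρ') hmean (c := c) hc D t x
  refine isIntegralSolution_of_step hρ hρ' (fun c hc => ?_) htermi (fun c hc t ht x => ?_)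
    fun c hc t ht x => ?_
  · have h0 : (fun p : ℝ × E d => ∫ ω, S.treeFunctional ρ ρ' (fun l => X l ω) p.1 p.2 c ∂P) =
        fun p => S.treeMean ρ ρ' Q c p.1 p.2 :=
      funext fun p => congrFun (congrFun (hmean c hc) p.1) p.2
    rw [h0]
    have h1 : Measurable fun q : (ℝ × E d) × (List ℕ → ℝ × ℝ × E d × ℝ) => (q.2, q.1) :=
      measurable_snd.prodMk measurable_fst
    have h2 : StronglyMeasurable (Function.uncurry fun (p : ℝ × E d)
        (m : List ℕ → ℝ × ℝ × E d × ℝ) => S.treeFunctional ρ ρ' m p.1 p.2 c) :=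
      ((measurable_treeFunctional hρ hρ' hterm hc).comp h1).stronglyMeasurable
    exact h2.integral_prod_right.measurable
  · simp only [hstep c hc]
    exact (treeMean_eq hρ hρ' hterm hQ hc (hi c hc t ht x)).1
  · simp only [hstep c hc]
    exact (congrFun (congrFun (hmean c hc) t) x).trans
      (treeMean_eq hρ hρ' hterm hQ hc (hi c hc t ht x)).2

end PDESystem

end

end CodedTree

theorem mainTheorem1 {d n : ℕ} (hd : 2 ≤ d) (S : CodedTree.PDESystem d n)
    (u : Fin (d + 1) → ℝ → CodedTree.E d → ℝ)
    (hu : S.IsClassicalSolution u) (hint : S.IntegrabilityConditions u)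
    (ρ ρ' : ℝ → ℝ) (hρ : CodedTree.IsPositiveDensity ρ) (hρ' : CodedTree.IsPositiveDensity ρ')
    {Ω : Type*} [MeasurableSpace Ω] (P : Measure Ω) [IsProbabilityMeasure P]
    (X : List ℕ → Ω → ℝ × ℝ × CodedTree.E d × ℝ)
    (hlaw : ∀ l, HasLaw (X l) (CodedTree.drawLaw d ρ ρ') P) (hindep : iIndepFun X P)
    (hH : ∀ c ∈ S.codes, ∀ t ∈ Icc 0 S.T, ∀ x,
      Integrable (fun ω => S.treeFunctional ρ ρ' (fun l => X l ω) t x c) P)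
    -- uniqueness for the integral system, in some class of families that contains the two
    -- families of interest (for instance in the class of all families)
    (V : Set (CodedTree.Code d n → ℝ → CodedTree.E d → ℝ))
    (hVu : S.evalFamily u ∈ V)
    (hVH : (fun c t x => ∫ ω, S.treeFunctional ρ ρ' (fun l => X l ω) t x c ∂P) ∈ V)
    (huniq : ∀ v ∈ V, ∀ w ∈ V, S.IsIntegralSolution v → S.IsIntegralSolution w →
      ∀ c ∈ S.codes, ∀ t ∈ Icc 0 S.T, ∀ x, v c t x = w c t x) :
    ∀ i : Fin (d + 1), ∀ t ∈ Icc 0 S.T, ∀ x,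
      u i t x = ∫ ω, S.treeFunctional ρ ρ' (fun l => X l ω) t x (CodedTree.Code.ident i) ∂P := by
  have hterm : ∀ c ∈ S.codes, ¬ c.IsPoisson → Measurable (S.terminalValue c) :=
    fun c hc hP => (hu.continuous_terminalValue hint hc hP).measurable
  have htree := CodedTree.PDESystem.isIntegralSolution_tree hρ hρ' hterm
    (fun c hc hP x a => hu.integrable_terminalValue hint hc hP x a) hlaw hindep hH
  intro i t ht x
  -- Both families are solutions in the uniqueness class, hence agree on every code of `𝒞`, in
  -- particular on `Id_i`.
  exact huniq _ hVu _ hVH (hu.isIntegralSolution hd hint) htree (.ident i) trivial t ht x
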